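/- **Setting.** Let $d\ge 1$ and let $x_1,x_2,\dots$ be independent random points in $\mathbb R^d$ with density $p$. Assume that $p$ vanishes outside a compact set $C$, that $0<p_{\min}\le p\le p_{\max}$ on $C$, and that $p$ is twice differentiable in the interior of $C$ with bounded gradient there. Let $S$ be a hyperplane with unit normal $n_S$ and closed halfspaces $H^+$, $H^-$ (both containing $S$), each of positive probability. If $d=1$, assume that the point $S$ lies in the interior of $C$. If $d\ge2$, assume that - $\partial C$ is a smooth $(d-1)$-dimensional surface whose principal curvatures are bounded by $1/\kappa$ in absolute value for some $\kappa>0$; - there are $\gamma,r_\gamma>0$ with $\mathcal L_d(B(x,r)\cap C)\ge\gamma\,\mathcal L_d(B(x,r))$ for all $x\in C$ and $0<r\le r_\gamma$; - there is $\alpha\in(0,\pi/2)$ with $|\langle n_S,n_x\rangle|\le\cos\alpha$ for every $x\in S\cap\partial C$ and every unit normal $n_x$ of $\partial C$ at $x$. Let $\eta_k$ denote the volume of the unit ball of $\mathbb R^k$, with $\eta_0=1$. The $r$-neighborhood graph on $x_1,\dots,x_n$ joins distinct points at distance at most $r$. An edge between points at distance $u$ has weight $f(u)$, where $f\equiv1$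 (unweighted) or $f(u)=(2\pi\sigma^2)^{-d/2}\exp(-u^2/(2\sigma^2))$ (Gaussian weights of bandwidth $\sigma$). With $w(i,j)=0$ for pairs that are not joined, set $$\mathrm{cut}_n=\sum_{x_i\in H^+,\,x_j\in H^-}\bigl(w(i,j)+w(j,i)\bigr),\qquad \mathrm{vol}_n(H)=\sum_{x_i\in H}\sum_{j=1}^n w(i,j),$$ $$\mathrm{NCut}_n=\mathrm{cut}_n\Bigl(\tfrac1{\mathrm{vol}_n(H^+)}+\tfrac1{\mathrm{vol}_n(H^-)}\Bigr),\qquad \mathrm{CheegerCut}_n=\frac{\mathrm{cut}_n}{\min\{\mathrm{vol}_n(H^+),\mathrm{vol}_n(H^-)\}}.$$ For positive sequences $(r_n)$ and, with Gaussian weights, $(\sigma_n)$, the scalings and limits are as follows, where $\int_S$ is the $(d-1)$-dimensional surface integral (the value at the point $S$ if $d=1$). - Unweighted: $s_n^{cut}=n^2r_n^{d+1}$, $s_n^{vol}=n^2r_n^d$, $CutLim=\frac{2\eta_{d-1}}{d+1}\int_Sp^2$, $VolLim(H)=\eta_d\int_Hp^2$. - Gaussian, $r_n/\sigma_n\to\infty$: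 $s_n^{cut}=n^2\sigma_n$, $s_n^{vol}=n^2$, $CutLim=\frac{2}{\sqrt{2\pi}}\int_Sp^2$, $VolLim(H)=\int_Hp^2$. - Gaussian, $r_n/\sigma_n\to0$: $s_n^{cut}=\sigma_n^{-d}n^2r_n^{d+1}$, $s_n^{vol}=\sigma_n^{-d}n^2r_n^d$, $CutLim=\frac{2\eta_{d-1}}{(d+1)(2\pi)^{d/2}}\int_Sp^2$, $VolLim(H)=\frac{\eta_d}{(2\pi)^{d/2}}\int_Hp^2$. Let $NCutLim=\frac{CutLim}{VolLim(H^+)}+\frac{CutLim}{VolLim(H^-)}$ and $CheegerCutLim=\frac{CutLim}{\min\{VolLim(H^+),VolLim(H^-)\}}$. For $XCut=NCut$ or $XCut=CheegerCut$ put $$\Delta_n=\left|\frac{s_n^{vol}}{s_n^{cut}}XCut_n-XCutLim\right|.$$ **Theorem 2.** Let $XCut=NCut$ or $XCut=CheegerCut$. 1. *Unweighted graph.* If $r_n\to0$ and $nr_n^{d+1}/\log n\to\infty$, then $\Delta_n\to0$ almost surely. Suppose, in addition, that $\partial C$ is finite if $d=1$. Then for every $r_0>0$ and $r_n=r_0\sqrt[d+3]{\log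 n/n}$, almost surely $\Delta_n=O\bigl(\sqrt[d+3]{\log n/n}\bigr)$, with a non-random constant. This choice of $r_n$ is optimal in the following sense: there are constants $a,b>0$, not depending on $(r_n)$, such that, whenever $r_n\to0$ and $nr_n^{d+1}/\log n\to\infty$, almost surely $$\Delta_n\le a\,r_n+b\sqrt{\frac{\log n}{n\,r_n^{d+1}}}\quad\text{for all sufficiently large } n,$$ and there is an $r_0>0$ such that for every $n\ge2$ the bound $a\,r+b\sqrt{\log n/(n\,r^{d+1})}$ is minimal over all $r>0$ at $r=r_0\sqrt[d+3]{\log n/n}$. 2. *Gaussian weights, $r_n/\sigma_n\to\infty$.* If $r_n\to0$, $\sigma_n\to0$, $r_n/\sigma_n\to\infty$ and $n\sigma_n^{d+1}/\log n\to\infty$, then $\Delta_n\to0$ almost surely. 3. *Gaussian weights, $r_n/\sigma_n\to0$.* If $r_n\to0$, $\sigma_n\to0$, $r_n/\sigma_n\to0$ and $nr_n^{d+1}/\log n\to\infty$, then $\Delta_n\to0$ almost surely. -/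

import Mathlib

open MeasureTheory ProbabilityTheory Filter Topology Set

noncomputable section

namespace GraphCut

/-- The Euclidean space `ℝᵈ`. -/
abbrev E (d : ℕ) : Type := EuclideanSpace ℝ (Fin d)

/-- The volume `η_d` of the Euclidean unit ball of `ℝᵈ`. -/
def ballVolume (d : ℕ) : ℝ := volume.real (Metric.closedBall (0 : E d) 1)

/-! ### Hyperplanes -/

/-- A hyperplane `{x | ⟪normal, x⟫ = offset}` of `ℝᵈ`, oriented by its unit normal. -/
structure Hyperplane (d : ℕ) where
  normal : E d
  norm_normal : ‖normal‖ = 1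
  offset : ℝ

/-- The points of the hyperplane. -/
def Hyperplane.carrier {d : ℕ} (S : Hyperplane d) : Set (E d) :=
  {x | inner ℝ S.normal x = S.offset}

/-- The closed halfspace `H⁺`, into which the normal points. -/
def Hyperplane.pos {d : ℕ} (S : Hyperplane d) : Set (E d) :=
  {x | S.offset ≤ inner ℝ S.normal x}

/-- The closed halfspace `H⁻`. -/
def Hyperplane.neg {d : ℕ} (S : Hyperplane d) : Set (E d) :=
  {x | inner ℝ S.normal x ≤ S.offset}

/-! ### Smooth hypersurfaces of `ℝᵈ` -/

/-- Near `x`, the set `M` is the zero set of the smooth function `φ`, whose gradient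
does not vanish there. -/
def IsLocalDefiningFunction {d : ℕ} (M : Set (E d)) (x : E d) (φ : E d → ℝ) : Prop :=
  ∃ U : Set (E d), IsOpen U ∧ x ∈ U ∧ ContDiffOn ℝ ((⊤ : ℕ∞) : WithTop ℕ∞) φ U ∧
    (∀ y ∈ U, y ∈ M ↔ φ y = 0) ∧ ∀ y ∈ U, gradient φ y ≠ 0

/-- `M` is a smooth embedded `(d-1)`-dimensional surface. -/
def IsSmoothHypersurface {d : ℕ} (M : Set (E d)) : Prop :=
  ∀ x ∈ M, ∃ φ : E d → ℝ, IsLocalDefiningFunction M x φ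

/-- `v` is one of the two unit normals of the hypersurface `M` at `x`. -/
def IsUnitNormal {d : ℕ} (M : Set (E d)) (x v : E d) : Prop :=
  ‖v‖ = 1 ∧ ∃ φ : E d → ℝ, IsLocalDefiningFunction M x φ ∧ ∃ c : ℝ, gradient φ x = c • v

/-- The principal curvatures of the hypersurface `M` are bounded by `1 / κ` in absolute value:
the second fundamental form at `x` is, up to sign, `v ↦ D²φ(x)(v, v) / ‖∇φ(x)‖` on the tangent
space `{v | ⟪∇φ(x), v⟫ = 0}`, and the principal curvatures are its eigenvalues. -/
def PrincipalCurvaturesBounded {d : ℕ} (M : Set (E d)) (κ : ℝ) : Prop :=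
  ∀ x ∈ M, ∀ φ : E d → ℝ, IsLocalDefiningFunction M x φ →
    ∀ v : E d, inner ℝ (gradient φ x) v = 0 →
      |iteratedFDeriv ℝ 2 φ x ![v, v]| ≤ 1 / κ * ‖gradient φ x‖ * ‖v‖ ^ 2

/-! ### The density and the standing assumptions -/

/-- The measure `μ(A) = ∫_A p(x) dx`. -/
def densityMeasure {d : ℕ} (p : E d → ℝ) : Measure (E d) :=
  volume.withDensity fun x => ENNReal.ofReal (p x)

/-- The standing assumptions on the density `p`, its compact support `C` and the
hyperplane `S`. -/
structure GeneralAssumptions {d : ℕ} (p : E d → ℝ) (C : Set (E d)) (S : Hyperplane d) :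
    Prop where
  measurable : Measurable p
  compact : IsCompact C
  eq_zero : ∀ x, x ∉ C → p x = 0
  bounds : ∃ pmin pmax : ℝ, 0 < pmin ∧ ∀ x ∈ C, pmin ≤ p x ∧ p x ≤ pmax
  differentiable : DifferentiableOn ℝ p (interior C)
  twice_differentiable : DifferentiableOn ℝ (fderiv ℝ p) (interior C)
  gradient_bounded : ∃ pmax' : ℝ, ∀ x ∈ interior C, ‖gradient p x‖ ≤ pmax'
  mass_pos : 0 < densityMeasure p S.pos
  mass_neg : 0 < densityMeasure p S.neg
  boundary_smooth : 2 ≤ d → IsSmoothHypersurface (frontier C)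
  boundary_curvature : 2 ≤ d → ∃ κ : ℝ, 0 < κ ∧ PrincipalCurvaturesBounded (frontier C) κ
  boundary_thick : 2 ≤ d → ∃ γ rγ : ℝ, 0 < γ ∧ 0 < rγ ∧ ∀ r : ℝ, 0 < r → r ≤ rγ →
    ∀ x ∈ C, γ * volume.real (Metric.closedBall x r) ≤ volume.real (Metric.closedBall x r ∩ C)
  transversal : 2 ≤ d → ∃ α : ℝ, 0 < α ∧ α < Real.pi / 2 ∧
    ∀ x ∈ S.carrier ∩ frontier C, ∀ v : E d, IsUnitNormal (frontier C) x v →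
      |inner ℝ S.normal v| ≤ Real.cos α
  interior_of_one_dim : d = 1 → S.carrier ⊆ interior C

/-- `X 0, X 1, …` are independent random points with density `p`. -/
def IsIIDSample {d : ℕ} {Ω : Type*} [MeasurableSpace Ω] (P : Measure Ω) (p : E d → ℝ)
    (X : ℕ → Ω → E d) : Prop :=
  (∀ i, Measurable (X i)) ∧ iIndepFun X P ∧ ∀ i, P.map (X i) = densityMeasure p

/-! ### Weighted graphs, cut and volume -/

/-- `cut(A, B)` of the two parts of a partition of the vertices, for the weights `w`. -/
def cut {V : Type*} (w : V → V → ℝ) (A B : Finset V) : ℝ :=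
  ∑ u ∈ A, ∑ v ∈ B, (w u v + w v u)

/-- `vol(A)`, the sum of the weights of all the edges that originate in `A`. -/
def vol {V : Type*} [Fintype V] (w : V → V → ℝ) (A : Finset V) : ℝ :=
  ∑ u ∈ A, ∑ v, w u v

/-- The two graph clustering quality measures. -/
inductive Quality where
  | ncut
  | cheegerCut

/-- The quality measure in terms of the cut `c` and the volumes `v₁`, `v₂` of the two parts. -/
def Quality.value : Quality → ℝ → ℝ → ℝ → ℝ
  | .ncut, c, v₁, v₂ => c * (1 / v₁ + 1 / v₂)
  | .cheegerCut, c, v₁, v₂ => c / min v₁ v₂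

/-- The quality measure of the partition `(A, B)` of the vertices of a weighted graph. -/
def Quality.ofGraph {V : Type*} [Fintype V] (q : Quality) (w : V → V → ℝ) (A B : Finset V) : ℝ :=
  q.value (cut w A B) (vol w A) (vol w B)

open Classical in
/-- The weights of the `r`-neighborhood graph on the points `x` with weight function `f`;
there are no loops, and a missing edge has weight `0`. -/
def rGraphWeight {d n : ℕ} (f : ℝ → ℝ) (r : ℝ) (x : Fin n → E d) (i j : Fin n) : ℝ :=
  if i ≠ j ∧ dist (x i) (x j) ≤ r then f (dist (x i) (x j)) else 0

open Classical in
/-- The sample points (their indices) that lie in `H`. -/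
def pointsIn {d n : ℕ} (x : Fin n → E d) (H : Set (E d)) : Finset (Fin n) :=
  Finset.univ.filter fun i => x i ∈ H

/-- The Gaussian weight function with bandwidth `σ`. -/
def gaussianWeight (d : ℕ) (σ u : ℝ) : ℝ :=
  1 / (2 * Real.pi * σ ^ 2) ^ ((d : ℝ) / 2) * Real.exp (-(1 / 2) * (u ^ 2 / σ ^ 2))

/-! ### Scaling sequences and limits -/

/-- The three settings: unit weights, Gaussian weights of bandwidth `σ` that is
dominated by the radius (`r / σ → ∞`), and Gaussian weights of bandwidth `σ` that dominates
the radius (`r / σ → 0`). -/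
inductive Weighting where
  | unweighted
  | gaussianLargeRadius (σ : ℝ)
  | gaussianSmallRadius (σ : ℝ)

namespace Weighting

/-- The weight function. -/
def weight (d : ℕ) : Weighting → ℝ → ℝ
  | unweighted => fun _ => 1
  | gaussianLargeRadius σ => gaussianWeight d σ
  | gaussianSmallRadius σ => gaussianWeight d σ

/-- The scaling `s_n^cut`. -/
def cutScale (d n : ℕ) (r : ℝ) : Weighting → ℝ
  | unweighted => (n : ℝ) ^ 2 * r ^ (d + 1)
  | gaussianLargeRadius σ => (n : ℝ) ^ 2 * σ
  | gaussianSmallRadius σ => (σ ^ d)⁻¹ * (n : ℝ) ^ 2 * r ^ (d + 1)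

/-- The scaling `s_n^vol`. -/
def volScale (d n : ℕ) (r : ℝ) : Weighting → ℝ
  | unweighted => (n : ℝ) ^ 2 * r ^ d
  | gaussianLargeRadius _ => (n : ℝ) ^ 2
  | gaussianSmallRadius σ => (σ ^ d)⁻¹ * (n : ℝ) ^ 2 * r ^ d

/-- The factor of `∫_S p²` in the limit of the cut. -/
def cutFactor (d : ℕ) : Weighting → ℝ
  | unweighted => 2 * ballVolume (d - 1) / (d + 1)
  | gaussianLargeRadius _ => 2 / Real.sqrt (2 * Real.pi)
  | gaussianSmallRadius _ =>
      2 * ballVolume (d - 1) / ((d + 1) * (2 * Real.pi) ^ ((d : ℝ) / 2))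

/-- The factor of `∫_H p²` in the limit of the volume. -/
def volFactor (d : ℕ) : Weighting → ℝ
  | unweighted => ballVolume d
  | gaussianLargeRadius _ => 1
  | gaussianSmallRadius _ => ballVolume d / (2 * Real.pi) ^ ((d : ℝ) / 2)

end Weighting

/-- `CutLim`; the integral is the `(d-1)`-dimensional surface integral along `S` (for `d = 1`
the value at the point `S`). -/
def cutLim {d : ℕ} (W : Weighting) (p : E d → ℝ) (S : Hyperplane d) : ℝ :=
  W.cutFactor d * ∫ s in S.carrier, p s ^ 2 ∂(Measure.euclideanHausdorffMeasure (d - 1))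

/-- `VolLim(H)`. -/
def volLim {d : ℕ} (W : Weighting) (p : E d → ℝ) (H : Set (E d)) : ℝ :=
  W.volFactor d * ∫ x in H, p x ^ 2

/-- `NCutLim` or `CheegerCutLim`. -/
def Quality.limit {d : ℕ} (q : Quality) (W : Weighting) (p : E d → ℝ) (S : Hyperplane d) : ℝ :=
  q.value (cutLim W p S) (volLim W p S.pos) (volLim W p S.neg)

/-- `Δ_n = |(s_n^vol / s_n^cut) XCut_n - XCutLim|` for the `r`-neighborhood graph on the points
`x 0, …, x (n-1)` and its partition by the hyperplane `S`. -/
def deviation {d : ℕ} (q : Quality) (W : Weighting) (p : E d → ℝ) (S : Hyperplane d)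
    (n : ℕ) (r : ℝ) (x : ℕ → E d) : ℝ :=
  let y : Fin n → E d := fun i => x i
  |W.volScale d n r / W.cutScale d n r *
      q.ofGraph (rGraphWeight (W.weight d) r y) (pointsIn y S.pos) (pointsIn y S.neg) -
    q.limit W p S|

/-- The rate `(log n / n)^(1 / (d + 3))`. -/
def rate (d n : ℕ) : ℝ := (Real.log n / n) ^ (1 / ((d : ℝ) + 3))

/-- The sum of a bias bound `a r` and a bound `b √(log n / (n r^(d+1)))` on the
fluctuations, for `n` points and radius `r`. -/
def errorBound (d : ℕ) (a b : ℝ) (n : ℕ) (r : ℝ) : ℝ :=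
  a * r + b * Real.sqrt (Real.log n / (n * r ^ (d + 1)))

end GraphCut

end

/-!
# Limits of the normalized cut and of the Cheeger cut of random neighborhood graphs

Up to the factor two for the cut, the cut and the two volumes are sums over the ordered pairs of
distinct sample points of kernels `1_A(x) 1_{A'}(y) k(y - x)`, where `k` is the edge weight as a
function of the difference vector. The deviation of the quality measure is therefore controlled by
the fluctuations of three pair sums around their means, by the bias of these means, and by the fact
that both quality measures are Lipschitz near limits with positive volumes
(`Quality.exists_lipschitz`).

*Fluctuations.* Grouping the pairs `{i, j}` by the residue of `i + j` modulo `n` splits them into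
`n` matchings, and the terms of a sum over a matching are independent. A Chernoff bound in which
the variance is controlled by the mean, a union bound over the matchings and the Borel-Cantelli
lemma give the almost sure rate `√(log n / (n ρ))` (`pairSum_concentration`), where `1 / ρ` bounds
the ratio of the supremum of the kernel to its scale.

*Bias.* By the substitution `y = x + z` the mean of a kernel is the integral of `k(z)` against the
correlation `∫_{x ∈ A, x + z ∈ A'} p(x) p(x + z) dx`, and only `‖z‖ ≤ r` matters. For the volumes
the correlation tends to `∫_H p²` as `z → 0` by continuity of translation in `L¹`. For the cut it is
computed in coordinates along the normal of `S` and along `S`: it is the width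
`max (-⟪n_S, z⟫) 0` of a strip times `∫_S p²`, with a relative error `O(‖z‖)`
(`GeneralAssumptions.exists_abs_corr_cut_sub_le`). Here `p` is Lipschitz on balls that do not meet
`∂C`, and the part of `S` close to `∂C` is small: if a function that vanishes on `∂C` grows in some
direction along `S`, then a `ρ`-neighborhood of `∂C` meets each line in `S` with that direction in a
segment of length `O(ρ)`, and `1 / ρ` disjoint translates of its trace on `S` fit into a bounded set
(`exists_measure_layer_le`). It is the transversality of `S` and `∂C` that provides the direction.
The same argument without `S` bounds the volume of the whole `ρ`-neighborhood of `∂C` and makes the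
correlations for the volumes Lipschitz at `0`, which yields the rate for unit weights.

*Constants.* What remains are the integrals of `k` and of `k` times the width. For unit weights they
are explicit, for Gaussian weights of small bandwidth they converge after rescaling to Gaussian
moments, and for Gaussian weights of large bandwidth the weight is nearly constant on its support.

*Optimal radius.* On multiples `u` of the rate the error bound is the rate times
`a u + b u ^ (-(d + 1) / 2)`, which is minimal where the tangent of the second summand has
slope `-a`.
-/

noncomputable section

namespace GraphCut

/-! ### Decomposition of the pairs of indices into matchings -/

/-- The pairs `(i, j)` with `i < j < n`. -/
def increasingPairs (n : ℕ) : Finset (ℕ × ℕ) :=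
  (Finset.range n ×ˢ Finset.range n).filter fun p => p.1 < p.2

lemma mem_increasingPairs {n : ℕ} {p : ℕ × ℕ} :
    p ∈ increasingPairs n ↔ p.1 < p.2 ∧ p.2 < n := by
  simp only [increasingPairs, Finset.mem_filter, Finset.mem_product, Finset.mem_range]
  omega

/-- The sum over all ordered pairs of distinct indices below `n`. -/
def pairSum {α : Type*} (n : ℕ) (h : α → α → ℝ) (x : ℕ → α) : ℝ :=
  ∑ p ∈ (Finset.range n).offDiag, h (x p.1) (x p.2)

lemma pairSum_eq {α : Type*} (n : ℕ) (h : α → α → ℝ) (x : ℕ → α) :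
    pairSum n h x
      = ∑ p ∈ increasingPairs n, (h (x p.1) (x p.2) + h (x p.2) (x p.1)) := by
  have h1 : (Finset.range n).offDiag
      = increasingPairs n ∪ (increasingPairs n).map (Equiv.prodComm ℕ ℕ).toEmbedding := by
    ext ⟨i, j⟩
    simp only [Finset.mem_offDiag, Finset.mem_range, Finset.mem_union, Finset.mem_map,
      mem_increasingPairs, Prod.exists, Equiv.coe_toEmbedding, Equiv.prodComm_apply,
      Prod.swap_prod_mk, Prod.mk.injEq]
    constructor
    · rintro ⟨hi, hj, hne⟩
      rcases lt_or_gt_of_ne hne with h | h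
      · exact Or.inl ⟨h, hj⟩
      · exact Or.inr ⟨j, i, ⟨h, hi⟩, rfl, rfl⟩
    · rintro (h | ⟨a, b, h, rfl, rfl⟩) <;> omega
  have h2 : Disjoint (increasingPairs n)
      ((increasingPairs n).map (Equiv.prodComm ℕ ℕ).toEmbedding) := by
    rw [Finset.disjoint_left]
    rintro ⟨i, j⟩ hp hq
    simp only [Finset.mem_map, mem_increasingPairs, Prod.exists, Equiv.coe_toEmbedding,
      Equiv.prodComm_apply, Prod.swap_prod_mk, Prod.mk.injEq] at hp hq
    obtain ⟨a, b, h, rfl, rfl⟩ := hq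
    omega
  rw [pairSum, h1, Finset.sum_union h2, Finset.sum_map, ← Finset.sum_add_distrib]
  rfl

lemma card_increasingPairs (n : ℕ) :
    ((increasingPairs n).card : ℝ) = n * (n - 1) / 2 := by
  have h := pairSum_eq n (fun _ _ : ℕ => (1 : ℝ)) id
  simp only [pairSum, Finset.sum_const, nsmul_eq_mul, mul_one, Finset.offDiag_card,
    Finset.card_range] at h
  rw [Nat.cast_sub (Nat.le_mul_self n)] at h
  push_cast at h
  linarith

/-- The pairs whose sum is a given residue modulo `n`: a matching. As the residue varies, these
matchings partition all the pairs. -/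
def residueMatching (n k : ℕ) : Finset (ℕ × ℕ) :=
  (increasingPairs n).filter fun p => (p.1 + p.2) % n = k

lemma residueMatching_disjoint {n k : ℕ} {p q : ℕ × ℕ} (hp : p ∈ residueMatching n k)
    (hq : q ∈ residueMatching n k) (hpq : p ≠ q) :
    p.1 ≠ q.1 ∧ p.1 ≠ q.2 ∧ p.2 ≠ q.1 ∧ p.2 ≠ q.2 := by
  obtain ⟨a, b⟩ := p
  obtain ⟨c, e⟩ := q
  simp only [residueMatching, Finset.mem_filter, mem_increasingPairs] at hp hq
  have key : ∀ x y z : ℕ, y < n → z < n → (x + y) % n = k → (x + z) % n = k → y = z :=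
    fun x y z hy hz h1 h2 =>
      (Nat.ModEq.add_left_cancel' x (show (x + y) ≡ (x + z) [MOD n] from h1.trans h2.symm)
        ).eq_of_lt_of_lt hy hz
  refine ⟨?_, ?_, ?_, ?_⟩ <;> rintro h <;> simp only at h <;> subst h
  · exact hpq (by rw [key a b e (by omega) (by omega) hp.2 hq.2])
  · have := key a b c (by omega) (by omega) hp.2 (by rw [add_comm]; exact hq.2)
    omega
  · have := key b a e (by omega) (by omega) (by rw [add_comm]; exact hp.2) hq.2
    omega
  · exact hpq (by
      rw [key b a c (by omega) (by omega) (by rw [add_comm]; exact hp.2)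
        (by rw [add_comm]; exact hq.2)])

lemma card_residueMatching_le (n k : ℕ) : (residueMatching n k).card ≤ n := by
  calc (residueMatching n k).card ≤ (Finset.range n).card := by
        refine Finset.card_le_card_of_injOn Prod.fst (fun p hp => ?_) fun p hp q hq h => ?_
        · have := mem_increasingPairs.1 (Finset.mem_filter.1 hp).1
          simp only [Finset.coe_range, mem_Iio]
          omega
        · by_contra hne
          exact (residueMatching_disjoint hp hq hne).1 h
    _ = n := Finset.card_range n

/-! ### Concentration of sums over pairs -/

section Concentration

variable {Ω α : Type*} [MeasurableSpace Ω] [MeasurableSpace α]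

/-- Bernstein-type bound: the second moment of `Y` is at most `M E[Y]`. -/
lemma mgf_le_of_mem_Icc {P : Measure Ω} [IsProbabilityMeasure P] {Y : Ω → ℝ} {M s : ℝ}
    (hY : Measurable Y) (h0 : ∀ ω, 0 ≤ Y ω) (hM : ∀ ω, Y ω ≤ M) (hs : |s| * M ≤ 1) :
    mgf Y P s ≤ Real.exp ((s + s ^ 2 * M) * ∫ ω, Y ω ∂P) := by
  have hb : ∀ ω, |s * Y ω| ≤ 1 := fun ω => by
    rw [abs_mul, abs_of_nonneg (h0 ω)]
    exact (mul_le_mul_of_nonneg_left (hM ω) (abs_nonneg s)).trans hs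
  have hYi : Integrable Y P := Integrable.of_bound hY.aestronglyMeasurable M
    (ae_of_all _ fun ω => by rw [Real.norm_eq_abs, abs_of_nonneg (h0 ω)]; exact hM ω)
  have hle : mgf Y P s ≤ ∫ ω, (1 + (s + s ^ 2 * M) * Y ω) ∂P := by
    refine integral_mono ?_ ((integrable_const _).add (hYi.const_mul _)) fun ω => ?_
    · refine Integrable.of_bound (by fun_prop) (Real.exp 1) (ae_of_all _ fun ω => ?_)
      rw [Real.norm_eq_abs, abs_of_pos (Real.exp_pos _)]
      exact Real.exp_le_exp.2 (le_of_abs_le (hb ω))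
    · have h1 := le_of_abs_le (Real.abs_exp_sub_one_sub_id_le (hb ω))
      have h2 : (s * Y ω) ^ 2 ≤ s ^ 2 * M * Y ω := by
        have := mul_le_mul_of_nonneg_left (hM ω) (mul_nonneg (sq_nonneg s) (h0 ω))
        nlinarith
      simp only
      nlinarith
  refine hle.trans ?_
  rw [integral_add (integrable_const _) (hYi.const_mul _), integral_const_mul]
  simp only [integral_const, probReal_univ, smul_eq_mul, mul_one]
  linarith [Real.add_one_le_exp ((s + s ^ 2 * M) * ∫ ω, Y ω ∂P)]

/-- Two members of an i.i.d. sequence are distributed like the product of the common law. -/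
lemma map_pair_eq {P : Measure Ω} [IsProbabilityMeasure P] {X : ℕ → Ω → α} {ν : Measure α}
    (hX : ∀ i, Measurable (X i)) (hind : iIndepFun X P) (hν : ∀ i, P.map (X i) = ν)
    {i j : ℕ} (hij : i ≠ j) : P.map (fun ω => (X i ω, X j ω)) = ν.prod ν := by
  have := (indepFun_iff_map_prod_eq_prod_map_map (hX i).aemeasurable (hX j).aemeasurable).1
    (hind.indepFun hij)
  rw [this, hν, hν]

/-- Over a matching, that is over pairwise disjoint pairs of indices, the terms `h (X i) (X j)`
are independent, so the moment generating function of their sum is a product. -/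
lemma mgf_sum_matching {P : Measure Ω} [IsProbabilityMeasure P] {X : ℕ → Ω → α}
    (hX : ∀ i, Measurable (X i)) (hind : iIndepFun X P) {h : α → α → ℝ}
    (hh : Measurable (Function.uncurry h)) (t : ℝ) (s : Finset (ℕ × ℕ))
    (hs : ∀ p ∈ s, ∀ q ∈ s, p ≠ q →
      p.1 ≠ q.1 ∧ p.1 ≠ q.2 ∧ p.2 ≠ q.1 ∧ p.2 ≠ q.2) :
    mgf (fun ω => ∑ p ∈ s, h (X p.1 ω) (X p.2 ω)) P t
      = ∏ p ∈ s, mgf (fun ω => h (X p.1 ω) (X p.2 ω)) P t := by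
  have hmeas : ∀ p : ℕ × ℕ, Measurable fun ω => h (X p.1 ω) (X p.2 ω) := fun p =>
    hh.comp ((hX p.1).prodMk (hX p.2))
  induction s using Finset.induction_on with
  | empty => simp
  | insert a s ha ih =>
    have ih' := ih fun p hp q hq => hs p (Finset.mem_insert_of_mem hp) q
      (Finset.mem_insert_of_mem hq)
    rw [Finset.prod_insert ha, ← ih']
    have hsum : (fun ω => ∑ p ∈ insert a s, h (X p.1 ω) (X p.2 ω))
        = (fun ω => h (X a.1 ω) (X a.2 ω)) + fun ω => ∑ p ∈ s, h (X p.1 ω) (X p.2 ω) := by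
      ext ω
      simp [Finset.sum_insert ha]
    rw [hsum]
    refine IndepFun.mgf_add ?_ ((hmeas a).const_mul t).exp.aestronglyMeasurable
      ((Finset.measurable_sum s fun p _ => hmeas p).const_mul t).exp.aestronglyMeasurable
    let m : ℕ → MeasurableSpace Ω := fun i => MeasurableSpace.comap (X i) inferInstance
    have hm : ∀ (T : Set ℕ) (i : ℕ), i ∈ T → Measurable[⨆ i ∈ T, m i] (X i) := fun T i hi =>
      (comap_measurable (X i)).mono (le_iSup₂_of_le i hi le_rfl) le_rfl
    have hdisj : Disjoint ({a.1, a.2} : Set ℕ) {i | ∃ p ∈ s, i = p.1 ∨ i = p.2} := by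
      rw [Set.disjoint_left]
      rintro i hi ⟨p, hp, hip⟩
      have hne : a ≠ p := fun h => ha (h ▸ hp)
      have := hs a (Finset.mem_insert_self _ _) p (Finset.mem_insert_of_mem hp) hne
      rcases hi with hi | hi <;> rcases hip with hip | hip <;> simp_all
    have hI := indep_iSup_of_disjoint (fun i => (hX i).comap_le) hind.iIndep hdisj
    rw [IndepFun_iff_Indep]
    refine indep_of_indep_of_le_left (indep_of_indep_of_le_right hI ?_) ?_
    · refine Measurable.comap_le ?_
      refine Finset.measurable_sum s fun p hp => ?_
      exact hh.comp ((hm {i | ∃ p ∈ s, i = p.1 ∨ i = p.2} p.1 ⟨p, hp, Or.inl rfl⟩).prodMk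
        (hm {i | ∃ p ∈ s, i = p.1 ∨ i = p.2} p.2 ⟨p, hp, Or.inr rfl⟩))
    · refine Measurable.comap_le ?_
      exact hh.comp ((hm {a.1, a.2} a.1 (by simp)).prodMk (hm {a.1, a.2} a.2 (by simp)))

/-- Chernoff bound for the sum over a matching of at most `n` pairs. -/
lemma measure_matching_deviation_le {P : Measure Ω} [IsProbabilityMeasure P] {X : ℕ → Ω → α}
    {ν : Measure α} (hX : ∀ i, Measurable (X i)) (hind : iIndepFun X P)
    (hν : ∀ i, P.map (X i) = ν) {h : α → α → ℝ} (hh : Measurable (Function.uncurry h))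
    {M m ε : ℝ} (hM0 : 0 < M) (h0 : ∀ x y, 0 ≤ h x y) (hM : ∀ x y, h x y ≤ M)
    (hm : ∫ z, h z.1 z.2 ∂(ν.prod ν) ≤ m) (hε0 : 0 < ε) (hε : ε ≤ 2) {n : ℕ}
    (s : Finset (ℕ × ℕ)) (hsn : s.card ≤ n) (hne : ∀ p ∈ s, p.1 ≠ p.2)
    (hs : ∀ p ∈ s, ∀ q ∈ s, p ≠ q →
      p.1 ≠ q.1 ∧ p.1 ≠ q.2 ∧ p.2 ≠ q.1 ∧ p.2 ≠ q.2) :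
    P.real {ω | n * ε * m ≤
        |∑ p ∈ s, h (X p.1 ω) (X p.2 ω) - s.card * ∫ z, h z.1 z.2 ∂(ν.prod ν)|}
      ≤ 2 * Real.exp (-(ε ^ 2 * (n * m) / (4 * M))) := by
  set θ := ∫ z, h z.1 z.2 ∂(ν.prod ν) with hθ
  set Y : Ω → ℝ := fun ω => ∑ p ∈ s, h (X p.1 ω) (X p.2 ω) with hY
  have hmeas : ∀ p : ℕ × ℕ, Measurable fun ω => h (X p.1 ω) (X p.2 ω) := fun p =>
    hh.comp ((hX p.1).prodMk (hX p.2))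
  have hYm : Measurable Y := Finset.measurable_sum s fun p _ => hmeas p
  have hθ0 : 0 ≤ θ := integral_nonneg fun z => h0 _ _
  have hmean : ∀ p ∈ s, ∫ ω, h (X p.1 ω) (X p.2 ω) ∂P = θ := fun p hp => by
    rw [hθ, ← map_pair_eq hX hind hν (hne p hp)]
    exact (integral_map (f := Function.uncurry h) ((hX _).prodMk (hX _)).aemeasurable
      hh.aestronglyMeasurable).symm
  have hint : ∀ t : ℝ, Integrable (fun ω => Real.exp (t * Y ω)) P := fun t => by
    refine Integrable.of_bound (by fun_prop) (Real.exp (|t| * (s.card * M)))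
      (ae_of_all _ fun ω => ?_)
    rw [Real.norm_eq_abs, abs_of_pos (Real.exp_pos _)]
    have hYle : Y ω ≤ s.card * M := by
      simpa using Finset.sum_le_card_nsmul s (fun p => h (X p.1 ω) (X p.2 ω)) M
        fun p _ => hM _ _
    have hY0 : 0 ≤ Y ω := Finset.sum_nonneg fun p _ => h0 _ _
    refine Real.exp_le_exp.2 ((le_abs_self _).trans ?_)
    rw [abs_mul, abs_of_nonneg hY0]
    gcongr
  have hmgf : ∀ t : ℝ, |t| * M ≤ 1 → mgf Y P t ≤ Real.exp (s.card * ((t + t ^ 2 * M) * θ)) := by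
    intro t ht
    rw [hY, mgf_sum_matching hX hind hh t s hs, Real.exp_nat_mul]
    refine (Finset.prod_le_prod (fun _ _ => mgf_nonneg) fun p hp => ?_).trans_eq
      (Finset.prod_const _)
    rw [← hmean p hp]
    exact mgf_le_of_mem_Icc (hmeas p) (fun ω => h0 _ _) (fun ω => hM _ _) ht
  -- the minimizer of the exponent `-t n ε m + t² M n m`
  set t : ℝ := ε / (2 * M) with ht
  have ht0 : 0 < t := by positivity
  have htM : t * M = ε / 2 := by rw [ht]; field_simp
  have hm0 : 0 ≤ m := hθ0.trans hm
  have hcard : (s.card : ℝ) * θ ≤ n * m := by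
    have : (s.card : ℝ) ≤ n := by exact_mod_cast hsn
    gcongr
  have hkey : -(t * (n * ε * m)) + t ^ 2 * M * (s.card * θ) ≤ -(ε ^ 2 * (n * m) / (4 * M)) := by
    have h1 : t ^ 2 * M * (s.card * θ) ≤ t ^ 2 * M * (n * m) := by gcongr
    have h2 : -(t * (n * ε * m)) + t ^ 2 * M * (n * m) = -(ε ^ 2 * (n * m) / (4 * M)) := by
      rw [ht]; field_simp; ring
    linarith
  have hup : P.real {ω | s.card * θ + n * ε * m ≤ Y ω}
      ≤ Real.exp (-(ε ^ 2 * (n * m) / (4 * M))) := by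
    refine (measure_ge_le_exp_mul_mgf _ ht0.le (hint t)).trans ?_
    refine (mul_le_mul_of_nonneg_left (hmgf t ?_) (Real.exp_pos _).le).trans ?_
    · rw [abs_of_pos ht0, htM]; linarith
    · rw [← Real.exp_add]
      refine Real.exp_le_exp.2 (le_trans (le_of_eq ?_) hkey)
      ring
  have hlow : P.real {ω | Y ω ≤ s.card * θ - n * ε * m}
      ≤ Real.exp (-(ε ^ 2 * (n * m) / (4 * M))) := by
    refine (measure_le_le_exp_mul_mgf _ (neg_nonpos.2 ht0.le) (hint (-t))).trans ?_
    refine (mul_le_mul_of_nonneg_left (hmgf (-t) ?_) (Real.exp_pos _).le).trans ?_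
    · rw [abs_neg, abs_of_pos ht0, htM]; linarith
    · rw [← Real.exp_add]
      refine Real.exp_le_exp.2 (le_trans (le_of_eq ?_) hkey)
      ring
  have hsub : {ω | n * ε * m ≤ |Y ω - s.card * θ|} ⊆
      {ω | s.card * θ + n * ε * m ≤ Y ω} ∪ {ω | Y ω ≤ s.card * θ - n * ε * m} := by
    intro ω hω
    rcases le_abs.1 (show n * ε * m ≤ |Y ω - s.card * θ| from hω) with h | h
    · left; simp only [mem_ofPred_eq]; linarith
    · right; simp only [mem_ofPred_eq]; linarith
  refine (measureReal_mono hsub).trans ((measureReal_union_le _ _).trans ?_)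
  linarith

/-- Tail bound for the sum over all increasing pairs, by a union bound over the `n` matchings. -/
lemma measure_increasingPairs_deviation_le {P : Measure Ω} [IsProbabilityMeasure P]
    {X : ℕ → Ω → α} {ν : Measure α} (hX : ∀ i, Measurable (X i)) (hind : iIndepFun X P)
    (hν : ∀ i, P.map (X i) = ν) {h : α → α → ℝ} (hh : Measurable (Function.uncurry h))
    {M m ε : ℝ} (hM0 : 0 < M) (h0 : ∀ x y, 0 ≤ h x y) (hM : ∀ x y, h x y ≤ M)
    (hm : ∫ z, h z.1 z.2 ∂(ν.prod ν) ≤ m) (hε0 : 0 < ε) (hε : ε ≤ 2) {n : ℕ} (hn : 0 < n) :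
    P.real {ω | n ^ 2 * (ε * m) ≤ |∑ p ∈ increasingPairs n, h (X p.1 ω) (X p.2 ω)
          - (increasingPairs n).card * ∫ z, h z.1 z.2 ∂(ν.prod ν)|}
      ≤ 2 * n * Real.exp (-(ε ^ 2 * (n * m) / (4 * M))) := by
  set θ := ∫ z, h z.1 z.2 ∂(ν.prod ν) with hθ
  have hmaps : ∀ p ∈ increasingPairs n, (p.1 + p.2) % n ∈ Finset.range n := fun p _ =>
    Finset.mem_range.2 (Nat.mod_lt _ hn)
  have hsum : ∀ ω, ∑ p ∈ increasingPairs n, h (X p.1 ω) (X p.2 ω)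
        - (increasingPairs n).card * θ
      = ∑ k ∈ Finset.range n, (∑ p ∈ residueMatching n k, h (X p.1 ω) (X p.2 ω)
          - (residueMatching n k).card * θ) := fun ω => by
    rw [Finset.sum_sub_distrib, ← Finset.sum_mul, ← Nat.cast_sum,
      ← Finset.sum_fiberwise_of_maps_to hmaps,
      Finset.card_eq_sum_card_fiberwise (t := Finset.range n) hmaps]
    rfl
  set A : ℕ → Set Ω := fun k => {ω | n * ε * m ≤
    |∑ p ∈ residueMatching n k, h (X p.1 ω) (X p.2 ω) - (residueMatching n k).card * θ|} with hA
  have hsub : {ω | n ^ 2 * (ε * m) ≤ |∑ p ∈ increasingPairs n, h (X p.1 ω) (X p.2 ω)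
      - (increasingPairs n).card * θ|} ⊆ ⋃ k ∈ Finset.range n, A k := by
    intro ω hω
    by_contra hcon
    simp only [mem_iUnion, not_exists, hA, mem_ofPred_eq, not_le] at hcon
    have h1 : |∑ p ∈ increasingPairs n, h (X p.1 ω) (X p.2 ω) - (increasingPairs n).card * θ|
        < ∑ k ∈ Finset.range n, n * ε * m := by
      rw [hsum]
      exact (Finset.abs_sum_le_sum_abs _ _).trans_lt (Finset.sum_lt_sum_of_nonempty
        (Finset.nonempty_range_iff.2 hn.ne') fun k hk => hcon k hk)
    simp only [Finset.sum_const, Finset.card_range, nsmul_eq_mul] at h1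
    simp only [mem_ofPred_eq] at hω
    nlinarith
  refine (measureReal_mono hsub (measure_ne_top _ _)).trans
    ((measureReal_biUnion_finset_le _ _).trans ?_)
  refine (Finset.sum_le_card_nsmul _ _ (2 * Real.exp (-(ε ^ 2 * (n * m) / (4 * M))))
    fun k _ => ?_).trans_eq (by simp only [Finset.card_range, nsmul_eq_mul]; ring)
  refine measure_matching_deviation_le hX hind hν hh hM0 h0 hM hm hε0 hε _
    (card_residueMatching_le n k) (fun p hp => ?_) fun p hp q hq =>
      residueMatching_disjoint hp hq
  exact (mem_increasingPairs.1 (Finset.mem_filter.1 hp).1).1.ne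

/-- Tail bound for the sum over all ordered pairs of distinct points. -/
lemma measure_pairSum_deviation_le {P : Measure Ω} [IsProbabilityMeasure P]
    {X : ℕ → Ω → α} {ν : Measure α} [IsProbabilityMeasure ν]
    (hX : ∀ i, Measurable (X i)) (hind : iIndepFun X P)
    (hν : ∀ i, P.map (X i) = ν) {h : α → α → ℝ} (hh : Measurable (Function.uncurry h))
    {M m ε : ℝ} (hM0 : 0 < M) (h0 : ∀ x y, 0 ≤ h x y) (hM : ∀ x y, h x y ≤ M)
    (hm : ∫ z, h z.1 z.2 ∂(ν.prod ν) ≤ m) (hε0 : 0 < ε) (hε : ε ≤ 2) {n : ℕ} (hn : 0 < n) :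
    P.real {ω | 2 * n ^ 2 * (ε * m) ≤ |pairSum n h (fun i => X i ω)
          - n * (n - 1) * ∫ z, h z.1 z.2 ∂(ν.prod ν)|}
      ≤ 2 * n * Real.exp (-(ε ^ 2 * (n * m) / (4 * M))) := by
  have hsw : Measurable (Function.uncurry fun x y => h y x) := hh.comp measurable_swap
  have hi : ∀ g : α → α → ℝ, Measurable (Function.uncurry g) → (∀ x y, 0 ≤ g x y) →
      (∀ x y, g x y ≤ M) → Integrable (fun z : α × α => g z.1 z.2) (ν.prod ν) :=
    fun g hg hg0 hgM => Integrable.of_bound hg.aestronglyMeasurable M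
      (ae_of_all _ fun z => by rw [Real.norm_eq_abs, abs_of_nonneg (hg0 _ _)]; exact hgM _ _)
  have hI : ∫ z, (h z.1 z.2 + h z.2 z.1) ∂(ν.prod ν) = 2 * ∫ z, h z.1 z.2 ∂(ν.prod ν) := by
    rw [integral_add (hi h hh h0 hM) (hi (fun x y => h y x) hsw (fun _ _ => h0 _ _)
      fun _ _ => hM _ _), ← integral_prod_swap]
    simp only [Prod.fst_swap, Prod.snd_swap]
    ring
  have := measure_increasingPairs_deviation_le (M := 2 * M) (m := 2 * m) (ε := ε) hX hind hν
    (h := fun x y => h x y + h y x) (hh.add hsw) (by positivity)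
    (fun x y => add_nonneg (h0 _ _) (h0 _ _)) (fun x y => by linarith [hM x y, hM y x])
    (by rw [hI]; linarith) hε0 hε hn
  rw [hI, card_increasingPairs] at this
  simp_rw [pairSum_eq]
  convert! this using 4
  · ring_nf
  · field_simp

/-- Almost sure concentration of the normalized pair sum around the mean `θ n / s n` of the kernel,
at the rate `√(log n / (n ρ n))`. The scale `s` dominates the means of the kernels, and `s / ρ`
dominates their suprema. -/
lemma pairSum_concentration {P : Measure Ω} [IsProbabilityMeasure P]
    {X : ℕ → Ω → α} {ν : Measure α} [IsProbabilityMeasure ν]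
    (hX : ∀ i, Measurable (X i)) (hind : iIndepFun X P)
    (hν : ∀ i, P.map (X i) = ν) {h : ℕ → α → α → ℝ} {s ρ M : ℕ → ℝ} {K : ℝ} (hK : 0 < K)
    (hh : ∀ n, Measurable (Function.uncurry (h n))) (h0 : ∀ n x y, 0 ≤ h n x y)
    (hs : ∀ᶠ n in atTop, 0 < s n) (hρ : ∀ᶠ n in atTop, 0 < ρ n) (hρ1 : ∀ᶠ n in atTop, ρ n ≤ 1)
    (hM0 : ∀ᶠ n in atTop, 0 < M n) (hM : ∀ᶠ n in atTop, ∀ x y, h n x y ≤ M n)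
    (hθ : ∀ᶠ n in atTop, ∫ z, h n z.1 z.2 ∂(ν.prod ν) ≤ K * s n)
    (hMρ : ∀ᶠ n in atTop, M n * ρ n ≤ K * s n)
    (hlim : Tendsto (fun n : ℕ => n * ρ n / Real.log n) atTop atTop) :
    ∀ᵐ ω ∂P, ∀ᶠ n : ℕ in atTop,
      |pairSum n (h n) (fun i => X i ω) / (n ^ 2 * s n)
          - (∫ z, h n z.1 z.2 ∂(ν.prod ν)) / s n|
        ≤ 9 * K * Real.sqrt (Real.log n / (n * ρ n)) := by
  set θ : ℕ → ℝ := fun n => ∫ z, h n z.1 z.2 ∂(ν.prod ν) with hθdef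
  -- with this `ε` the exponent of the tail bound is at least `4 log n`, which leaves a summable
  -- tail after the union bound over the `n` matchings
  set ε : ℕ → ℝ := fun n => 4 * Real.sqrt (Real.log n / (n * ρ n)) with hε
  set A : ℕ → Set Ω := fun n => {ω | 2 * n ^ 2 * (ε n * (K * s n)) ≤
    |pairSum n (h n) (fun i => X i ω) - n * (n - 1) * θ n|} with hA
  have hgood : ∀ᶠ n : ℕ in atTop, 3 ≤ n ∧ 0 < s n ∧ 0 < ρ n ∧ ρ n ≤ 1 ∧ 0 < M n ∧
      (∀ x y, h n x y ≤ M n) ∧ θ n ≤ K * s n ∧ M n * ρ n ≤ K * s n ∧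
      4 ≤ n * ρ n / Real.log n := by
    filter_upwards [eventually_ge_atTop 3, hs, hρ, hρ1, hM0, hM, hθ, hMρ,
      hlim.eventually_ge_atTop 4] with n h1 h2 h3 h4 h5 h6 h7 h8 h9
    exact ⟨h1, h2, h3, h4, h5, h6, h7, h8, h9⟩
  obtain ⟨N, hN⟩ := eventually_atTop.1 hgood
  have hlog : ∀ n : ℕ, 3 ≤ n → 1 ≤ Real.log n := fun n hn => by
    rw [Real.le_log_iff_exp_le (by positivity)]
    have : (3 : ℝ) ≤ n := by exact_mod_cast hn
    linarith [Real.exp_one_lt_d9]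
  have htail : ∀ n, N ≤ n → P.real (A n) ≤ 2 * (1 / (n : ℝ) ^ 2) := by
    intro n hn
    obtain ⟨h3, hs, hρ, hρ1, hM0, hM, hθ, hMρ, h4⟩ := hN n hn
    have hl := hlog n h3
    have hn0 : (0 : ℝ) < n := by positivity
    have hq : Real.log n / (n * ρ n) ≤ (1 / 2) ^ 2 := by
      rw [le_div_iff₀ (by linarith)] at h4
      rw [div_le_iff₀ (by positivity)]
      linarith
    have hε2 : ε n ≤ 2 := by
      have := Real.sqrt_le_sqrt hq
      rw [Real.sqrt_sq (by norm_num)] at this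
      simp only [hε]
      linarith
    have hε0 : 0 < ε n := by
      have : 0 < Real.log n / (n * ρ n) := by positivity
      simp only [hε]
      positivity
    refine (measure_pairSum_deviation_le hX hind hν (hh n) hM0 (h0 n) hM hθ hε0 hε2
      (by omega)).trans ?_
    have hexp : 4 * Real.log n ≤ ε n ^ 2 * (n * (K * s n)) / (4 * M n) := by
      have hsq : ε n ^ 2 = 16 * (Real.log n / (n * ρ n)) := by
        simp only [hε]
        rw [mul_pow, Real.sq_sqrt (by positivity)]
        norm_num
      rw [hsq, le_div_iff₀ (by positivity)]
      have : 16 * (Real.log n / (n * ρ n)) * (n * (K * s n))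
          = 16 * Real.log n * (K * s n) / ρ n := by field_simp
      rw [this, le_div_iff₀ hρ]
      nlinarith
    calc 2 * n * Real.exp (-(ε n ^ 2 * (n * (K * s n)) / (4 * M n)))
        ≤ 2 * n * Real.exp (-(4 * Real.log n)) := by gcongr
      _ = 2 * (1 / (n : ℝ) ^ 3) := by
        rw [Real.exp_neg, mul_comm 4, Real.exp_mul, Real.exp_log hn0]
        norm_num
        field_simp
      _ ≤ 2 * (1 / (n : ℝ) ^ 2) := by
        have : (1 : ℝ) ≤ n := by exact_mod_cast (by omega : 1 ≤ n)
        gcongr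
        norm_num
  have hsum : ∑' n, P (A (n + N)) ≠ ⊤ := by
    have hsm : Summable fun n : ℕ => 2 * (1 / ((n + N : ℕ) : ℝ) ^ 2) :=
      (summable_nat_add_iff N).2 ((Real.summable_one_div_nat_pow.2 one_lt_two).mul_left 2)
    refine ne_top_of_le_ne_top hsm.tsum_ofReal_ne_top (ENNReal.tsum_le_tsum fun n => ?_)
    rw [← ofReal_measureReal]
    exact ENNReal.ofReal_le_ofReal (htail _ (Nat.le_add_left _ _))
  filter_upwards [ae_eventually_notMem hsum] with ω hω
  have hω' : ∀ᶠ n in atTop, ω ∉ A n := by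
    obtain ⟨n₀, h⟩ := eventually_atTop.1 hω
    refine eventually_atTop.2 ⟨n₀ + N, fun n hn => ?_⟩
    have := h (n - N) (by omega)
    rwa [Nat.sub_add_cancel (by omega)] at this
  filter_upwards [hω', eventually_ge_atTop N] with n hn hNn
  obtain ⟨h3, hs, hρ, hρ1, hM0, hM, hθ, hMρ, h4⟩ := hN n hNn
  have hl := hlog n h3
  have hn0 : (0 : ℝ) < n := by positivity
  have hn1 : (1 : ℝ) ≤ n := by exact_mod_cast (by omega : 1 ≤ n)
  have hθ0 : 0 ≤ θ n := integral_nonneg fun z => h0 _ _ _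
  set q := Real.sqrt (Real.log n / (n * ρ n)) with hq
  have hqn : 1 / (n : ℝ) ≤ q := by
    rw [hq]
    apply Real.le_sqrt_of_sq_le
    rw [div_pow, one_pow, div_le_div_iff₀ (by positivity) (by positivity)]
    nlinarith [mul_le_mul hn1 hρ1 hρ.le (by positivity)]
  simp only [hA, mem_ofPred_eq, not_le] at hn
  -- there are `n (n - 1)` ordered pairs, not `n²`; the difference is absorbed by `1 / n ≤ q`
  have e1 : pairSum n (h n) (fun i => X i ω) / (n ^ 2 * s n) - θ n / s n
      = (pairSum n (h n) (fun i => X i ω) - n * (n - 1) * θ n) / (n ^ 2 * s n)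
        - 1 / n * (θ n / s n) := by
    field_simp
    ring
  have e2 : |(pairSum n (h n) (fun i => X i ω) - n * (n - 1) * θ n) / (n ^ 2 * s n)|
      ≤ 8 * K * q := by
    rw [abs_div, abs_of_pos (show (0 : ℝ) < n ^ 2 * s n by positivity),
      div_le_iff₀ (by positivity)]
    simp only [hε] at hn
    linarith
  have e3 : |1 / n * (θ n / s n)| ≤ K * q := by
    rw [abs_of_nonneg (by positivity), mul_comm K]
    have : θ n / s n ≤ K := by rwa [div_le_iff₀ hs]
    exact mul_le_mul hqn this (by positivity) (by positivity)
  rw [e1]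
  refine (abs_sub _ _).trans ?_
  linarith

end Concentration

/-! ### The measure of thin layers around a hypersurface -/

section Layers

/-- A bounded set that meets every line in direction `e` in a segment of length `O(ρ)` has measure
`O(ρ)`: about `1 / ρ` translates of it in direction `e` are disjoint and stay in a fixed ball. -/
lemma exists_measure_le_of_short_fibres {F : Type*} [NormedAddCommGroup F] [NormedSpace ℝ F]
    [MeasurableSpace F] [BorelSpace F] [ProperSpace F] (μ : Measure F) [μ.IsAddLeftInvariant]
    [IsFiniteMeasureOnCompacts μ] (x₀ e : F) (R : ℝ) {A : ℝ} (hA : 0 < A) :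
    ∃ K : ℝ, 0 ≤ K ∧ ∀ ρ : ℝ, 0 < ρ → ∀ T : Set F, MeasurableSet T →
      T ⊆ Metric.closedBall x₀ R →
      (∀ y ∈ T, ∀ s : ℝ, 0 ≤ s → y + s • e ∈ T → s < A * ρ) →
      μ T ≤ ENNReal.ofReal (K * ρ) := by
  set B := Metric.closedBall x₀ (R + A * ‖e‖) with hB
  have hBfin : μ B ≠ ⊤ := (isCompact_closedBall _ _).measure_lt_top.ne
  refine ⟨μ.real B, measureReal_nonneg, fun ρ hρ T hT hTR hfib => ?_⟩
  have hTfin : μ T ≠ ⊤ := ne_top_of_le_ne_top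
    (isCompact_closedBall x₀ R).measure_lt_top.ne (measure_mono hTR)
  set N : ℕ := ⌊1 / ρ⌋₊ + 1 with hN
  let f : ℕ → Set F := fun j => (fun y => -((j * (A * ρ)) • e) + y) ⁻¹' T
  have hfm : ∀ j, MeasurableSet (f j) := fun j => (measurable_const_add _) hT
  have hfμ : ∀ j, μ (f j) = μ T := fun j => measure_preimage_add μ _ T
  have hdisj : ∀ i j : ℕ, i < j → Disjoint (f i) (f j) := fun i j hij => by
    rw [Set.disjoint_left]
    intro y hi hj
    have h1 : (1 : ℝ) ≤ (j : ℝ) - i := by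
      have : (i : ℝ) + 1 ≤ j := by exact_mod_cast hij
      linarith
    have := hfib _ hj (((j : ℝ) - i) * (A * ρ)) (by positivity) (by
      have : -(((j : ℝ) * (A * ρ)) • e) + y + (((j : ℝ) - i) * (A * ρ)) • e
          = -(((i : ℝ) * (A * ρ)) • e) + y := by module
      simp only
      rw [this]
      exact hi)
    nlinarith [mul_pos hA hρ]
  have hsub : (⋃ j ∈ Finset.range N, f j) ⊆ B := by
    intro y hy
    simp only [mem_iUnion, Finset.mem_range] at hy
    obtain ⟨j, hj, hy⟩ := hy
    have hjρ : (j : ℝ) * ρ ≤ 1 := by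
      have h2 : (j : ℝ) ≤ ⌊1 / ρ⌋₊ := by exact_mod_cast (by omega : j ≤ ⌊1 / ρ⌋₊)
      have h3 := Nat.floor_le (show 0 ≤ 1 / ρ by positivity)
      calc (j : ℝ) * ρ ≤ 1 / ρ * ρ := by gcongr; linarith
        _ = 1 := by field_simp
    have h1 := hTR hy
    rw [Metric.mem_closedBall, dist_eq_norm] at h1
    rw [hB, Metric.mem_closedBall, dist_eq_norm]
    have h2 : y - x₀ = (-((j * (A * ρ)) • e) + y - x₀) + (j * (A * ρ)) • e := by module
    rw [h2]
    refine (norm_add_le _ _).trans (add_le_add h1 ?_)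
    rw [norm_smul, Real.norm_eq_abs, abs_of_nonneg (by positivity)]
    gcongr
    nlinarith
  have hmain : (N : ℝ) * μ.real T ≤ μ.real B := by
    have h1 := measureReal_mono hsub hBfin
    have hpd : (↑(Finset.range N) : Set ℕ).PairwiseDisjoint f := fun i _ j _ hij => by
      rcases lt_or_gt_of_ne hij with h | h
      · exact hdisj i j h
      · exact (hdisj j i h).symm
    rw [measureReal_biUnion_finset hpd (fun j _ => hfm j)
      fun j _ => by rw [hfμ]; exact hTfin] at h1
    simpa [measureReal_def, hfμ] using h1
  rw [← ENNReal.ofReal_toReal hTfin]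
  refine ENNReal.ofReal_le_ofReal ?_
  have hN1 : 1 ≤ N * ρ := by
    have := (Nat.lt_floor_add_one (1 / ρ)).le
    rw [div_le_iff₀ hρ] at this
    simpa [hN] using this
  have h0 : 0 ≤ μ.real T := measureReal_nonneg
  change μ.real T ≤ _
  nlinarith

variable {F V : Type*} [NormedAddCommGroup F] [NormedSpace ℝ F] [MeasurableSpace F] [BorelSpace F]
  [ProperSpace F] [NormedAddCommGroup V] [NormedSpace ℝ V]

/-- The set `M` is, near `b + J w₀`, contained in the zero set of a function that is strictly
differentiable with a derivative that does not vanish along the affine subspace `b + range J`. -/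
def HasTransversalDefiningFunction (M : Set V) (b : V) (J : F →L[ℝ] V) (w₀ : F) : Prop :=
  ∃ (φ : V → ℝ) (φ' : V →L[ℝ] ℝ), HasStrictFDerivAt φ φ' (b + J w₀) ∧ φ'.comp J ≠ 0 ∧
    ∀ᶠ y in 𝓝 (b + J w₀), y ∈ M → φ y = 0

/-- Near a transversal point the slice of the `ρ`-neighborhood of `M` has measure `O(ρ)`: the
defining function is `O(ρ)` on it and grows linearly in a direction of the slice. -/
lemma HasTransversalDefiningFunction.exists_measure_layer_le {μ : Measure F}
    [μ.IsAddLeftInvariant] [IsFiniteMeasureOnCompacts μ] {M : Set V} {b : V} {J : F →L[ℝ] V}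
    {w₀ : F} (h : HasTransversalDefiningFunction M b J w₀) :
    ∃ δ K ρ₀ : ℝ, 0 < δ ∧ 0 ≤ K ∧ 0 < ρ₀ ∧ ∀ ρ : ℝ, 0 < ρ → ρ ≤ ρ₀ →
      μ (Metric.closedBall w₀ δ ∩ (fun w => b + J w) ⁻¹' Metric.cthickening ρ M)
        ≤ ENNReal.ofReal (K * ρ) := by
  obtain ⟨φ, φ', hφ, hJ, hM⟩ := h
  obtain ⟨e, he⟩ : ∃ e, φ' (J e) = 1 := by
    obtain ⟨v, hv⟩ := DFunLike.ne_iff.1 hJ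
    have hv' : φ' (J v) ≠ 0 := by simpa using hv
    exact ⟨(φ' (J v))⁻¹ • v, by simp [hv']⟩
  -- up to this error of linearization, `φ` still grows at rate `1 / 2` in the direction `J e`
  set c : ℝ := 1 / (2 * (‖J e‖ + 1)) with hc
  have hc0 : 0 < c := by positivity
  have hcJ : c * ‖J e‖ ≤ 1 / 2 := by
    rw [hc, div_mul_eq_mul_div, one_mul, div_le_div_iff₀ (by positivity) (by positivity)]
    linarith
  have hstrict := hφ.isLittleO.bound hc0
  obtain ⟨η, hη, hball⟩ : ∃ η > 0, (∀ x ∈ Metric.ball (b + J w₀) η,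
      ∀ y ∈ Metric.ball (b + J w₀) η, |φ x - φ y - φ' (x - y)| ≤ c * ‖x - y‖) ∧
      ∀ y ∈ Metric.ball (b + J w₀) η, y ∈ M → φ y = 0 := by
    rw [nhds_prod_eq] at hstrict
    obtain ⟨η₁, hη₁, h1⟩ := (Metric.nhds_basis_ball.prod_self.eventually_iff).1 hstrict
    obtain ⟨η₂, hη₂, h2⟩ := Metric.eventually_nhds_iff_ball.1 hM
    refine ⟨min η₁ η₂, lt_min hη₁ hη₂, fun x hx y hy => ?_, fun y hy =>
      h2 y (Metric.ball_subset_ball (min_le_right _ _) hy)⟩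
    exact h1 (mk_mem_prod (Metric.ball_subset_ball (min_le_left _ _) hx)
      (Metric.ball_subset_ball (min_le_left _ _) hy))
  obtain ⟨hlip, hzero⟩ := hball
  set L : ℝ := c + ‖φ'‖ with hL
  have hL0 : 0 < L := by positivity
  set δ : ℝ := η / (4 * (‖J‖ + 1)) with hδ
  have hδ0 : 0 < δ := by positivity
  have hδJ : ‖J‖ * δ ≤ η / 4 := by
    rw [hδ, mul_div_assoc', div_le_div_iff₀ (by positivity) (by positivity)]
    nlinarith
  obtain ⟨K, hK0, hK⟩ := exists_measure_le_of_short_fibres μ w₀ e δ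
    (show 0 < 8 * L + 1 by positivity)
  refine ⟨δ, K, η / 8, hδ0, hK0, by positivity, fun ρ hρ hρ₀ => hK ρ hρ _ ?_
    inter_subset_left ?_⟩
  · exact Metric.isClosed_closedBall.measurableSet.inter
      ((Metric.isClosed_cthickening.preimage (by fun_prop)).measurableSet)
  have hnear : ∀ w ∈ Metric.closedBall w₀ δ, dist (b + J w) (b + J w₀) ≤ η / 4 := fun w hw => by
    rw [dist_add_left, dist_eq_norm, ← map_sub]
    refine (J.le_opNorm _).trans (le_trans ?_ hδJ)
    rw [Metric.mem_closedBall, dist_eq_norm] at hw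
    gcongr
  have hsmall : ∀ w ∈ Metric.closedBall w₀ δ ∩ (fun w => b + J w) ⁻¹' Metric.cthickening ρ M,
      |φ (b + J w)| ≤ 2 * L * ρ := by
    rintro w ⟨hw, hwM⟩
    have h2 : b + J w ∈ Metric.thickening (2 * ρ) M :=
      Metric.cthickening_subset_thickening' (by positivity) (by linarith) M hwM
    obtain ⟨m, hmM, hm⟩ := Metric.mem_thickening_iff.1 h2
    have hwη : b + J w ∈ Metric.ball (b + J w₀) η :=
      Metric.mem_ball.2 ((hnear w hw).trans_lt (by linarith))
    have hmη : m ∈ Metric.ball (b + J w₀) η := by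
      rw [Metric.mem_ball]
      have := dist_triangle m (b + J w) (b + J w₀)
      rw [dist_comm m (b + J w)] at this
      linarith [hnear w hw]
    have h3 := hlip _ hwη _ hmη
    rw [hzero m hmη hmM, sub_zero] at h3
    have h4 : |φ' (b + J w - m)| ≤ ‖φ'‖ * ‖b + J w - m‖ := φ'.le_opNorm _
    rw [dist_eq_norm] at hm
    have h5 := abs_sub_abs_le_abs_sub (φ (b + J w)) (φ' (b + J w - m))
    nlinarith
  intro w hw s hs hws
  have h1 := hsmall w hw
  have h2 := hsmall _ hws
  have h3 := hlip (b + J (w + s • e)) (Metric.mem_ball.2 ((hnear _ hws.1).trans_lt (by linarith)))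
    (b + J w) (Metric.mem_ball.2 ((hnear _ hw.1).trans_lt (by linarith)))
  have h4 : b + J (w + s • e) - (b + J w) = s • J e := by
    rw [map_add, map_smul]; abel
  rw [h4, map_smul, he, norm_smul, Real.norm_eq_abs, abs_of_nonneg hs, smul_eq_mul, mul_one] at h3
  have h5 : c * (s * ‖J e‖) ≤ s / 2 := by nlinarith
  have h6 := (abs_le.1 h3).1
  have h7 := (abs_le.1 h1).1
  have h8 := (abs_le.1 h2).2
  nlinarith

/-- If all the intersections of the affine slice `b + J w`, `w ∈ Q`, with the compact set `M` are
transversal, then the slice of the `ρ`-neighborhood of `M` has measure `O(ρ)`. -/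
lemma exists_measure_layer_le {μ : Measure F} [μ.IsAddLeftInvariant]
    [IsFiniteMeasureOnCompacts μ] {M : Set V} (hM : IsClosed M) {b : V} {J : F →L[ℝ] V}
    {Q : Set F} (hQ : IsCompact Q)
    (h : ∀ w ∈ Q, b + J w ∈ M → HasTransversalDefiningFunction M b J w) :
    ∃ K ρ₀ : ℝ, 0 ≤ K ∧ 0 < ρ₀ ∧ ∀ ρ : ℝ, 0 < ρ → ρ ≤ ρ₀ →
      μ (Q ∩ (fun w => b + J w) ⁻¹' Metric.cthickening ρ M) ≤ ENNReal.ofReal (K * ρ) := by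
  refine hQ.induction_on (p := fun s => ∃ K ρ₀ : ℝ, 0 ≤ K ∧ 0 < ρ₀ ∧ ∀ ρ : ℝ, 0 < ρ → ρ ≤ ρ₀ →
      μ (s ∩ (fun w => b + J w) ⁻¹' Metric.cthickening ρ M) ≤ ENNReal.ofReal (K * ρ))
    ⟨0, 1, le_rfl, one_pos, by simp⟩ ?_ ?_ ?_
  · rintro s t hst ⟨K, ρ₀, hK, hρ₀, hb⟩
    exact ⟨K, ρ₀, hK, hρ₀, fun ρ h1 h2 =>
      (measure_mono (inter_subset_inter_left _ hst)).trans (hb ρ h1 h2)⟩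
  · rintro s t ⟨K₁, ρ₁, hK₁, hρ₁, hb₁⟩ ⟨K₂, ρ₂, hK₂, hρ₂, hb₂⟩
    refine ⟨K₁ + K₂, min ρ₁ ρ₂, by positivity, lt_min hρ₁ hρ₂, fun ρ h1 h2 => ?_⟩
    rw [union_inter_distrib_right, add_mul, ENNReal.ofReal_add (by positivity) (by positivity)]
    exact (measure_union_le _ _).trans (add_le_add (hb₁ ρ h1 (h2.trans (min_le_left _ _)))
      (hb₂ ρ h1 (h2.trans (min_le_right _ _))))
  · intro w hw
    by_cases hwM : b + J w ∈ M
    · obtain ⟨δ, K, ρ₀, hδ, hK, hρ₀, hb⟩ := (h w hw hwM).exists_measure_layer_le (μ := μ)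
      exact ⟨_, mem_nhdsWithin_of_mem_nhds (Metric.closedBall_mem_nhds w hδ), K, ρ₀, hK, hρ₀, hb⟩
    · -- away from `M` the layer is empty near `w`
      obtain ⟨ε, hε, hεM⟩ := Metric.nhds_basis_ball.mem_iff.1 (hM.isOpen_compl.mem_nhds hwM)
      have hcont : Continuous fun w => b + J w := by fun_prop
      refine ⟨(fun w => b + J w) ⁻¹' Metric.ball (b + J w) (ε / 2), mem_nhdsWithin_of_mem_nhds
        (hcont.continuousAt.preimage_mem_nhds (Metric.ball_mem_nhds _ (by positivity))),
        0, ε / 4, le_rfl, by positivity, fun ρ hρ hρ₀ => ?_⟩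
      have : (fun w => b + J w) ⁻¹' Metric.ball (b + J w) (ε / 2) ∩
          (fun w => b + J w) ⁻¹' Metric.cthickening ρ M = ∅ := by
        rw [eq_empty_iff_forall_notMem]
        rintro v ⟨hv, hvM⟩
        obtain ⟨m, hmM, hm⟩ := Metric.mem_thickening_iff.1
          (Metric.cthickening_subset_thickening' (δ₂ := ε / 2) (by positivity) (by linarith) M hvM)
        refine hεM ?_ hmM
        rw [Metric.mem_ball]
        have := dist_triangle m (b + J v) (b + J w)
        rw [dist_comm m (b + J v)] at this
        have hv' : dist (b + J v) (b + J w) < ε / 2 := hv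
        have hm' : dist (b + J v) m < ε / 2 := hm
        linarith
      simp [this]

end Layers

/-! ### Slicing along a hyperplane -/

section Slicing

variable {k : ℕ}

/-- `J` is an isometric parametrization of the linear hyperplane parallel to `S`, such that
`(t, w) ↦ (S.offset + t) n_S + J w` are volume preserving coordinates in which `S` is `{t = 0}`. -/
structure IsSlicing (S : Hyperplane (k + 1)) (J : E k →ₗᵢ[ℝ] E (k + 1)) : Prop where
  inner_eq_zero : ∀ w, inner ℝ S.normal (J w) = 0
  exists_eq : ∀ x, ∃ w, x = inner ℝ S.normal x • S.normal + J w
  measurePreserving : MeasurePreserving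
    (fun q : ℝ × E k => (S.offset + q.1) • S.normal + J q.2) (volume.prod volume) volume

lemma exists_isSlicing (S : Hyperplane (k + 1)) : ∃ J, IsSlicing S J := by
  classical
  obtain ⟨b, hb⟩ := Orthonormal.exists_orthonormalBasis_extension_of_card_eq (𝕜 := ℝ)
    (E := E (k + 1)) (ι := Fin (k + 1)) (by simp) (v := fun _ => S.normal) (s := {0}) (by
      rw [orthonormal_iff_ite]
      rintro ⟨i, hi⟩ ⟨j, hj⟩
      obtain rfl : i = 0 := hi
      obtain rfl : j = 0 := hj
      simp [S.norm_normal])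
  have hb0 : b 0 = S.normal := hb 0 rfl
  let J₀ : E k →ₗ[ℝ] E (k + 1) :=
    { toFun := fun w => WithLp.toLp 2 (Fin.cons 0 w.ofLp)
      map_add' := fun x y => by
        ext i
        refine Fin.cases ?_ (fun i => ?_) i <;> simp
      map_smul' := fun c x => by
        ext i
        refine Fin.cases ?_ (fun i => ?_) i <;> simp }
  have hJ₀ : ∀ w, ‖J₀ w‖ = ‖w‖ := fun w => by
    simp [J₀, EuclideanSpace.norm_eq, Fin.sum_univ_succ]
  let J : E k →ₗᵢ[ℝ] E (k + 1) := b.repr.symm.toLinearIsometry.comp ⟨J₀, hJ₀⟩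
  have hJ : ∀ w, J w = b.repr.symm (WithLp.toLp 2 (Fin.cons 0 w.ofLp)) := fun _ => rfl
  have hnorm : ∀ t : ℝ, ∀ w : E k, t • S.normal + J w
      = b.repr.symm (WithLp.toLp 2 (Fin.cons t w.ofLp)) := fun t w => by
    rw [hJ, ← hb0, ← b.repr_symm_single 0, ← map_smul, ← map_add]
    congr 1
    ext i
    refine Fin.cases ?_ (fun i => ?_) i <;> simp
  refine ⟨J, fun w => ?_, fun x => ?_, ?_⟩
  · rw [← hb0, ← b.repr_apply_apply, hJ, LinearIsometryEquiv.apply_symm_apply]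
    simp
  · refine ⟨WithLp.toLp 2 fun i => b.repr x i.succ, ?_⟩
    rw [hnorm, ← b.repr.injective.eq_iff, LinearIsometryEquiv.apply_symm_apply]
    ext i
    refine Fin.cases ?_ (fun i => ?_) i <;> simp [← hb0, b.repr_apply_apply]
  · have h1 : MeasurePreserving (fun q : ℝ × E k => (q.1, q.2.ofLp))
        (volume.prod volume) (volume.prod volume) :=
      (MeasurePreserving.id volume).prod (PiLp.volume_preserving_ofLp (Fin k))
    have h2 := (volume_preserving_piFinSuccAbove (fun _ : Fin (k + 1) => ℝ) 0).symm
    have h3 := PiLp.volume_preserving_toLp (Fin (k + 1))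
    have h4 := b.repr.symm.measurePreserving
    have h5 := measurePreserving_add_left (volume : Measure (E (k + 1))) (S.offset • S.normal)
    have h6 := h5.comp (h4.comp (h3.comp (h2.comp h1)))
    convert! h6 using 1
    ext1 q
    rw [add_smul, add_assoc, hnorm]
    simp only [Function.comp_apply]
    congr 3
    ext i
    refine Fin.cases ?_ (fun i => ?_) i <;> rfl

variable {S : Hyperplane (k + 1)} {J : E k →ₗᵢ[ℝ] E (k + 1)}

lemma IsSlicing.inner_slice (hJ : IsSlicing S J) (t : ℝ) (w : E k) :
    inner ℝ S.normal ((S.offset + t) • S.normal + J w) = S.offset + t := by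
  rw [inner_add_right, inner_smul_right, hJ.inner_eq_zero, real_inner_self_eq_norm_sq,
    S.norm_normal]
  ring

lemma IsSlicing.range_eq (hJ : IsSlicing S J) :
    range (fun w => S.offset • S.normal + J w) = S.carrier := by
  ext x
  constructor
  · rintro ⟨w, rfl⟩
    have := hJ.inner_slice 0 w
    rwa [add_zero] at this
  · intro hx
    obtain ⟨w, hw⟩ := hJ.exists_eq x
    rw [show inner ℝ S.normal x = S.offset from hx] at hw
    exact ⟨w, hw.symm⟩

/-- The surface integral along `S`. -/
lemma IsSlicing.setIntegral_carrier (hJ : IsSlicing S J) {f : E (k + 1) → ℝ} (hf : Measurable f) :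
    ∫ x in S.carrier, f x ∂(Measure.euclideanHausdorffMeasure (k + 1 - 1))
      = ∫ w, f (S.offset • S.normal + J w) := by
  have hi : Isometry fun w => S.offset • S.normal + J w :=
    (IsometryEquiv.addLeft (S.offset • S.normal)).isometry.comp J.isometry
  have := hi.map_euclideanHausdorffMeasure (d := k)
  rw [EuclideanSpace.euclideanHausdorffMeasure_eq_volume, hJ.range_eq] at this
  rw [Nat.add_sub_cancel, ← this, integral_map hi.continuous.measurable.aemeasurable
    hf.aestronglyMeasurable]

/-- A vector orthogonal to the hyperplane is a multiple of the normal. -/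
lemma IsSlicing.eq_smul_normal (hJ : IsSlicing S J) {v : E (k + 1)}
    (hv : ∀ w, inner ℝ v (J w) = 0) : v = inner ℝ S.normal v • S.normal := by
  obtain ⟨w, hw⟩ := hJ.exists_eq v
  have h1 := hv w
  rw [hw, inner_add_left, inner_smul_left, hJ.inner_eq_zero, mul_zero, zero_add,
    inner_self_eq_zero] at h1
  rwa [h1, add_zero] at hw

end Slicing

/-! ### The layers around the boundary of the support -/

section Boundary

/-- A local defining function is strictly differentiable, with derivative given by its
gradient. -/
lemma IsLocalDefiningFunction.exists_strict {d : ℕ} {M : Set (E d)} {x : E d} {φ : E d → ℝ}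
    (h : IsLocalDefiningFunction M x φ) :
    HasStrictFDerivAt φ (innerSL ℝ (gradient φ x)) x ∧ gradient φ x ≠ 0 ∧
      ∀ᶠ y in 𝓝 x, y ∈ M → φ y = 0 := by
  obtain ⟨U, hU, hx, hsm, hz, hg⟩ := h
  refine ⟨?_, hg x hx, ?_⟩
  · have hc := (hsm.contDiffAt (hU.mem_nhds hx)).hasStrictFDerivAt (by simp)
    convert! hc using 1
    ext v
    simp [gradient, InnerProductSpace.toDual_symm_apply]
  · filter_upwards [hU.mem_nhds hx] with y hy hM
    exact (hz y hy).1 hM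

/-- The slice by `S` of the `ρ`-neighborhood of `∂C` has surface measure `O(ρ)`. -/
lemma exists_slice_layer_le {k : ℕ} {p : E (k + 1) → ℝ} {C : Set (E (k + 1))}
    {S : Hyperplane (k + 1)} (hpCS : GeneralAssumptions p C S) {J : E k →ₗᵢ[ℝ] E (k + 1)}
    (hJ : IsSlicing S J) :
    ∃ K ρ₀ : ℝ, 0 ≤ K ∧ 0 < ρ₀ ∧ ∀ ρ : ℝ, 0 < ρ → ρ ≤ ρ₀ →
      volume ((fun w => S.offset • S.normal + J w) ⁻¹' Metric.cthickening ρ (frontier C))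
        ≤ ENNReal.ofReal (K * ρ) := by
  have hi : Isometry fun w => S.offset • S.normal + J w :=
    (IsometryEquiv.addLeft (S.offset • S.normal)).isometry.comp J.isometry
  have hfc : IsCompact (frontier C) :=
    hpCS.compact.of_isClosed_subset isClosed_frontier hpCS.compact.isClosed.frontier_subset
  have hQ : IsCompact ((fun w => S.offset • S.normal + J w) ⁻¹'
      Metric.cthickening 1 (frontier C)) :=
    hi.isClosedEmbedding.isCompact_preimage hfc.cthickening
  obtain ⟨K, ρ₀, hK, hρ₀, h⟩ := exists_measure_layer_le (μ := (volume : Measure (E k)))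
    (isClosed_frontier (s := C)) (b := S.offset • S.normal) (J := J.toContinuousLinearMap) hQ
    fun w _ hwM => by
    have hwS : S.offset • S.normal + J w ∈ S.carrier := hJ.range_eq ▸ mem_range_self w
    rcases Nat.eq_zero_or_pos k with rfl | hk
    · exact absurd (hpCS.interior_of_one_dim rfl hwS) hwM.2
    obtain ⟨α, hα0, hα, htr⟩ := hpCS.transversal (by omega)
    obtain ⟨φ, hφ⟩ := hpCS.boundary_smooth (by omega) _ hwM
    obtain ⟨hd, hg, hz⟩ := hφ.exists_strict
    refine ⟨φ, _, hd, fun h0 => ?_, hz⟩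
    have := hJ.eq_smul_normal (v := gradient φ (S.offset • S.normal + J w)) fun v => by
      simpa using DFunLike.congr_fun h0 v
    have hcos := htr _ ⟨hwS, hwM⟩ S.normal ⟨S.norm_normal, φ, hφ, _, this⟩
    rw [real_inner_self_eq_norm_sq, S.norm_normal] at hcos
    have h1 := Real.cos_lt_cos_of_nonneg_of_le_pi_div_two le_rfl hα.le hα0
    rw [Real.cos_zero] at h1
    norm_num at hcos
    linarith
  refine ⟨K, min ρ₀ 1, hK, lt_min hρ₀ one_pos, fun ρ h1 h2 => ?_⟩
  refine le_trans (measure_mono ?_) (h ρ h1 (h2.trans (min_le_left _ _)))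
  refine fun w hw => ⟨?_, hw⟩
  exact Metric.cthickening_mono (h2.trans (min_le_right _ _)) _ hw

/-- The `ρ`-neighborhood of `∂C` has volume `O(ρ)`. -/
lemma exists_layer_le {k : ℕ} {p : E (k + 1) → ℝ} {C : Set (E (k + 1))}
    {S : Hyperplane (k + 1)} (hpCS : GeneralAssumptions p C S)
    (hfin : k + 1 = 1 → (frontier C).Finite) :
    ∃ K ρ₀ : ℝ, 0 ≤ K ∧ 0 < ρ₀ ∧ ∀ ρ : ℝ, 0 < ρ → ρ ≤ ρ₀ →
      volume (Metric.cthickening ρ (frontier C)) ≤ ENNReal.ofReal (K * ρ) := by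
  have hfc : IsCompact (frontier C) :=
    hpCS.compact.of_isClosed_subset isClosed_frontier hpCS.compact.isClosed.frontier_subset
  obtain ⟨K, ρ₀, hK, hρ₀, h⟩ := exists_measure_layer_le (μ := (volume : Measure (E (k + 1))))
    (isClosed_frontier (s := C)) (b := 0) (J := ContinuousLinearMap.id ℝ _)
    (hfc.cthickening (r := 1)) fun w _ hwM => by
    simp only [ContinuousLinearMap.coe_id', id_eq, zero_add] at hwM
    rcases Nat.eq_zero_or_pos k with rfl | hk
    · -- in dimension one, the coordinate function centered at an isolated boundary point
      refine ⟨fun y => y 0 - w 0, EuclideanSpace.proj 0, ?_, fun h0 => ?_, ?_⟩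
      · exact (EuclideanSpace.proj (𝕜 := ℝ) (0 : Fin 1)).hasStrictFDerivAt.sub_const _
      · have := DFunLike.congr_fun h0 (EuclideanSpace.single 0 1)
        simp at this
      · have h1 := ((hfin rfl).subset (sdiff_subset (s := frontier C) (t := {w}))).isClosed
        simp only [ContinuousLinearMap.coe_id', id_eq, zero_add]
        filter_upwards [h1.isOpen_compl.mem_nhds (by simp)] with y hy hyM
        have : y = w := by
          by_contra hne
          exact hy ⟨hyM, hne⟩
        simp [this]
    obtain ⟨φ, hφ⟩ := hpCS.boundary_smooth (by omega) _ hwM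
    obtain ⟨hd, hg, hz⟩ := hφ.exists_strict
    refine ⟨φ, innerSL ℝ (gradient φ w), by simpa using hd, fun h0 => hg ?_, by simpa using hz⟩
    have := DFunLike.congr_fun h0 (gradient φ w)
    simpa using this
  refine ⟨K, min ρ₀ 1, hK, lt_min hρ₀ one_pos, fun ρ h1 h2 => ?_⟩
  refine le_trans (measure_mono ?_) (h ρ h1 (h2.trans (min_le_left _ _)))
  refine fun w hw => ⟨?_, ?_⟩
  · exact Metric.cthickening_mono (h2.trans (min_le_right _ _)) _ hw
  · simpa using hw

end Boundary

/-! ### The local behaviour of the density -/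

section Density

/-- What the bias estimates use of the density `p`: it is bounded, vanishes off `C`, and is
Lipschitz on every ball that does not meet `∂C`. -/
structure DensityBounds {d : ℕ} (p : E d → ℝ) (C : Set (E d)) (B G : ℝ) : Prop where
  measurable : Measurable p
  compact : IsCompact C
  pos : 0 < B
  nonneg_const : 0 ≤ G
  nonneg : ∀ x, 0 ≤ p x
  le : ∀ x, p x ≤ B
  eq_zero : ∀ x, x ∉ C → p x = 0
  eq_zero_of_notMem : ∀ (s : E d) (R : ℝ), s ∉ Metric.cthickening R (frontier C) → s ∉ C →
    ∀ x ∈ Metric.closedBall s R, p x = 0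
  lipschitz : ∀ (s : E d) (R : ℝ), s ∉ Metric.cthickening R (frontier C) →
    ∀ x ∈ Metric.closedBall s R, ∀ y ∈ Metric.closedBall s R, |p x - p y| ≤ G * ‖x - y‖

lemma GeneralAssumptions.exists_densityBounds {d : ℕ} {p : E d → ℝ} {C : Set (E d)}
    {S : Hyperplane d} (h : GeneralAssumptions p C S) : ∃ B G, DensityBounds p C B G := by
  obtain ⟨pmin, pmax, hmin, hb⟩ := h.bounds
  obtain ⟨G, hG⟩ := h.gradient_bounded
  have hdich : ∀ (s : E d) (R : ℝ), s ∉ Metric.cthickening R (frontier C) →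
      Metric.closedBall s R ⊆ interior C ∨ Metric.closedBall s R ⊆ Cᶜ := by
    intro s R hs
    refine IsPreconnected.subset_or_subset isOpen_interior h.compact.isClosed.isOpen_compl
      (disjoint_compl_right.mono_left interior_subset) (fun x hx => ?_)
      (convex_closedBall s R).isPreconnected
    by_contra hx'
    simp only [mem_union, mem_compl_iff, not_or, not_not] at hx'
    refine hs (Metric.mem_cthickening_of_dist_le s x R _ ⟨subset_closure hx'.2, hx'.1⟩ ?_)
    rw [dist_comm]
    exact hx
  refine ⟨max pmax 1, max G 0, h.measurable, h.compact, by positivity, le_max_right _ _,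
    fun x => ?_, fun x => ?_, h.eq_zero, fun s R hs hsC x hx => ?_, fun s R hs x hx y hy => ?_⟩
  · by_cases hx : x ∈ C
    · exact hmin.le.trans (hb x hx).1
    · rw [h.eq_zero x hx]
  · by_cases hx : x ∈ C
    · exact (hb x hx).2.trans (le_max_left _ _)
    · rw [h.eq_zero x hx]; positivity
  · rcases hdich s R hs with h1 | h1
    · have hR : 0 ≤ R := dist_nonneg.trans hx
      exact absurd (interior_subset (h1 (Metric.mem_closedBall_self hR))) hsC
    · exact h.eq_zero x (h1 hx)
  · rcases hdich s R hs with h1 | h1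
    · refine (convex_closedBall s R).norm_image_sub_le_of_norm_fderiv_le (𝕜 := ℝ) (f := p)
        (fun z hz => ?_) (fun z hz => ?_) hy hx
      · exact h.differentiable.differentiableAt (isOpen_interior.mem_nhds (h1 hz))
      · have := hG z (h1 hz)
        rw [gradient, LinearIsometryEquiv.norm_map] at this
        exact this.trans (le_max_left _ _)
    · rw [h.eq_zero x (h1 hx), h.eq_zero y (h1 hy)]
      simp only [sub_self, abs_zero]
      positivity

variable {d : ℕ} {p : E d → ℝ} {C : Set (E d)} {B G : ℝ}

lemma DensityBounds.integrable (h : DensityBounds p C B G) : Integrable p := by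
  have h1 : IntegrableOn p C := Measure.integrableOn_of_bounded h.compact.measure_lt_top.ne
    h.measurable.aestronglyMeasurable (M := B)
    (ae_of_all _ fun x => by rw [Real.norm_eq_abs, abs_of_nonneg (h.nonneg x)]; exact h.le x)
  rwa [integrableOn_iff_integrable_of_support_subset] at h1
  intro x hx
  by_contra hxC
  exact hx (h.eq_zero x hxC)

end Density

/-! ### Means of pair kernels as integrals of correlations -/

section Correlation

variable {d : ℕ}

/-- The correlation `z ↦ ∫ a(x) b(x + z) dx` of `a` and `b`. -/
def corr (a b : E d → ℝ) (z : E d) : ℝ := ∫ x, a x * b (x + z)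

/-- The edge weight as a function of the difference vector. -/
def radialKernel (f : ℝ → ℝ) (r : ℝ) (z : E d) : ℝ := if ‖z‖ ≤ r then f ‖z‖ else 0

/-- The kernel whose sum over pairs of sample points is the total weight of the edges that lead
from `A` to `A'`. -/
def edgeKernel (f : ℝ → ℝ) (r : ℝ) (A A' : Set (E d)) (x y : E d) : ℝ :=
  A.indicator 1 x * (A'.indicator 1 y * radialKernel f r (y - x))

variable {f : ℝ → ℝ} {r M : ℝ} {A A' : Set (E d)}

lemma measurable_radialKernel (hf : Measurable f) : Measurable (radialKernel (d := d) f r) :=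
  Measurable.ite (measurableSet_le measurable_norm measurable_const) (hf.comp measurable_norm)
    measurable_const

lemma radialKernel_nonneg (hf0 : ∀ u, 0 ≤ f u) (z : E d) : 0 ≤ radialKernel f r z := by
  unfold radialKernel
  split_ifs
  exacts [hf0 _, le_rfl]

lemma radialKernel_le (hM : 0 ≤ M) (hfM : ∀ u, f u ≤ M) (z : E d) : radialKernel f r z ≤ M := by
  unfold radialKernel
  split_ifs
  exacts [hfM _, hM]

lemma integrable_radialKernel (hf : Measurable f) (hf0 : ∀ u, 0 ≤ f u) (hfM : ∀ u, f u ≤ M) :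
    Integrable (radialKernel (d := d) f r) := by
  have h1 : IntegrableOn (radialKernel (d := d) f r) (Metric.closedBall 0 r) :=
    Measure.integrableOn_of_bounded (isCompact_closedBall _ _).measure_lt_top.ne
      (measurable_radialKernel hf).aestronglyMeasurable (M := max M 0)
      (ae_of_all _ fun x => by
        rw [Real.norm_eq_abs, abs_of_nonneg (radialKernel_nonneg hf0 x)]
        exact radialKernel_le (le_max_right _ _) (fun u => (hfM u).trans (le_max_left _ _)) x)
  rwa [integrableOn_iff_integrable_of_support_subset] at h1
  intro x hx
  by_contra hxr
  rw [mem_closedBall_zero_iff] at hxr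
  exact hx (if_neg hxr)

lemma measurable_edgeKernel (hf : Measurable f) (hA : MeasurableSet A) (hA' : MeasurableSet A') :
    Measurable (Function.uncurry (edgeKernel f r A A')) := by
  refine ((measurable_const.indicator hA).comp measurable_fst).mul
    (((measurable_const.indicator hA').comp measurable_snd).mul
      ((measurable_radialKernel hf).comp (measurable_snd.sub measurable_fst)))

lemma edgeKernel_nonneg (hf0 : ∀ u, 0 ≤ f u) (x y : E d) : 0 ≤ edgeKernel f r A A' x y :=
  mul_nonneg (indicator_nonneg (fun _ _ => zero_le_one) _)
    (mul_nonneg (indicator_nonneg (fun _ _ => zero_le_one) _) (radialKernel_nonneg hf0 _))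

lemma edgeKernel_le (hf0 : ∀ u, 0 ≤ f u) (hM : 0 ≤ M) (hfM : ∀ u, f u ≤ M) (x y : E d) :
    edgeKernel f r A A' x y ≤ M := by
  have hi : ∀ (D : Set (E d)) (x : E d), D.indicator (1 : E d → ℝ) x ≤ 1 := fun D x =>
    indicator_le_self' (fun _ _ => zero_le_one) x
  have h0 := radialKernel_nonneg (d := d) (r := r) hf0 (y - x)
  have h1 : A'.indicator 1 y * radialKernel f r (y - x) ≤ radialKernel f r (y - x) :=
    mul_le_of_le_one_left h0 (hi A' y)
  refine (mul_le_of_le_one_left ?_ (hi A x)).trans (h1.trans (radialKernel_le hM hfM _))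
  exact mul_nonneg (indicator_nonneg (fun _ _ => zero_le_one) _) h0

variable {p : E d → ℝ} {C : Set (E d)} {B G : ℝ}

lemma DensityBounds.integrable_indicator (h : DensityBounds p C B G) (hA : MeasurableSet A) :
    Integrable (A.indicator p) := h.integrable.indicator hA

lemma DensityBounds.indicator_nonneg (h : DensityBounds p C B G) (x : E d) :
    0 ≤ A.indicator p x := Set.indicator_nonneg (fun x _ => h.nonneg x) x

lemma DensityBounds.indicator_le (h : DensityBounds p C B G) (x : E d) :
    A.indicator p x ≤ B := (indicator_le_self' (fun x _ => h.nonneg x) x).trans (h.le x)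

/-- The mean of the edge kernel, after the substitution `y = x + z`. -/
lemma DensityBounds.integral_edgeKernel (h : DensityBounds p C B G)
    [IsProbabilityMeasure (densityMeasure p)] (hf : Measurable f) (hf0 : ∀ u, 0 ≤ f u)
    (hM : 0 ≤ M) (hfM : ∀ u, f u ≤ M) (hA : MeasurableSet A) (hA' : MeasurableSet A') :
    ∫ q, edgeKernel f r A A' q.1 q.2 ∂((densityMeasure p).prod (densityMeasure p))
      = ∫ z, radialKernel f r z * corr (A.indicator p) (A'.indicator p) z := by
  have hmE := measurable_edgeKernel (r := r) hf hA hA'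
  have hiE : Integrable (fun q : E d × E d => edgeKernel f r A A' q.1 q.2)
      ((densityMeasure p).prod (densityMeasure p)) :=
    Integrable.of_bound hmE.aestronglyMeasurable M (ae_of_all _ fun q => by
      rw [Real.norm_eq_abs, abs_of_nonneg (edgeKernel_nonneg hf0 _ _)]
      exact edgeKernel_le hf0 hM hfM _ _)
  have hdens : ∀ g : E d → ℝ, ∫ x, g x ∂(densityMeasure p) = ∫ x, p x * g x := fun g => by
    rw [densityMeasure, integral_withDensity_eq_integral_toReal_smul
      h.measurable.ennreal_ofReal (ae_of_all _ fun x => ENNReal.ofReal_lt_top)]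
    simp only [ENNReal.toReal_ofReal (h.nonneg _), smul_eq_mul]
  rw [integral_prod _ hiE, hdens]
  simp_rw [hdens]
  have hinner : ∀ x, p x * ∫ y, p y * edgeKernel f r A A' x y
      = ∫ z, radialKernel f r z * (A.indicator p x * A'.indicator p (x + z)) := fun x => by
    rw [← integral_add_left_eq_self _ x, ← integral_const_mul]
    refine integral_congr_ae (ae_of_all _ fun z => ?_)
    classical
    simp only [edgeKernel, add_sub_cancel_left, indicator_apply, Pi.one_apply]
    split_ifs <;> ring
  simp_rw [hinner, corr, ← integral_const_mul]
  refine integral_integral_swap ?_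
  have hdom : Integrable (fun q : E d × E d => A.indicator p q.1 * (B * radialKernel f r q.2))
      (volume.prod volume) :=
    (h.integrable_indicator hA).mul_prod ((integrable_radialKernel hf hf0 hfM).const_mul B)
  have hmA := h.measurable.indicator hA
  have hmA' := h.measurable.indicator hA'
  have hmK := measurable_radialKernel (d := d) (r := r) hf
  refine hdom.mono' ?_ (ae_of_all _ fun q => ?_)
  · exact ((hmK.comp measurable_snd).mul ((hmA.comp measurable_fst).mul
      (hmA'.comp (measurable_fst.add measurable_snd)))).aestronglyMeasurable
  · have h1 := h.indicator_nonneg (A := A) q.1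
    have h2 := h.indicator_nonneg (A := A') (q.1 + q.2)
    have h3 := radialKernel_nonneg (d := d) (r := r) hf0 q.2
    have h4 := h.indicator_le (A := A') (q.1 + q.2)
    simp only [Function.uncurry]
    rw [Real.norm_eq_abs, abs_of_nonneg (by positivity)]
    calc radialKernel f r q.2 * (A.indicator p q.1 * A'.indicator p (q.1 + q.2))
        = A.indicator p q.1 * (A'.indicator p (q.1 + q.2) * radialKernel f r q.2) := by ring
      _ ≤ _ := by gcongr

lemma DensityBounds.integrable_corr_integrand (h : DensityBounds p C B G) (hA : MeasurableSet A)
    (hA' : MeasurableSet A') (z : E d) :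
    Integrable fun x => A.indicator p x * A'.indicator p (x + z) := by
  have hmA := h.measurable.indicator hA
  have hmA' := h.measurable.indicator hA'
  refine ((h.integrable_indicator hA).mul_const B).mono' (by fun_prop) (ae_of_all _ fun x => ?_)
  have h1 := h.indicator_nonneg (A := A) x
  have h2 := h.indicator_nonneg (A := A') (x + z)
  rw [Real.norm_eq_abs, abs_of_nonneg (by positivity)]
  exact mul_le_mul_of_nonneg_left (h.indicator_le _) h1

end Correlation

/-! ### The bias of the volume -/

section VolumeBias

variable {d : ℕ} {p : E d → ℝ} {C H : Set (E d)} {B G : ℝ}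

lemma setIntegral_sq_eq_corr (hH : MeasurableSet H) :
    ∫ x in H, p x ^ 2 = corr (H.indicator p) p 0 := by
  rw [← integral_indicator hH, corr]
  refine integral_congr_ae (ae_of_all _ fun x => ?_)
  classical
  simp only [indicator_apply, add_zero]
  split_ifs <;> ring

/-- The correlation of `1_H p` and `p` is continuous at `0`: approximate `p` in mean by a
continuous function with compact support. No regularity of `∂C` enters. -/
lemma DensityBounds.exists_abs_corr_sub_le (h : DensityBounds p C B G) (hH : MeasurableSet H)
    {ε : ℝ} (hε : 0 < ε) :
    ∃ ρ₀ : ℝ, 0 < ρ₀ ∧ ∀ z : E d, ‖z‖ ≤ ρ₀ →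
      |corr (H.indicator p) p z - ∫ x in H, p x ^ 2| ≤ ε := by
  set a := H.indicator p with ha
  have hai : Integrable a := h.integrable_indicator hH
  have ham : Measurable a := h.measurable.indicator hH
  have hB := h.pos
  have hpm := h.measurable
  obtain ⟨g, hgs, hgp, hgc, hgi⟩ :=
    h.integrable.exists_hasCompactSupport_integral_sub_le (show 0 < ε / (4 * B) by positivity)
  obtain ⟨L, hL⟩ := hgs.exists_bound_of_continuous hgc
  have hcont : Tendsto (fun z : E d => corr a g z) (𝓝 0) (𝓝 (corr a g 0)) := by
    refine tendsto_integral_filter_of_dominated_convergence (fun x => a x * L)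
      (Eventually.of_forall fun z => by fun_prop) (Eventually.of_forall fun z =>
        ae_of_all _ fun x => ?_) (hai.mul_const L) (ae_of_all _ fun x => ?_)
    · rw [norm_mul, Real.norm_eq_abs, abs_of_nonneg (h.indicator_nonneg _)]
      exact mul_le_mul_of_nonneg_left (hL _) (h.indicator_nonneg _)
    · exact ((continuous_const.mul (hgc.comp (continuous_const.add continuous_id))).tendsto 0)
  have happ : ∀ z : E d, |corr a p z - corr a g z| ≤ ε / 4 := by
    intro z
    have hip : Integrable fun x => a x * p (x + z) := by
      simpa using h.integrable_corr_integrand hH MeasurableSet.univ z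
    have hig : Integrable fun x => a x * g (x + z) := by
      refine (hai.norm.mul_const L).mono' (by fun_prop) (ae_of_all _ fun x => ?_)
      rw [norm_mul]
      exact mul_le_mul_of_nonneg_left (hL _) (norm_nonneg _)
    have hd : Integrable fun x => ‖p (x + z) - g (x + z)‖ :=
      ((h.integrable.sub hgi).comp_add_right z).norm
    rw [corr, corr, ← integral_sub hip hig, ← Real.norm_eq_abs]
    refine (norm_integral_le_of_norm_le (hd.const_mul B) (ae_of_all _ fun x => ?_)).trans ?_
    · rw [← mul_sub, norm_mul, Real.norm_eq_abs, abs_of_nonneg (h.indicator_nonneg _)]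
      exact mul_le_mul_of_nonneg_right (h.indicator_le _) (norm_nonneg _)
    · rw [integral_const_mul, integral_add_right_eq_self (fun x => ‖p x - g x‖) z]
      calc B * ∫ x, ‖p x - g x‖ ≤ B * (ε / (4 * B)) := by gcongr
        _ = ε / 4 := by field_simp
  obtain ⟨ρ, hρ, hclose⟩ := Metric.tendsto_nhds_nhds.1 hcont (ε / 2) (by positivity)
  refine ⟨ρ / 2, by positivity, fun z hz => ?_⟩
  have h1 := hclose (x := z) (by rw [dist_zero_right]; linarith)
  rw [Real.dist_eq] at h1
  rw [setIntegral_sq_eq_corr hH, ← ha]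
  have h2 := happ z
  have h3 := happ 0
  rw [abs_le] at h2 h3 ⊢
  rw [abs_lt] at h1
  constructor <;> linarith

/-- If the layers around `∂C` are thin, the correlation of `1_H p` and `p` is Lipschitz at `0`. -/
lemma DensityBounds.exists_abs_corr_sub_le_mul (h : DensityBounds p C B G) (hH : MeasurableSet H)
    {K₀ ρ₀ : ℝ} (hK₀ : 0 ≤ K₀) (hlayer : ∀ ρ : ℝ, 0 < ρ → ρ ≤ ρ₀ →
      volume (Metric.cthickening ρ (frontier C)) ≤ ENNReal.ofReal (K₀ * ρ)) :
    ∃ K : ℝ, 0 ≤ K ∧ ∀ ρ : ℝ, 0 < ρ → ρ ≤ ρ₀ → ∀ z : E d, ‖z‖ ≤ ρ →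
      |corr (H.indicator p) p z - ∫ x in H, p x ^ 2| ≤ K * ρ := by
  have hB := h.pos
  have hG := h.nonneg_const
  refine ⟨B * (G * volume.real C + B * K₀), by positivity, fun ρ hρ hρ₀ z hz => ?_⟩
  set D := Metric.cthickening ρ (frontier C) with hD
  have hDm : MeasurableSet D := Metric.isClosed_cthickening.measurableSet
  have hCm : MeasurableSet C := h.compact.isClosed.measurableSet
  have hDv : volume D ≠ ⊤ := ne_top_of_le_ne_top ENNReal.ofReal_ne_top (hlayer ρ hρ hρ₀)
  have hDr : volume.real D ≤ K₀ * ρ :=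
    ENNReal.toReal_le_of_le_ofReal (by positivity) (hlayer ρ hρ hρ₀)
  have hip : ∀ z, Integrable fun x => H.indicator p x * p (x + z) := fun z => by
    simpa using h.integrable_corr_integrand hH MeasurableSet.univ z
  rw [setIntegral_sq_eq_corr hH, corr, corr, ← integral_sub (hip z) (hip 0), ← Real.norm_eq_abs]
  have hiC : Integrable (C.indicator fun _ => G * ρ) :=
    (integrableOn_const h.compact.measure_lt_top.ne).integrable_indicator hCm
  have hiD : Integrable (D.indicator fun _ => B) :=
    (integrableOn_const hDv).integrable_indicator hDm
  refine (norm_integral_le_of_norm_le ((hiC.add hiD).const_mul B)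
    (ae_of_all _ fun x => ?_)).trans ?_
  · rw [← mul_sub, norm_mul, Real.norm_eq_abs, Real.norm_eq_abs,
      abs_of_nonneg (h.indicator_nonneg _), add_zero]
    refine mul_le_mul (h.indicator_le _) ?_ (abs_nonneg _) hB.le
    have hxz : x + z ∈ Metric.closedBall x ρ := by simpa [dist_eq_norm] using hz
    have hx : x ∈ Metric.closedBall x ρ := Metric.mem_closedBall_self hρ.le
    simp only [Pi.add_apply]
    by_cases hxD : x ∈ D
    · have h1 : 0 ≤ C.indicator (fun _ => G * ρ) x :=
        Set.indicator_nonneg (fun _ _ => by positivity) x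
      rw [indicator_of_mem hxD]
      have := abs_sub_le_of_nonneg_of_le (h.nonneg (x + z)) (h.le (x + z)) (h.nonneg x) (h.le x)
      linarith
    · rw [indicator_of_notMem hxD, add_zero]
      by_cases hxC : x ∈ C
      · rw [indicator_of_mem hxC]
        refine (h.lipschitz x ρ hxD _ hxz _ hx).trans ?_
        rw [add_sub_cancel_left]
        gcongr
      · rw [indicator_of_notMem hxC, h.eq_zero x hxC, h.eq_zero_of_notMem x ρ hxD hxC _ hxz]
        simp
  · rw [integral_const_mul, integral_add' hiC hiD, integral_indicator hCm, integral_indicator hDm,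
      setIntegral_const, setIntegral_const, smul_eq_mul, smul_eq_mul]
    rw [mul_assoc B]
    refine mul_le_mul_of_nonneg_left ?_ hB.le
    nlinarith

end VolumeBias

/-! ### The bias of the cut -/

section CutBias

variable {k : ℕ}

lemma Hyperplane.measurableSet_pos {d : ℕ} (S : Hyperplane d) : MeasurableSet S.pos :=
  (isClosed_le continuous_const (by fun_prop : Continuous fun x : E d => inner ℝ S.normal x)
    ).measurableSet

lemma Hyperplane.measurableSet_neg {d : ℕ} (S : Hyperplane d) : MeasurableSet S.neg :=
  (isClosed_le (by fun_prop : Continuous fun x : E d => inner ℝ S.normal x) continuous_const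
    ).measurableSet

/-- The width of the strip of points `x ∈ H⁺` with `x + z ∈ H⁻`. -/
def Hyperplane.width {d : ℕ} (S : Hyperplane d) (z : E d) : ℝ := max (-inner ℝ S.normal z) 0

lemma Hyperplane.width_nonneg {d : ℕ} (S : Hyperplane d) (z : E d) : 0 ≤ S.width z :=
  le_max_right _ _

lemma Hyperplane.width_le_norm {d : ℕ} (S : Hyperplane d) (z : E d) : S.width z ≤ ‖z‖ := by
  refine max_le ?_ (norm_nonneg _)
  have := abs_real_inner_le_norm S.normal z
  rw [S.norm_normal, one_mul] at this
  exact (neg_le_abs _).trans this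

lemma Hyperplane.continuous_width {d : ℕ} (S : Hyperplane d) : Continuous S.width := by
  unfold Hyperplane.width
  fun_prop

variable {p : E (k + 1) → ℝ} {C : Set (E (k + 1))} {B G : ℝ} {S : Hyperplane (k + 1)}
  {J : E k →ₗᵢ[ℝ] E (k + 1)}

/-- The integral of `p(x) p(x + z)` over the points `x` at signed distance `t` from `S`. -/
def sliceCorr (p : E (k + 1) → ℝ) (S : Hyperplane (k + 1)) (J : E k →ₗᵢ[ℝ] E (k + 1))
    (z : E (k + 1)) (t : ℝ) : ℝ :=
  ∫ w, p ((S.offset + t) • S.normal + J w) * p ((S.offset + t) • S.normal + J w + z)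

lemma indicator_slice_mul (hJ : IsSlicing S J) (z : E (k + 1)) (t : ℝ) (w : E k) :
    S.pos.indicator p ((S.offset + t) • S.normal + J w)
        * S.neg.indicator p ((S.offset + t) • S.normal + J w + z)
      = (Icc 0 (-inner ℝ S.normal z)).indicator (fun t =>
          p ((S.offset + t) • S.normal + J w) * p ((S.offset + t) • S.normal + J w + z)) t := by
  have h1 : (S.offset + t) • S.normal + J w ∈ S.pos ↔ 0 ≤ t := by
    change S.offset ≤ inner ℝ S.normal ((S.offset + t) • S.normal + J w) ↔ _
    rw [hJ.inner_slice]
    exact le_add_iff_nonneg_right _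
  have h2 : (S.offset + t) • S.normal + J w + z ∈ S.neg ↔ t ≤ -inner ℝ S.normal z := by
    change inner ℝ S.normal ((S.offset + t) • S.normal + J w + z) ≤ S.offset ↔ _
    rw [inner_add_right, hJ.inner_slice]
    constructor <;> intro h <;> linarith
  classical
  simp only [indicator_apply, h1, h2, mem_Icc]
  by_cases ht : 0 ≤ t <;> by_cases ht' : t ≤ -inner ℝ S.normal z <;> simp [ht, ht']

/-- The correlation of `1_{H⁺} p` and `1_{H⁻} p` is an integral over the slices of the strip. -/
lemma DensityBounds.corr_eq_setIntegral (h : DensityBounds p C B G) (hJ : IsSlicing S J)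
    (z : E (k + 1)) :
    IntegrableOn (sliceCorr p S J z) (Icc 0 (-inner ℝ S.normal z)) ∧
    corr (S.pos.indicator p) (S.neg.indicator p) z
      = ∫ t in Icc 0 (-inner ℝ S.normal z), sliceCorr p S J z t := by
  have hi := h.integrable_corr_integrand S.measurableSet_pos S.measurableSet_neg z
  have hpi := (hJ.measurePreserving.integrable_comp hi.aestronglyMeasurable).2 hi
  simp only [Function.comp_def, indicator_slice_mul hJ] at hpi
  have hslice : ∀ t : ℝ, ∫ w, (Icc 0 (-inner ℝ S.normal z)).indicator (fun t =>
      p ((S.offset + t) • S.normal + J w) * p ((S.offset + t) • S.normal + J w + z)) t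
      = (Icc 0 (-inner ℝ S.normal z)).indicator (sliceCorr p S J z) t := fun t => by
    by_cases ht : t ∈ Icc 0 (-inner ℝ S.normal z)
    · simp only [indicator_of_mem ht, sliceCorr]
    · simp only [indicator_of_notMem ht, integral_zero]
  constructor
  · rw [← integrable_indicator_iff measurableSet_Icc]
    refine hpi.integral_prod_left.congr (ae_of_all _ fun t => hslice t)
  · rw [corr, ← hJ.measurePreserving.map_eq, integral_map
      hJ.measurePreserving.measurable.aemeasurable
      (by rw [hJ.measurePreserving.map_eq]; exact hi.aestronglyMeasurable)]
    simp only [indicator_slice_mul hJ]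
    rw [integral_prod _ hpi]
    simp only [hslice]
    exact integral_indicator measurableSet_Icc

/-- Near `S` the slices of the strip are all close to the surface integral of `p²`, up to an error
proportional to the distance: `p` is Lipschitz away from `∂C`, and the layer of `S` around `∂C` is
thin. -/
lemma DensityBounds.exists_abs_sliceCorr_sub_le (h : DensityBounds p C B G)
    {K₀ ρ₀ : ℝ} (hK₀ : 0 ≤ K₀) (hlayer : ∀ ρ : ℝ, 0 < ρ → ρ ≤ ρ₀ →
      volume ((fun w => S.offset • S.normal + J w) ⁻¹' Metric.cthickening ρ (frontier C))
        ≤ ENNReal.ofReal (K₀ * ρ)) :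
    ∃ K : ℝ, 0 ≤ K ∧ ∀ ρ : ℝ, 0 < ρ → 2 * ρ ≤ ρ₀ → ∀ z : E (k + 1), ‖z‖ ≤ ρ →
      ∀ t : ℝ, |t| ≤ ρ →
      |sliceCorr p S J z t - ∫ w, p (S.offset • S.normal + J w) ^ 2| ≤ K * ρ := by
  have hB := h.pos
  have hG := h.nonneg_const
  have hpm := h.measurable
  set i : E k → E (k + 1) := fun w => S.offset • S.normal + J w with hi_def
  have hiso : ∀ v : E (k + 1), Isometry fun w => v + J w := fun v =>
    (IsometryEquiv.addLeft v).isometry.comp J.isometry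
  have hJm : Measurable fun w => J w := J.continuous.measurable
  -- products of two values of the density are integrable along each slice
  have hint : ∀ v z : E (k + 1), Integrable fun w => p (v + J w) * p (v + J w + z) := by
    intro v z
    have hc : IsCompact ((fun w => v + J w) ⁻¹' C) :=
      (hiso v).isClosedEmbedding.isCompact_preimage h.compact
    have h1 : IntegrableOn (fun w => p (v + J w) * p (v + J w + z)) ((fun w => v + J w) ⁻¹' C) :=
      Measure.integrableOn_of_bounded hc.measure_lt_top.ne
        (by fun_prop) (M := B * B) (ae_of_all _ fun w => by
          rw [Real.norm_eq_abs, abs_of_nonneg (mul_nonneg (h.nonneg _) (h.nonneg _))]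
          exact mul_le_mul (h.le _) (h.le _) (h.nonneg _) hB.le)
    rwa [integrableOn_iff_integrable_of_support_subset] at h1
    intro w hw
    by_contra hwC
    exact hw (by simp only [h.eq_zero _ hwC, zero_mul])
  set A := i ⁻¹' C with hA
  have hAc : IsCompact A := (hiso _).isClosedEmbedding.isCompact_preimage h.compact
  have hAm : MeasurableSet A := hAc.isClosed.measurableSet
  refine ⟨3 * B * G * volume.real A + 2 * B ^ 2 * K₀, by positivity,
    fun ρ hρ hρ₀ z hz t ht => ?_⟩
  set D := i ⁻¹' Metric.cthickening (2 * ρ) (frontier C) with hD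
  have hDm : MeasurableSet D :=
    (Metric.isClosed_cthickening.preimage (hiso _).continuous).measurableSet
  have hDl := hlayer (2 * ρ) (by positivity) hρ₀
  have hDv : volume D ≠ ⊤ := ne_top_of_le_ne_top ENNReal.ofReal_ne_top hDl
  have hDr : volume.real D ≤ K₀ * (2 * ρ) := ENNReal.toReal_le_of_le_ofReal (by positivity) hDl
  have hI : ∫ w, p (i w) ^ 2 = ∫ w, p (i w) * p (i w + 0) := by simp [sq]
  have hiA : Integrable (A.indicator fun _ => 3 * B * G * ρ) :=
    (integrableOn_const hAc.measure_lt_top.ne).integrable_indicator hAm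
  have hiD : Integrable (D.indicator fun _ => B ^ 2) :=
    (integrableOn_const hDv).integrable_indicator hDm
  rw [hI, sliceCorr, ← integral_sub (hint _ z) (hint _ 0), ← Real.norm_eq_abs]
  refine (norm_integral_le_of_norm_le (hiA.add hiD) (ae_of_all _ fun w => ?_)).trans ?_
  · set x := (S.offset + t) • S.normal + J w with hx
    have hxi : x = i w + t • S.normal := by rw [hx, hi_def]; module
    have hxd : ‖x - i w‖ ≤ ρ := by
      rw [hxi, add_sub_cancel_left, norm_smul, S.norm_normal, mul_one]
      exact ht
    have hyd : ‖x + z - i w‖ ≤ 2 * ρ := by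
      rw [add_sub_right_comm]
      exact (norm_add_le _ _).trans (by linarith)
    have hxb : x ∈ Metric.closedBall (i w) (2 * ρ) := by
      rw [Metric.mem_closedBall, dist_eq_norm]; linarith
    have hyb : x + z ∈ Metric.closedBall (i w) (2 * ρ) := by
      rw [Metric.mem_closedBall, dist_eq_norm]; exact hyd
    have hib : i w ∈ Metric.closedBall (i w) (2 * ρ) := Metric.mem_closedBall_self (by positivity)
    rw [Real.norm_eq_abs]
    change |p x * p (x + z) - p (i w) * p (i w + 0)| ≤ _
    rw [add_zero]
    simp only [Pi.add_apply]
    by_cases hwD : w ∈ D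
    · have h1 : 0 ≤ A.indicator (fun _ => 3 * B * G * ρ) w :=
        Set.indicator_nonneg (fun _ _ => by positivity) w
      rw [indicator_of_mem hwD]
      have hb : ∀ u v, p u * p v ≤ B ^ 2 := fun u v => by
        rw [sq]; exact mul_le_mul (h.le _) (h.le _) (h.nonneg _) hB.le
      have := abs_sub_le_of_nonneg_of_le (mul_nonneg (h.nonneg x) (h.nonneg (x + z)))
        (hb x (x + z)) (mul_nonneg (h.nonneg (i w)) (h.nonneg (i w))) (hb _ _)
      linarith
    · rw [indicator_of_notMem hwD, add_zero]
      by_cases hwA : w ∈ A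
      · rw [indicator_of_mem hwA]
        have h1 := h.lipschitz _ _ hwD _ hxb _ hib
        have h2 := h.lipschitz _ _ hwD _ hyb _ hib
        have h3 : p x * p (x + z) - p (i w) * p (i w)
            = p x * (p (x + z) - p (i w)) + p (i w) * (p x - p (i w)) := by ring
        rw [h3]
        refine (abs_add_le _ _).trans ?_
        rw [abs_mul, abs_mul, abs_of_nonneg (h.nonneg x), abs_of_nonneg (h.nonneg (i w))]
        have h4 : p x * |p (x + z) - p (i w)| ≤ B * (G * (2 * ρ)) :=
          mul_le_mul (h.le x) (h2.trans (by gcongr)) (abs_nonneg _) hB.le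
        have h5 : p (i w) * |p x - p (i w)| ≤ B * (G * ρ) :=
          mul_le_mul (h.le _) (h1.trans (by gcongr)) (abs_nonneg _) hB.le
        linarith
      · rw [indicator_of_notMem hwA, h.eq_zero_of_notMem _ _ hwD hwA x hxb, h.eq_zero _ hwA]
        simp
  · rw [integral_add' hiA hiD, integral_indicator hAm, integral_indicator hDm,
      setIntegral_const, setIntegral_const, smul_eq_mul, smul_eq_mul]
    nlinarith [mul_le_mul_of_nonneg_left hDr (sq_nonneg B)]

/-- The correlation of `1_{H⁺} p` and `1_{H⁻} p` at `z` is the width of the strip times the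
surface integral of `p²`, up to a relative error proportional to `‖z‖`. -/
lemma GeneralAssumptions.exists_abs_corr_cut_sub_le (hpCS : GeneralAssumptions p C S) :
    ∃ K ρ₀ : ℝ, 0 ≤ K ∧ 0 < ρ₀ ∧ ∀ ρ : ℝ, 0 < ρ → ρ ≤ ρ₀ → ∀ z : E (k + 1), ‖z‖ ≤ ρ →
      |corr (S.pos.indicator p) (S.neg.indicator p) z
          - S.width z * ∫ s in S.carrier, p s ^ 2 ∂(Measure.euclideanHausdorffMeasure (k + 1 - 1))|
        ≤ S.width z * (K * ρ) := by
  obtain ⟨B, G, h⟩ := hpCS.exists_densityBounds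
  obtain ⟨J, hJ⟩ := exists_isSlicing S
  obtain ⟨K₀, ρ₀, hK₀, hρ₀, hlayer⟩ := exists_slice_layer_le hpCS hJ
  obtain ⟨K, hK, hb⟩ := h.exists_abs_sliceCorr_sub_le hK₀ hlayer
  refine ⟨K, ρ₀ / 2, hK, by positivity, fun ρ hρ hρ₀' z hz => ?_⟩
  obtain ⟨hint, heq⟩ := h.corr_eq_setIntegral hJ z
  rw [hJ.setIntegral_carrier (h.measurable.pow_const 2), heq]
  set I := ∫ w, p (S.offset • S.normal + J w) ^ 2 with hI
  have hvol : volume.real (Icc 0 (-inner ℝ S.normal z)) = S.width z := by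
    rw [measureReal_def, Real.volume_Icc, sub_zero, ENNReal.toReal_ofReal']
    rfl
  have hconst : IntegrableOn (fun _ : ℝ => I) (Icc 0 (-inner ℝ S.normal z)) :=
    integrableOn_const (by simp)
  have h1 : S.width z * I = ∫ _ in Icc 0 (-inner ℝ S.normal z), I := by
    rw [setIntegral_const, hvol, smul_eq_mul]
  rw [h1, ← integral_sub hint hconst, ← Real.norm_eq_abs, mul_comm, ← hvol]
  refine norm_setIntegral_le_of_norm_le_const (by simp) fun t ht => ?_
  refine hb ρ hρ (by linarith) z hz t ?_
  rw [abs_of_nonneg ht.1]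
  exact (ht.2.trans (le_max_left _ _)).trans ((S.width_le_norm z).trans hz)

end CutBias

/-! ### From correlations to the means of the edge kernels -/

section Means

variable {d : ℕ} {f : ℝ → ℝ} {r M : ℝ}

lemma measurable_corr {a b : E d → ℝ} (ha : Measurable a) (hb : Measurable b) :
    Measurable (corr a b) := by
  have h1 : StronglyMeasurable (Function.uncurry fun x z : E d => a x * b (x + z)) :=
    ((ha.comp measurable_fst).mul
      (hb.comp (measurable_fst.add measurable_snd))).stronglyMeasurable
  exact h1.integral_prod_left.measurable

/-- If `c` is close to `τ a` on the support of the kernel, with an error relative to `τ`, then so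
are the integrals against the kernel. -/
lemma abs_integral_radialKernel_mul_sub_le (hf : Measurable f) (hf0 : ∀ u, 0 ≤ f u)
    (hfM : ∀ u, f u ≤ M) {c τ : E d → ℝ} (hc : Measurable c) (hτ : Measurable τ)
    (hτ0 : ∀ z, 0 ≤ τ z) {T a e : ℝ} (hτT : ∀ z, ‖z‖ ≤ r → τ z ≤ T)
    (h : ∀ z, ‖z‖ ≤ r → |c z - τ z * a| ≤ τ z * e) :
    |(∫ z, radialKernel f r z * c z) - (∫ z, radialKernel f r z * τ z) * a|
      ≤ (∫ z, radialKernel f r z * τ z) * e := by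
  have hk0 := radialKernel_nonneg (d := d) (r := r) hf0
  have hkm := measurable_radialKernel (d := d) (r := r) hf
  have hsupp : ∀ z : E d, ¬ ‖z‖ ≤ r → radialKernel f r z = 0 := fun z hz => if_neg hz
  have hiτ : Integrable fun z => radialKernel f r z * τ z := by
    refine ((integrable_radialKernel (r := r) hf hf0 hfM).mul_const T).mono'
      (hkm.mul hτ).aestronglyMeasurable (ae_of_all _ fun z => ?_)
    rw [Real.norm_eq_abs, abs_of_nonneg (mul_nonneg (hk0 z) (hτ0 z))]
    by_cases hz : ‖z‖ ≤ r
    · exact mul_le_mul_of_nonneg_left (hτT z hz) (hk0 z)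
    · simp [hsupp z hz]
  have hbound : ∀ z, ‖radialKernel f r z * c z - radialKernel f r z * τ z * a‖
      ≤ radialKernel f r z * τ z * e := fun z => by
    by_cases hz : ‖z‖ ≤ r
    · rw [mul_assoc, ← mul_sub, norm_mul, Real.norm_eq_abs, abs_of_nonneg (hk0 z), mul_assoc]
      exact mul_le_mul_of_nonneg_left (h z hz) (hk0 z)
    · simp [hsupp z hz]
  have hic : Integrable fun z => radialKernel f r z * c z := by
    have h1 : Integrable fun z => radialKernel f r z * c z - radialKernel f r z * τ z * a :=
      (hiτ.mul_const e).mono' ((hkm.mul hc).sub ((hkm.mul hτ).mul_const a)).aestronglyMeasurable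
        (ae_of_all _ hbound)
    exact (h1.add (hiτ.mul_const a)).congr (ae_of_all _ fun z => sub_add_cancel _ _)
  rw [← integral_mul_const, ← integral_mul_const, ← integral_sub hic (hiτ.mul_const a),
    ← Real.norm_eq_abs]
  exact norm_integral_le_of_norm_le (hiτ.mul_const e) (ae_of_all _ hbound)

/-- The mean of the edge kernel of `A` and `A'` under independent points with density `p`. -/
def edgeMean (p : E d → ℝ) (f : ℝ → ℝ) (r : ℝ) (A A' : Set (E d)) : ℝ :=
  ∫ z, edgeKernel f r A A' z.1 z.2 ∂((densityMeasure p).prod (densityMeasure p))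

/-- The total mass of the edge weight. -/
def kernelMass (d : ℕ) (f : ℝ → ℝ) (r : ℝ) : ℝ := ∫ z : E d, radialKernel f r z

/-- The integral of the edge weight against the width of the strip along the hyperplane. -/
def kernelWidth (f : ℝ → ℝ) (r : ℝ) (S : Hyperplane d) : ℝ :=
  ∫ z, radialKernel f r z * S.width z

variable {p : E d → ℝ} {C : Set (E d)} {B G : ℝ} [IsProbabilityMeasure (densityMeasure p)]

lemma DensityBounds.abs_edgeMean_univ_sub_le (h : DensityBounds p C B G) (hf : Measurable f)
    (hf0 : ∀ u, 0 ≤ f u) (hM : 0 ≤ M) (hfM : ∀ u, f u ≤ M) {H : Set (E d)}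
    (hH : MeasurableSet H) {e : ℝ}
    (he : ∀ z : E d, ‖z‖ ≤ r → |corr (H.indicator p) p z - ∫ x in H, p x ^ 2| ≤ e) :
    |edgeMean p f r H univ - kernelMass d f r * ∫ x in H, p x ^ 2| ≤ kernelMass d f r * e := by
  have := abs_integral_radialKernel_mul_sub_le (r := r) hf hf0 hfM
    (measurable_corr (h.measurable.indicator hH) h.measurable)
    (τ := fun _ => 1) measurable_const (fun _ => zero_le_one) (T := 1) (fun _ _ => le_rfl)
    (a := ∫ x in H, p x ^ 2) (e := e) (fun z hz => by simpa using he z hz)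
  rw [edgeMean, h.integral_edgeKernel hf hf0 hM hfM hH MeasurableSet.univ, indicator_univ,
    kernelMass]
  simpa only [mul_one] using this

lemma DensityBounds.abs_edgeMean_cut_sub_le (h : DensityBounds p C B G) (hf : Measurable f)
    (hf0 : ∀ u, 0 ≤ f u) (hM : 0 ≤ M) (hfM : ∀ u, f u ≤ M) {S : Hyperplane d} {a e : ℝ}
    (he : ∀ z : E d, ‖z‖ ≤ r →
      |corr (S.pos.indicator p) (S.neg.indicator p) z - S.width z * a| ≤ S.width z * e) :
    |edgeMean p f r S.pos S.neg - kernelWidth f r S * a| ≤ kernelWidth f r S * e := by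
  rw [edgeMean, h.integral_edgeKernel hf hf0 hM hfM S.measurableSet_pos S.measurableSet_neg]
  exact abs_integral_radialKernel_mul_sub_le hf hf0 hfM
    (measurable_corr (h.measurable.indicator S.measurableSet_pos)
      (h.measurable.indicator S.measurableSet_neg)) S.continuous_width.measurable S.width_nonneg
    (T := r) (fun z hz => (S.width_le_norm z).trans hz) he

lemma kernelMass_nonneg (hf0 : ∀ u, 0 ≤ f u) : 0 ≤ kernelMass d f r :=
  integral_nonneg fun z => radialKernel_nonneg hf0 z

lemma kernelWidth_nonneg (hf0 : ∀ u, 0 ≤ f u) (S : Hyperplane d) : 0 ≤ kernelWidth f r S :=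
  integral_nonneg fun z => mul_nonneg (radialKernel_nonneg hf0 z) (S.width_nonneg z)

end Means

/-! ### The cut and the volumes as sums over pairs -/

section GraphSums

variable {d : ℕ} (f : ℝ → ℝ) (r : ℝ) (x : ℕ → E d)

lemma sum_sum_fin_eq_pairSum {α : Type*} (n : ℕ) (h : α → α → ℝ) (x : ℕ → α) :
    ∑ i : Fin n, ∑ j : Fin n, (if i ≠ j then h (x i) (x j) else 0) = pairSum n h x := by
  have h1 : ∀ i : Fin n, ∑ j : Fin n, (if i ≠ j then h (x i) (x j) else 0)
      = ∑ j ∈ Finset.range n, if (i : ℕ) ≠ j then h (x i) (x j) else 0 := fun i => by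
    rw [← Fin.sum_univ_eq_sum_range (fun j => if (i : ℕ) ≠ j then h (x i) (x j) else 0)]
    simp only [ne_eq, Fin.ext_iff]
  simp only [h1]
  rw [Fin.sum_univ_eq_sum_range
    (fun i => ∑ j ∈ Finset.range n, if i ≠ j then h (x i) (x j) else 0),
    ← Finset.sum_product', ← Finset.sum_filter, pairSum]
  congr 1
  ext p
  simp [Finset.mem_offDiag, and_assoc]

lemma edgeKernel_eq_ite (A A' : Set (E d)) [DecidablePred (· ∈ A)] [DecidablePred (· ∈ A')]
    (y z : E d) : edgeKernel f r A A' y z =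
      if y ∈ A then (if z ∈ A' then (if dist y z ≤ r then f (dist y z) else 0) else 0) else 0 := by
  rw [dist_comm, dist_eq_norm]
  simp only [edgeKernel, radialKernel, indicator_apply, Pi.one_apply]
  split_ifs <;> simp

lemma vol_eq_pairSum (n : ℕ) (H : Set (E d)) :
    vol (rGraphWeight f r fun i : Fin n => x i) (pointsIn (fun i : Fin n => x i) H)
      = pairSum n (edgeKernel f r H univ) x := by
  classical
  rw [← sum_sum_fin_eq_pairSum, vol, pointsIn, Finset.sum_filter]
  refine Finset.sum_congr rfl fun i _ => ?_
  by_cases hi : x i ∈ H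
  · rw [if_pos hi]
    refine Finset.sum_congr rfl fun j _ => ?_
    rw [rGraphWeight, edgeKernel_eq_ite]
    by_cases hij : i = j <;> simp [hi, hij]
  · rw [if_neg hi]
    refine (Finset.sum_eq_zero fun j _ => ?_).symm
    rw [edgeKernel_eq_ite]
    simp [hi]

lemma cut_eq_pairSum (n : ℕ) (A A' : Set (E d)) :
    cut (rGraphWeight f r fun i : Fin n => x i) (pointsIn (fun i : Fin n => x i) A)
        (pointsIn (fun i : Fin n => x i) A')
      = 2 * pairSum n (edgeKernel f r A A') x := by
  classical
  rw [← sum_sum_fin_eq_pairSum, cut, pointsIn, pointsIn, Finset.sum_filter, Finset.mul_sum]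
  refine Finset.sum_congr rfl fun i _ => ?_
  by_cases hi : x i ∈ A
  · rw [if_pos hi, Finset.sum_filter, Finset.mul_sum]
    refine Finset.sum_congr rfl fun j _ => ?_
    rw [rGraphWeight, rGraphWeight, edgeKernel_eq_ite, dist_comm (x j)]
    by_cases hij : i = j
    · simp [hij]
    · by_cases hj : x j ∈ A'
      · simp only [hi, hj, if_true, ne_eq, hij, Ne.symm hij, not_false_eq_true, true_and]
        ring
      · simp [hj]
  · rw [if_neg hi, Finset.sum_eq_zero, mul_zero]
    intro j _
    rw [edgeKernel_eq_ite]
    simp [hi]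

end GraphSums

/-! ### The quality measures as functions of the cut and the volumes -/

section QualityValue

lemma Quality.value_scale (q : Quality) {c v₁ v₂ s t : ℝ} (ht : 0 < t) :
    t / s * q.value c v₁ v₂ = q.value (c / s) (v₁ / t) (v₂ / t) := by
  cases q
  · simp only [Quality.value, one_div, inv_div]
    ring
  · simp only [Quality.value]
    rw [min_div_div_right ht.le]
    rw [div_mul_div_comm, div_div_div_eq, mul_comm t]

lemma abs_div_sub_div_le {c c₀ v v₀ m ε : ℝ} (hm : 0 < m) (hv₀ : m ≤ v₀) (hε : ε ≤ m / 2)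
    (hc : |c - c₀| ≤ ε) (hv : |v - v₀| ≤ ε) :
    |c / v - c₀ / v₀| ≤ (2 / m + 2 * |c₀| / m ^ 2) * ε := by
  have hε0 : 0 ≤ ε := (abs_nonneg _).trans hc
  have hv1 : m / 2 ≤ v := by
    have := (abs_le.1 hv).1
    linarith
  have hv0 : 0 < v := by linarith
  have hv00 : 0 < v₀ := by linarith
  have h1 : c / v - c₀ / v₀ = (c - c₀) / v + c₀ * (v₀ - v) / (v * v₀) := by
    field_simp
    ring
  have h2 : |(c - c₀) / v| ≤ 2 / m * ε := by
    rw [abs_div, abs_of_pos hv0, div_le_iff₀ hv0]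
    have : 1 ≤ 2 / m * v := by
      rw [div_mul_eq_mul_div, le_div_iff₀ hm]; linarith
    nlinarith
  have h3 : |c₀ * (v₀ - v) / (v * v₀)| ≤ 2 * |c₀| / m ^ 2 * ε := by
    rw [abs_div, abs_mul, abs_of_pos (mul_pos hv0 hv00), abs_sub_comm]
    have h4 : m ^ 2 / 2 ≤ v * v₀ := by nlinarith
    calc |c₀| * |v - v₀| / (v * v₀) ≤ |c₀| * ε / (m ^ 2 / 2) := by gcongr
      _ = 2 * |c₀| / m ^ 2 * ε := by field_simp
  rw [h1, add_mul]
  exact (abs_add_le _ _).trans (add_le_add h2 h3)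

/-- The quality measures are Lipschitz near limits with positive volumes. -/
lemma Quality.exists_lipschitz (q : Quality) (c₀ : ℝ) {v₁ v₂ : ℝ} (h₁ : 0 < v₁) (h₂ : 0 < v₂) :
    ∃ L ε₀ : ℝ, 0 < L ∧ 0 < ε₀ ∧ ∀ ε : ℝ, ε ≤ ε₀ → ∀ c u₁ u₂ : ℝ, |c - c₀| ≤ ε → |u₁ - v₁| ≤ ε →
      |u₂ - v₂| ≤ ε → |q.value c u₁ u₂ - q.value c₀ v₁ v₂| ≤ L * ε := by
  set m := min v₁ v₂ with hm
  have hm0 : 0 < m := lt_min h₁ h₂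
  refine ⟨2 * (2 / m + 2 * |c₀| / m ^ 2), m / 2, by positivity, by positivity,
    fun ε hε c u₁ u₂ hc hu₁ hu₂ => ?_⟩
  have hε0 : 0 ≤ ε := (abs_nonneg _).trans hc
  cases q
  · have e1 := abs_div_sub_div_le hm0 (min_le_left _ _) hε hc hu₁
    have e2 := abs_div_sub_div_le hm0 (min_le_right _ _) hε hc hu₂
    have e3 : c * (1 / u₁ + 1 / u₂) - c₀ * (1 / v₁ + 1 / v₂)
        = (c / u₁ - c₀ / v₁) + (c / u₂ - c₀ / v₂) := by ring
    simp only [Quality.value]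
    rw [e3]
    refine (abs_add_le _ _).trans ?_
    linarith
  · have e1 : |min u₁ u₂ - m| ≤ ε :=
      (abs_min_sub_min_le_max u₁ u₂ v₁ v₂).trans (max_le hu₁ hu₂)
    have e2 := abs_div_sub_div_le hm0 le_rfl hε hc e1
    simp only [Quality.value]
    refine e2.trans ?_
    have : 0 ≤ (2 / m + 2 * |c₀| / m ^ 2) * ε := by positivity
    linarith

end QualityValue

/-! ### Moments of the edge weights -/

section Moments

variable {k : ℕ}

lemma measurable_mul_width {d : ℕ} {F : E d → ℝ} (hF : Measurable F) (S : Hyperplane d) :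
    Measurable fun z => F z * S.width z := hF.mul S.continuous_width.measurable

/-- Integration against the width of the strip, slice by slice. -/
lemma exists_integral_mul_width_eq (S : Hyperplane (k + 1)) :
    ∃ J : E k →ₗᵢ[ℝ] E (k + 1), (∀ t w, ‖t • S.normal + J w‖ ^ 2 = t ^ 2 + ‖w‖ ^ 2) ∧
      ∀ F : E (k + 1) → ℝ, Integrable (fun z => F z * S.width z) →
        ∫ z, F z * S.width z = ∫ t in Iic (0 : ℝ), -t * ∫ w, F (t • S.normal + J w) := by
  obtain ⟨J, hJ⟩ := exists_isSlicing (⟨S.normal, S.norm_normal, 0⟩ : Hyperplane (k + 1))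
  have hw : ∀ t w, S.width (t • S.normal + J w) = max (-t) 0 := fun t w => by
    have := hJ.inner_slice t w
    simp only [zero_add] at this
    rw [Hyperplane.width, this]
  refine ⟨J, fun t w => ?_, fun F hF => ?_⟩
  · have h0 : inner ℝ (t • S.normal) (J w) = 0 := by
      rw [inner_smul_left, hJ.inner_eq_zero, mul_zero]
    rw [norm_add_sq_real, h0, norm_smul, S.norm_normal, J.norm_map, Real.norm_eq_abs, mul_one,
      sq_abs]
    ring
  · have hmp := hJ.measurePreserving
    simp only [zero_add] at hmp
    have hi := (hmp.integrable_comp hF.aestronglyMeasurable).2 hF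
    simp only [Function.comp_def] at hi
    rw [← hmp.map_eq, integral_map hmp.measurable.aemeasurable
      (by rw [hmp.map_eq]; exact hF.aestronglyMeasurable)]
    rw [integral_prod _ hi, ← integral_indicator measurableSet_Iic]
    refine integral_congr_ae (ae_of_all _ fun t => ?_)
    simp only [hw]
    rw [integral_mul_const, mul_comm]
    by_cases ht : t ≤ 0
    · rw [indicator_of_mem (show t ∈ Iic (0 : ℝ) from ht), max_eq_left (by linarith)]
    · rw [indicator_of_notMem (show t ∉ Iic (0 : ℝ) from ht), max_eq_right (by linarith), zero_mul]

lemma ballVolume_pos (d : ℕ) : 0 < ballVolume d :=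
  ENNReal.toReal_pos (Metric.measure_closedBall_pos volume _ one_pos).ne'
    (isCompact_closedBall _ _).measure_lt_top.ne

lemma radialKernel_one_eq {d : ℕ} (r : ℝ) :
    radialKernel (d := d) (fun _ => 1) r = (Metric.closedBall 0 r).indicator 1 := by
  ext z
  classical
  simp only [radialKernel, indicator_apply, mem_closedBall_zero_iff, Pi.one_apply]

lemma kernelMass_one (d : ℕ) {r : ℝ} (hr : 0 ≤ r) :
    kernelMass d (fun _ => 1) r = r ^ d * ballVolume d := by
  rw [kernelMass, radialKernel_one_eq,
    integral_indicator_one Metric.isClosed_closedBall.measurableSet,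
    Measure.addHaar_real_closedBall' _ _ hr, finrank_euclideanSpace_fin, ballVolume]

lemma integrable_radialKernel_mul_width {d : ℕ} {f : ℝ → ℝ} {r M : ℝ} (hf : Measurable f)
    (hf0 : ∀ u, 0 ≤ f u) (hfM : ∀ u, f u ≤ M) (S : Hyperplane d) :
    Integrable fun z => radialKernel f r z * S.width z := by
  refine ((integrable_radialKernel (r := r) hf hf0 hfM).mul_const r).mono'
    (measurable_mul_width (measurable_radialKernel hf) S).aestronglyMeasurable
    (ae_of_all _ fun z => ?_)
  rw [Real.norm_eq_abs, abs_of_nonneg (mul_nonneg (radialKernel_nonneg hf0 z) (S.width_nonneg z))]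
  by_cases hz : ‖z‖ ≤ r
  · exact mul_le_mul_of_nonneg_left ((S.width_le_norm z).trans hz) (radialKernel_nonneg hf0 z)
  · simp [radialKernel, hz]

/-- The slices of the ball are balls of radius `√(r² - t²)`. -/
lemma kernelWidth_one {r : ℝ} (hr : 0 ≤ r) (S : Hyperplane (k + 1)) :
    kernelWidth (fun _ => 1) r S = r ^ (k + 2) * (ballVolume k / (k + 2)) := by
  obtain ⟨J, hnorm, hint⟩ := exists_integral_mul_width_eq S
  rw [kernelWidth, hint _ (integrable_radialKernel_mul_width measurable_const
    (fun _ => zero_le_one) (fun _ => le_rfl) S)]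
  -- for `k = 0` the slice at `t = -r` is a point of measure one, hence the exception
  have hslice : ∀ t ∈ Iic (0 : ℝ), -t * ∫ w, radialKernel (fun _ => 1) r (t • S.normal + J w)
      = (Ioc (-r) 0).indicator (fun t => -t * √(r ^ 2 - t ^ 2) ^ k * ballVolume k) t
        ∨ t = -r := by
    intro t ht
    have hk : ∀ w, ‖t • S.normal + J w‖ ≤ r ↔ t ^ 2 + ‖w‖ ^ 2 ≤ r ^ 2 := fun w => by
      rw [← hnorm, sq_le_sq₀ (norm_nonneg _) hr]
    by_cases htr : -r < t
    · left
      have hpos : 0 ≤ r ^ 2 - t ^ 2 := by nlinarith [show t ≤ 0 from ht]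
      have : (fun w => radialKernel (fun _ => 1) r (t • S.normal + J w))
          = radialKernel (d := k) (fun _ => 1) √(r ^ 2 - t ^ 2) := by
        ext w
        simp only [radialKernel, hk, Real.le_sqrt (norm_nonneg _) hpos, le_sub_iff_add_le']
      rw [this]
      have h2 := kernelMass_one k (Real.sqrt_nonneg (r ^ 2 - t ^ 2))
      rw [kernelMass] at h2
      rw [h2, indicator_of_mem (show t ∈ Ioc (-r) 0 from ⟨htr, ht⟩), mul_assoc]
    · rcases eq_or_lt_of_le (not_lt.1 htr) with h | h
      · exact Or.inr h
      · left
        rw [indicator_of_notMem fun h' => htr h'.1]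
        have : ∀ w, radialKernel (fun _ => 1) r (t • S.normal + J w) = 0 := fun w => by
          rw [radialKernel, if_neg]
          rw [hk]
          nlinarith [sq_nonneg ‖w‖]
        simp [this]
  have hae : ∀ᵐ t : ℝ ∂volume, t ∈ Iic (0 : ℝ) →
      -t * ∫ w, radialKernel (fun _ => 1) r (t • S.normal + J w)
        = (Ioc (-r) 0).indicator (fun t => -t * √(r ^ 2 - t ^ 2) ^ k * ballVolume k) t := by
    have : ∀ᵐ t : ℝ ∂volume, t ≠ -r := by simp [ae_iff]
    filter_upwards [this] with t ht ht0
    exact (hslice t ht0).resolve_right ht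
  rw [setIntegral_congr_ae measurableSet_Iic hae, setIntegral_indicator measurableSet_Ioc,
    inter_eq_self_of_subset_right (fun t ht => ht.2), integral_mul_const,
    ← intervalIntegral.integral_of_le (by linarith)]
  have hFTC : ∫ t in (-r)..0, -t * √(r ^ 2 - t ^ 2) ^ k = r ^ (k + 2) / (k + 2) := by
    have hk2 : ((k : ℝ) + 2) ≠ 0 := by positivity
    rw [intervalIntegral.integral_eq_sub_of_hasDerivAt_of_le (by linarith)
      (f := fun t => √(r ^ 2 - t ^ 2) ^ (k + 2) / (k + 2)) (by fun_prop) (fun t ht => ?_)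
      (Continuous.intervalIntegrable (by fun_prop) _ _)]
    · have h0 : √(r ^ 2 - (-r) ^ 2) = 0 := by simp
      have h1 : √(r ^ 2 - 0 ^ 2) = r := by simp [Real.sqrt_sq hr]
      simp only [h0, h1]
      simp
    · have hpos : 0 < r ^ 2 - t ^ 2 := by nlinarith [ht.1, ht.2]
      have hs : 0 < √(r ^ 2 - t ^ 2) := Real.sqrt_pos.2 hpos
      have hd : HasDerivAt (fun t : ℝ => r ^ 2 - t ^ 2) (-(2 * t)) t := by
        simpa using (hasDerivAt_pow 2 t).const_sub (r ^ 2)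
      have := ((hd.sqrt hpos.ne').pow (k + 2)).div_const ((k : ℝ) + 2)
      convert! this using 1
      push_cast
      field_simp
      ring
  rw [hFTC]
  ring

/-! ### Moments of the Gaussian weights -/

/-- The maximal value of the Gaussian weight function. -/
def gaussianMax (d : ℕ) (σ : ℝ) : ℝ := (σ ^ d)⁻¹ * ((2 * Real.pi) ^ ((d : ℝ) / 2))⁻¹

variable {d : ℕ} {σ r : ℝ}

lemma gaussianWeight_eq (d : ℕ) (hσ : 0 < σ) (u : ℝ) :
    gaussianWeight d σ u = gaussianMax d σ * Real.exp (-(1 / 2) * (u ^ 2 / σ ^ 2)) := by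
  have h1 : (σ ^ 2) ^ ((d : ℝ) / 2) = σ ^ d := by
    rw [← Real.rpow_natCast σ 2, ← Real.rpow_mul hσ.le]
    push_cast
    rw [mul_div_cancel₀ _ (by norm_num : (2 : ℝ) ≠ 0), Real.rpow_natCast]
  rw [gaussianWeight, gaussianMax, Real.mul_rpow (by positivity) (by positivity), h1, one_div,
    mul_inv, mul_comm (((2 * Real.pi) ^ ((d : ℝ) / 2))⁻¹)]

lemma gaussianMax_pos (d : ℕ) (hσ : 0 < σ) : 0 < gaussianMax d σ := by
  unfold gaussianMax
  positivity

lemma gaussianWeight_nonneg (hσ : 0 < σ) (u : ℝ) : 0 ≤ gaussianWeight d σ u := by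
  rw [gaussianWeight_eq d hσ]
  exact mul_nonneg (gaussianMax_pos d hσ).le (Real.exp_pos _).le

lemma gaussianWeight_le (hσ : 0 < σ) (u : ℝ) : gaussianWeight d σ u ≤ gaussianMax d σ := by
  rw [gaussianWeight_eq d hσ]
  refine mul_le_of_le_one_right (gaussianMax_pos d hσ).le (Real.exp_le_one_iff.2 ?_)
  have : 0 ≤ u ^ 2 / σ ^ 2 := by positivity
  linarith

lemma measurable_gaussianWeight : Measurable (gaussianWeight d σ) := by
  unfold gaussianWeight
  fun_prop

lemma gaussianMax_le (d : ℕ) (hσ : 0 < σ) : gaussianMax d σ ≤ (σ ^ d)⁻¹ := by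
  refine mul_le_of_le_one_right (by positivity) (inv_le_one_of_one_le₀ ?_)
  refine Real.one_le_rpow ?_ (by positivity)
  linarith [Real.two_le_pi]

/-- Two-sided bounds for the integral of a weight function that is nearly constant on `[0, r]`. -/
lemma integral_radialKernel_mul_mem_Icc {f : ℝ → ℝ} {M : ℝ} (hf : Measurable f)
    (hf0 : ∀ u, 0 ≤ f u) (hfM : ∀ u, f u ≤ M) {τ : E d → ℝ} (hτ : Measurable τ)
    (hτ0 : ∀ z, 0 ≤ τ z) {T : ℝ} (hτT : ∀ z, ‖z‖ ≤ r → τ z ≤ T) {lo : ℝ}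
    (hlo : ∀ u, 0 ≤ u → u ≤ r → lo ≤ f u) :
    lo * ∫ z, radialKernel (fun _ => 1) r z * τ z ≤ ∫ z, radialKernel f r z * τ z ∧
    ∫ z, radialKernel f r z * τ z ≤ M * ∫ z, radialKernel (fun _ => 1) r z * τ z := by
  have hi : ∀ g : ℝ → ℝ, ∀ N : ℝ, Measurable g → (∀ u, 0 ≤ g u) → (∀ u, g u ≤ N) →
      Integrable fun z => radialKernel g r z * τ z := fun g N hg hg0 hgN => by
    refine ((integrable_radialKernel (r := r) hg hg0 hgN).mul_const T).mono'
      ((measurable_radialKernel hg).mul hτ).aestronglyMeasurable (ae_of_all _ fun z => ?_)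
    rw [Real.norm_eq_abs, abs_of_nonneg (mul_nonneg (radialKernel_nonneg hg0 z) (hτ0 z))]
    by_cases hz : ‖z‖ ≤ r
    · exact mul_le_mul_of_nonneg_left (hτT z hz) (radialKernel_nonneg hg0 z)
    · simp [radialKernel, hz]
  have hif := hi f M hf hf0 hfM
  have hi1 := hi (fun _ => 1) 1 measurable_const (fun _ => zero_le_one) (fun _ => le_rfl)
  rw [← integral_const_mul, ← integral_const_mul]
  constructor
  · refine integral_mono (hi1.const_mul lo) hif fun z => ?_
    by_cases hz : ‖z‖ ≤ r
    · simpa [radialKernel, hz] using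
        mul_le_mul_of_nonneg_right (hlo _ (norm_nonneg z) hz) (hτ0 z)
    · simp [radialKernel, hz]
  · refine integral_mono hif (hi1.const_mul M) fun z => ?_
    by_cases hz : ‖z‖ ≤ r
    · simpa [radialKernel, hz] using mul_le_mul_of_nonneg_right (hfM ‖z‖) (hτ0 z)
    · simp [radialKernel, hz]

/-- When the radius is dominated by the bandwidth, the Gaussian weights are nearly constant. -/
lemma tendsto_integral_gaussian_small {r σ : ℕ → ℝ} (hσ : ∀ n, 0 < σ n)
    (hrσ : Tendsto (fun n => r n / σ n) atTop (𝓝 0)) {τ : E d → ℝ} (hτ : Measurable τ)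
    (hτ0 : ∀ z, 0 ≤ τ z) {T : ℕ → ℝ} (hτT : ∀ n z, ‖z‖ ≤ r n → τ z ≤ T n) {s : ℕ → ℝ} {c : ℝ}
    (hs : ∀ n, 0 < s n)
    (hone : ∀ n, ∫ z, radialKernel (fun _ => 1) (r n) z * τ z = s n * c) :
    Tendsto (fun n => (∫ z, radialKernel (gaussianWeight d (σ n)) (r n) z * τ z)
      / (((σ n) ^ d)⁻¹ * s n)) atTop (𝓝 (c / (2 * Real.pi) ^ ((d : ℝ) / 2))) := by
  set e : ℕ → ℝ := fun n => Real.exp (-(1 / 2) * (r n / σ n) ^ 2) with he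
  have hkey : ∀ n, e n * (c / (2 * Real.pi) ^ ((d : ℝ) / 2))
        ≤ (∫ z, radialKernel (gaussianWeight d (σ n)) (r n) z * τ z) / (((σ n) ^ d)⁻¹ * s n) ∧
      (∫ z, radialKernel (gaussianWeight d (σ n)) (r n) z * τ z) / (((σ n) ^ d)⁻¹ * s n)
        ≤ c / (2 * Real.pi) ^ ((d : ℝ) / 2) := by
    intro n
    have hσn := hσ n
    have hsn := hs n
    obtain ⟨h1, h2⟩ := integral_radialKernel_mul_mem_Icc (r := r n) measurable_gaussianWeight
      (gaussianWeight_nonneg (d := d) hσn) (gaussianWeight_le hσn) hτ hτ0 (hτT n)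
      (lo := gaussianMax d (σ n) * e n) fun u hu hur => by
        rw [gaussianWeight_eq d hσn, ← div_pow]
        refine mul_le_mul_of_nonneg_left (Real.exp_le_exp.2 ?_) (gaussianMax_pos d hσn).le
        have : (u / σ n) ^ 2 ≤ (r n / σ n) ^ 2 := by gcongr
        linarith
    rw [hone n] at h1 h2
    have hpos : 0 < ((σ n) ^ d)⁻¹ * s n := by positivity
    rw [le_div_iff₀ hpos, div_le_iff₀ hpos]
    refine ⟨le_trans (le_of_eq ?_) h1, h2.trans_eq ?_⟩ <;> rw [gaussianMax] <;> ring
  have het : Tendsto e atTop (𝓝 1) := by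
    have h1 : Tendsto (fun n => -(1 / 2) * (r n / σ n) ^ 2) atTop (𝓝 (-(1 / 2) * 0 ^ 2)) :=
      (hrσ.pow 2).const_mul _
    have := (Real.continuous_exp.tendsto _).comp h1
    simpa [Function.comp_def, he] using this
  refine tendsto_of_tendsto_of_tendsto_of_le_of_le ?_ tendsto_const_nhds
    (fun n => (hkey n).1) (fun n => (hkey n).2)
  simpa using het.mul_const (c / (2 * Real.pi) ^ ((d : ℝ) / 2))

/-- Rescaling by the bandwidth. -/
lemma integral_gaussian_scale (hσ : 0 < σ) {τ : E d → ℝ} {j : ℕ}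
    (hτ : ∀ z, τ (σ • z) = σ ^ j * τ z) :
    ∫ z, radialKernel (gaussianWeight d σ) r z * τ z
      = σ ^ j * ∫ z, radialKernel (gaussianWeight d 1) (r / σ) z * τ z := by
  have h := Measure.integral_comp_smul_of_nonneg (volume : Measure (E d))
    (fun z => radialKernel (gaussianWeight d σ) r z * τ z) σ (hR := hσ.le)
  rw [finrank_euclideanSpace_fin, smul_eq_mul, eq_inv_mul_iff_mul_eq₀ (by positivity)] at h
  rw [← h, ← integral_const_mul, ← integral_const_mul]
  refine integral_congr_ae (ae_of_all _ fun z => ?_)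
  simp only [hτ, radialKernel, norm_smul, Real.norm_eq_abs, abs_of_pos hσ, le_div_iff₀ hσ,
    mul_comm σ ‖z‖]
  split_ifs
  · rw [gaussianWeight_eq d hσ, gaussianWeight_eq d one_pos, gaussianMax, gaussianMax]
    have : (‖z‖ * σ) ^ 2 / σ ^ 2 = ‖z‖ ^ 2 / 1 ^ 2 := by field_simp
    rw [this]
    field_simp
    simp
  · simp

lemma integrable_exp_neg_mul_norm_sq {b : ℝ} (hb : 0 < b) :
    Integrable fun z : E d => Real.exp (-b * ‖z‖ ^ 2) := by
  by_contra h
  have h1 := integral_undef h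
  rw [GaussianFourier.integral_rexp_neg_mul_sq_norm hb] at h1
  have : 0 < (Real.pi / b) ^ ((Module.finrank ℝ (E d) : ℝ) / 2) := by positivity
  linarith

lemma gaussianWeight_one_eq (z : E d) : gaussianWeight d 1 ‖z‖
    = ((2 * Real.pi) ^ ((d : ℝ) / 2))⁻¹ * Real.exp (-(1 / 2) * ‖z‖ ^ 2) := by
  rw [gaussianWeight_eq d one_pos, gaussianMax]
  simp

/-- As the truncation radius tends to infinity, so do the truncated moments. -/
lemma tendsto_integral_gaussian_large {τ : E d → ℝ} (hτ : Measurable τ)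
    (hi : Integrable fun z : E d => gaussianWeight d 1 ‖z‖ * τ z) :
    Tendsto (fun R => ∫ z, radialKernel (gaussianWeight d 1) R z * τ z) atTop
      (𝓝 (∫ z, gaussianWeight d 1 ‖z‖ * τ z)) := by
  refine tendsto_integral_filter_of_dominated_convergence
    (fun z => ‖gaussianWeight d 1 ‖z‖ * τ z‖)
    (Eventually.of_forall fun R =>
      ((measurable_radialKernel measurable_gaussianWeight).mul hτ).aestronglyMeasurable)
    (Eventually.of_forall fun R => ae_of_all _ fun z => ?_) hi.norm (ae_of_all _ fun z => ?_)
  · unfold radialKernel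
    split_ifs
    · exact le_rfl
    · rw [zero_mul, norm_zero]
      exact norm_nonneg _
  · refine tendsto_const_nhds.congr' ?_
    filter_upwards [eventually_ge_atTop ‖z‖] with R hR
    rw [radialKernel, if_pos hR]

lemma integral_gaussianWeight_one : ∫ z : E d, gaussianWeight d 1 ‖z‖ = 1 := by
  simp only [gaussianWeight_one_eq]
  rw [integral_const_mul, GaussianFourier.integral_rexp_neg_mul_sq_norm (by norm_num),
    finrank_euclideanSpace_fin, show Real.pi / (1 / 2) = 2 * Real.pi by ring]
  exact inv_mul_cancel₀ (by positivity)

lemma integrable_gaussianWeight_one_mul_width (S : Hyperplane d) :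
    Integrable fun z : E d => gaussianWeight d 1 ‖z‖ * S.width z := by
  refine ((integrable_exp_neg_mul_norm_sq (d := d) (b := 1 / 4) (by norm_num)).const_mul
    ((2 * Real.pi) ^ ((d : ℝ) / 2))⁻¹).mono' (measurable_mul_width
      (measurable_gaussianWeight.comp measurable_norm) S).aestronglyMeasurable
    (ae_of_all _ fun z => ?_)
  rw [Real.norm_eq_abs, abs_of_nonneg (mul_nonneg (gaussianWeight_nonneg one_pos _)
    (S.width_nonneg z)), gaussianWeight_one_eq, mul_assoc]
  refine mul_le_mul_of_nonneg_left ?_ (by positivity)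
  -- the linear growth of the width is absorbed by half of the exponent
  have h1 : S.width z ≤ Real.exp (1 / 4 * ‖z‖ ^ 2) := by
    refine (S.width_le_norm z).trans (le_trans ?_ (Real.add_one_le_exp _))
    nlinarith [sq_nonneg (‖z‖ / 2 - 1)]
  calc Real.exp (-(1 / 2) * ‖z‖ ^ 2) * S.width z
      ≤ Real.exp (-(1 / 2) * ‖z‖ ^ 2) * Real.exp (1 / 4 * ‖z‖ ^ 2) := by gcongr
    _ = Real.exp (-(1 / 4) * ‖z‖ ^ 2) := by rw [← Real.exp_add]; ring_nf

lemma integral_gaussianWeight_one_mul_width (S : Hyperplane (k + 1)) :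
    ∫ z, gaussianWeight (k + 1) 1 ‖z‖ * S.width z = 1 / √(2 * Real.pi) := by
  obtain ⟨J, hnorm, hint⟩ := exists_integral_mul_width_eq S
  rw [hint (fun z => gaussianWeight (k + 1) 1 ‖z‖) (integrable_gaussianWeight_one_mul_width S)]
  have hslice : ∀ t : ℝ, -t * ∫ w, gaussianWeight (k + 1) 1 ‖t • S.normal + J w‖
      = 1 / √(2 * Real.pi) * (-t * Real.exp (-(1 / 2) * t ^ 2)) := fun t => by
    simp only [gaussianWeight_one_eq, hnorm, mul_add, Real.exp_add]
    rw [integral_const_mul, integral_const_mul,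
      GaussianFourier.integral_rexp_neg_mul_sq_norm (by norm_num), finrank_euclideanSpace_fin,
      show Real.pi / (1 / 2) = 2 * Real.pi by ring, Real.sqrt_eq_rpow]
    have : ((k + 1 : ℕ) : ℝ) / 2 = (k : ℝ) / 2 + 1 / 2 := by push_cast; ring
    rw [this, Real.rpow_add (by positivity)]
    have h1 : (2 * Real.pi) ^ ((k : ℝ) / 2) ≠ 0 := by positivity
    have h2 : (2 * Real.pi) ^ ((1 : ℝ) / 2) ≠ 0 := by positivity
    field_simp
  simp only [hslice]
  rw [integral_const_mul]
  have hd : ∀ t ∈ Iic (0 : ℝ), HasDerivAt (fun t : ℝ => Real.exp (-(1 / 2) * t ^ 2))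
      (-t * Real.exp (-(1 / 2) * t ^ 2)) t := fun t _ => by
    have := ((hasDerivAt_pow 2 t).const_mul (-(1 / 2) : ℝ)).exp
    convert! this using 1
    push_cast
    ring
  have hi : Integrable fun t : ℝ => -t * Real.exp (-(1 / 2) * t ^ 2) := by
    refine (integrable_mul_exp_neg_mul_sq (b := 1 / 2) (by norm_num)).neg.congr
      (ae_of_all _ fun t => ?_)
    simp
  have hlim : Tendsto (fun t : ℝ => Real.exp (-(1 / 2) * t ^ 2)) atBot (𝓝 0) := by
    refine Real.tendsto_exp_atBot.comp ?_
    have h2 : Tendsto (fun t : ℝ => t ^ 2) atBot atTop :=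
      (tendsto_pow_atTop two_ne_zero).comp tendsto_abs_atBot_atTop |>.congr fun t => sq_abs t
    exact h2.const_mul_atTop_of_neg (by norm_num)
  rw [integral_Iic_of_hasDerivAt_of_tendsto' hd hi.integrableOn hlim]
  simp

end Moments

/-! ### The deviation of the quality measure: fluctuation plus bias -/

section Deviation

lemma IsIIDSample.isProbabilityMeasure {d : ℕ} {Ω : Type*} [MeasurableSpace Ω] {P : Measure Ω}
    [IsProbabilityMeasure P] {p : E d → ℝ} {X : ℕ → Ω → E d} (hX : IsIIDSample P p X) :
    IsProbabilityMeasure (densityMeasure p) := by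
  rw [← hX.2.2 0]
  exact Measure.isProbabilityMeasure_map (hX.1 0).aemeasurable

lemma DensityBounds.setIntegral_sq_pos {d : ℕ} {p : E d → ℝ} {C H : Set (E d)} {B G : ℝ}
    (h : DensityBounds p C B G) (hH : MeasurableSet H) (hpos : 0 < densityMeasure p H) :
    0 < ∫ x in H, p x ^ 2 := by
  have hi : Integrable fun x => p x ^ 2 := by
    have := h.integrable_corr_integrand MeasurableSet.univ MeasurableSet.univ 0
    simpa [sq] using this
  rw [densityMeasure, withDensity_apply _ hH, setLIntegral_pos_iff h.measurable.ennreal_ofReal]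
    at hpos
  rw [setIntegral_pos_iff_support_of_nonneg_ae (ae_of_all _ fun x => sq_nonneg (p x))
    hi.integrableOn]
  refine hpos.trans_le (measure_mono (inter_subset_inter_left _ fun x hx => ?_))
  have : 0 < p x := by simpa using hx
  simpa using this.ne'

lemma tendsto_sqrt_fluctuation {ρ : ℕ → ℝ}
    (hlim : Tendsto (fun n : ℕ => n * ρ n / Real.log n) atTop atTop) :
    Tendsto (fun n : ℕ => √(Real.log n / (n * ρ n))) atTop (𝓝 0) := by
  have h1 := tendsto_inv_atTop_zero.comp hlim
  have h2 := (Real.continuous_sqrt.tendsto 0).comp h1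
  simpa [Function.comp_def, inv_div] using h2

/-- If the normalized means of the cut and of the volumes are within `δ n` of their limits, then
almost surely the normalized quality measure is eventually within
`O(δ n + √(log n / (n ρ n)))` of its limit. -/
theorem ae_eventually_quality_sub_le {d : ℕ} {Ω : Type*} [MeasurableSpace Ω] {P : Measure Ω}
    [IsProbabilityMeasure P] {p : E d → ℝ} {X : ℕ → Ω → E d} (hX : IsIIDSample P p X)
    (S : Hyperplane d) (q : Quality) {f : ℕ → ℝ → ℝ} {r sc sv ρ M δ : ℕ → ℝ}
    {c v₁ v₂ K L ε₀ : ℝ} (hε₀ : 0 < ε₀)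
    (hLip : ∀ ε : ℝ, ε ≤ ε₀ → ∀ c' u₁ u₂ : ℝ, |c' - c| ≤ ε → |u₁ - v₁| ≤ ε →
      |u₂ - v₂| ≤ ε → |q.value c' u₁ u₂ - q.value c v₁ v₂| ≤ L * ε)
    (hf : ∀ n, Measurable (f n)) (hf0 : ∀ n u, 0 ≤ f n u)
    (hfM : ∀ᶠ n in atTop, ∀ u, f n u ≤ M n) (hM0 : ∀ᶠ n in atTop, 0 < M n)
    (hsc : ∀ᶠ n in atTop, 0 < sc n) (hsv : ∀ᶠ n in atTop, 0 < sv n)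
    (hρ : ∀ᶠ n in atTop, 0 < ρ n) (hρ1 : ∀ᶠ n in atTop, ρ n ≤ 1)
    (hMc : ∀ᶠ n in atTop, M n * ρ n ≤ K * sc n) (hMv : ∀ᶠ n in atTop, M n * ρ n ≤ K * sv n)
    (hK : 0 < K) (hcK : c + 1 ≤ K) (hv₁K : v₁ + 1 ≤ K) (hv₂K : v₂ + 1 ≤ K)
    (hlim : Tendsto (fun n : ℕ => n * ρ n / Real.log n) atTop atTop)
    (hδ : Tendsto δ atTop (𝓝 0))
    (hbc : ∀ᶠ n in atTop, |2 * edgeMean p (f n) (r n) S.pos S.neg / sc n - c| ≤ δ n)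
    (hb₁ : ∀ᶠ n in atTop, |edgeMean p (f n) (r n) S.pos univ / sv n - v₁| ≤ δ n)
    (hb₂ : ∀ᶠ n in atTop, |edgeMean p (f n) (r n) S.neg univ / sv n - v₂| ≤ δ n) :
    ∀ᵐ ω ∂P, ∀ᶠ n : ℕ in atTop,
      |((n : ℝ) ^ 2 * sv n) / ((n : ℝ) ^ 2 * sc n) *
          q.ofGraph (rGraphWeight (f n) (r n) fun i : Fin n => X i ω)
            (pointsIn (fun i : Fin n => X i ω) S.pos) (pointsIn (fun i : Fin n => X i ω) S.neg)
          - q.value c v₁ v₂|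
        ≤ L * (δ n + 18 * K * √(Real.log n / (n * ρ n))) := by
  have := hX.isProbabilityMeasure
  obtain ⟨hXm, hXi, hXd⟩ := hX
  have hδ1 : ∀ᶠ n in atTop, δ n ≤ 1 := hδ.eventually_le_const one_pos
  have hker : ∀ (A A' : Set (E d)), MeasurableSet A → MeasurableSet A' → ∀ s : ℕ → ℝ,
      (∀ᶠ n in atTop, 0 < s n) → (∀ᶠ n in atTop, M n * ρ n ≤ K * s n) →
      (∀ᶠ n in atTop, edgeMean p (f n) (r n) A A' ≤ K * s n) →
      ∀ᵐ ω ∂P, ∀ᶠ n : ℕ in atTop,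
        |pairSum n (edgeKernel (f n) (r n) A A') (fun i => X i ω) / (n ^ 2 * s n)
          - edgeMean p (f n) (r n) A A' / s n| ≤ 9 * K * √(Real.log n / (n * ρ n)) := by
    intro A A' hA hA' s hs hMs hmean
    exact pairSum_concentration hXm hXi hXd hK
      (fun n => measurable_edgeKernel (hf n) hA hA') (fun n x y => edgeKernel_nonneg (hf0 n) x y)
      hs hρ hρ1 hM0 (by
        filter_upwards [hfM, hM0] with n h1 h2 x y
        exact edgeKernel_le (hf0 n) h2.le h1 x y) hmean hMs hlim
  have hmean₁ : ∀ᶠ n in atTop, edgeMean p (f n) (r n) S.pos univ ≤ K * sv n := by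
    filter_upwards [hb₁, hδ1, hsv] with n h1 h2 h3
    rw [← div_le_iff₀ h3]
    linarith only [h2, hv₁K, (abs_le.1 h1).2]
  have hmean₂ : ∀ᶠ n in atTop, edgeMean p (f n) (r n) S.neg univ ≤ K * sv n := by
    filter_upwards [hb₂, hδ1, hsv] with n h1 h2 h3
    rw [← div_le_iff₀ h3]
    linarith only [h2, hv₂K, (abs_le.1 h1).2]
  have hmeanc : ∀ᶠ n in atTop, edgeMean p (f n) (r n) S.pos S.neg ≤ K * sc n := by
    filter_upwards [hbc, hδ1, hsc] with n h1 h2 h3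
    have h4 : 2 * edgeMean p (f n) (r n) S.pos S.neg ≤ K * sc n := by
      rw [← div_le_iff₀ h3]
      linarith only [h2, hcK, (abs_le.1 h1).2]
    have h5 : 0 < K * sc n := by positivity
    linarith only [h4, h5]
  -- `18 = 2 * 9`, since the cut counts every ordered pair twice
  have hε : ∀ᶠ n : ℕ in atTop, δ n + 18 * K * √(Real.log n / (n * ρ n)) ≤ ε₀ := by
    have := hδ.add ((tendsto_sqrt_fluctuation hlim).const_mul (18 * K))
    simp only [mul_zero, add_zero] at this
    exact this.eventually_le_const hε₀
  filter_upwards [hker _ _ S.measurableSet_pos S.measurableSet_neg sc hsc hMc hmeanc,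
    hker _ _ S.measurableSet_pos MeasurableSet.univ sv hsv hMv hmean₁,
    hker _ _ S.measurableSet_neg MeasurableSet.univ sv hsv hMv hmean₂] with ω hωc hω₁ hω₂
  filter_upwards [hωc, hω₁, hω₂, hbc, hb₁, hb₂, hsv, hε, eventually_gt_atTop 0]
    with n h1 h2 h3 h4 h5 h6 h7 h8 h9
  have hn : (0 : ℝ) < n := by exact_mod_cast h9
  have hq : 0 ≤ K * √(Real.log n / (n * ρ n)) := by positivity
  rw [Quality.ofGraph, Quality.value_scale q (by positivity), cut_eq_pairSum (f n) (r n)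
    (fun i => X i ω), vol_eq_pairSum (f n) (r n) (fun i => X i ω), vol_eq_pairSum (f n) (r n)
    (fun i => X i ω)]
  generalize √(Real.log n / (n * ρ n)) = s at h1 h2 h3 h8 hq ⊢
  refine hLip _ h8 _ _ _ ?_ ?_ ?_
  · rw [mul_div_assoc]
    rw [mul_div_assoc] at h4
    refine (abs_sub_le _ _ _).trans ((add_le_add ?_ h4).trans_eq (add_comm _ _))
    rw [← mul_sub, abs_mul, abs_two]
    linarith only [h1]
  · exact ((abs_sub_le _ _ _).trans (add_le_add h2 h5)).trans (by linarith only [hq])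
  · exact ((abs_sub_le _ _ _).trans (add_le_add h3 h6)).trans (by linarith only [hq])

end Deviation

/-! ### Convergence of the normalized means -/

section MeanConvergence

variable {k : ℕ} {p : E (k + 1) → ℝ} {C : Set (E (k + 1))} {S : Hyperplane (k + 1)}

lemma tendsto_edgeMean_cut (hpCS : GeneralAssumptions p C S)
    [IsProbabilityMeasure (densityMeasure p)] {f : ℕ → ℝ → ℝ} {r sc M : ℕ → ℝ} {Fc : ℝ}
    (hf : ∀ n, Measurable (f n)) (hf0 : ∀ n u, 0 ≤ f n u) (hM : ∀ n, 0 ≤ M n)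
    (hfM : ∀ n u, f n u ≤ M n) (hr : ∀ n, 0 < r n) (hr0 : Tendsto r atTop (𝓝 0))
    (hsc : ∀ n, 0 < sc n)
    (hw : Tendsto (fun n => 2 * kernelWidth (f n) (r n) S / sc n) atTop (𝓝 Fc)) :
    Tendsto (fun n => 2 * edgeMean p (f n) (r n) S.pos S.neg / sc n) atTop
      (𝓝 (Fc * ∫ s in S.carrier, p s ^ 2 ∂(Measure.euclideanHausdorffMeasure (k + 1 - 1)))) := by
  obtain ⟨B, G, h⟩ := hpCS.exists_densityBounds
  obtain ⟨K, ρ₀, hK, hρ₀, hb⟩ := hpCS.exists_abs_corr_cut_sub_le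
  set I := ∫ s in S.carrier, p s ^ 2 ∂(Measure.euclideanHausdorffMeasure (k + 1 - 1))
  have hdiff : Tendsto (fun n => 2 * edgeMean p (f n) (r n) S.pos S.neg / sc n
      - 2 * kernelWidth (f n) (r n) S / sc n * I) atTop (𝓝 0) := by
    have hz : Tendsto (fun n => 2 * kernelWidth (f n) (r n) S / sc n * (K * r n)) atTop (𝓝 0) := by
      have := hw.mul (hr0.const_mul K)
      simpa using this
    refine squeeze_zero_norm' ?_ hz
    filter_upwards [hr0.eventually_le_const hρ₀] with n hn
    have h1 := h.abs_edgeMean_cut_sub_le (hf n) (hf0 n) (hM n) (hfM n) (S := S) (a := I)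
      (e := K * r n) (fun z hz => hb (r n) (hr n) hn z hz)
    have h2 : 2 * edgeMean p (f n) (r n) S.pos S.neg / sc n
        - 2 * kernelWidth (f n) (r n) S / sc n * I
        = 2 / sc n * (edgeMean p (f n) (r n) S.pos S.neg - kernelWidth (f n) (r n) S * I) := by
      ring
    have h3 : 0 < 2 / sc n := div_pos two_pos (hsc n)
    rw [h2, norm_mul, Real.norm_eq_abs, Real.norm_eq_abs, abs_of_pos h3]
    calc 2 / sc n * |edgeMean p (f n) (r n) S.pos S.neg - kernelWidth (f n) (r n) S * I|
        ≤ 2 / sc n * (kernelWidth (f n) (r n) S * (K * r n)) := by gcongr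
      _ = _ := by ring
  have := hdiff.add (hw.mul_const I)
  simpa using this

lemma tendsto_edgeMean_vol (hpCS : GeneralAssumptions p C S)
    [IsProbabilityMeasure (densityMeasure p)] {f : ℕ → ℝ → ℝ} {r sv M : ℕ → ℝ} {Fv : ℝ}
    (hf : ∀ n, Measurable (f n)) (hf0 : ∀ n u, 0 ≤ f n u) (hM : ∀ n, 0 ≤ M n)
    (hfM : ∀ n u, f n u ≤ M n) (hr0 : Tendsto r atTop (𝓝 0))
    (hsv : ∀ n, 0 < sv n)
    (hw : Tendsto (fun n => kernelMass (k + 1) (f n) (r n) / sv n) atTop (𝓝 Fv))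
    {H : Set (E (k + 1))} (hH : MeasurableSet H) :
    Tendsto (fun n => edgeMean p (f n) (r n) H univ / sv n) atTop
      (𝓝 (Fv * ∫ x in H, p x ^ 2)) := by
  obtain ⟨B, G, h⟩ := hpCS.exists_densityBounds
  set A := ∫ x in H, p x ^ 2
  have hdiff : Tendsto (fun n => edgeMean p (f n) (r n) H univ / sv n
      - kernelMass (k + 1) (f n) (r n) / sv n * A) atTop (𝓝 0) := by
    have hFv : 0 ≤ Fv := ge_of_tendsto' hw fun n =>
      div_nonneg (kernelMass_nonneg (hf0 n)) (hsv n).le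
    rw [Metric.tendsto_nhds]
    intro ε hε
    obtain ⟨ρ₀, hρ₀, hb⟩ := h.exists_abs_corr_sub_le hH (show 0 < ε / (2 * (Fv + 1)) by positivity)
    filter_upwards [hr0.eventually_le_const hρ₀, hw.eventually_le_const (lt_add_one Fv)]
      with n hn hn2
    have h1 := h.abs_edgeMean_univ_sub_le (hf n) (hf0 n) (hM n) (hfM n) hH (r := r n)
      (fun z hz => hb z (hz.trans hn))
    have h2 : edgeMean p (f n) (r n) H univ / sv n - kernelMass (k + 1) (f n) (r n) / sv n * A
        = (edgeMean p (f n) (r n) H univ - kernelMass (k + 1) (f n) (r n) * A) / sv n := by ring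
    rw [dist_zero_right, h2, norm_div, Real.norm_eq_abs, Real.norm_eq_abs, abs_of_pos (hsv n)]
    calc |edgeMean p (f n) (r n) H univ - kernelMass (k + 1) (f n) (r n) * A| / sv n
        ≤ kernelMass (k + 1) (f n) (r n) * (ε / (2 * (Fv + 1))) / sv n := by
          have := (hsv n).le
          gcongr
      _ = kernelMass (k + 1) (f n) (r n) / sv n * (ε / (2 * (Fv + 1))) := by ring
      _ ≤ (Fv + 1) * (ε / (2 * (Fv + 1))) := by gcongr
      _ = ε / 2 := by field_simp
      _ < ε := half_lt_self hε
  have := hdiff.add (hw.mul_const A)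
  simpa using this

/-- Convergence of the quality measure when the normalized moments of the weights converge. -/
theorem ae_tendsto_deviation {Ω : Type*} [MeasurableSpace Ω] {P : Measure Ω}
    [IsProbabilityMeasure P] (hpCS : GeneralAssumptions p C S) {X : ℕ → Ω → E (k + 1)}
    (hX : IsIIDSample P p X) (q : Quality) {W : ℕ → Weighting} {r sc sv ρ M : ℕ → ℝ} {Fc Fv : ℝ}
    (hFv0 : 0 < Fv) (hf : ∀ n, Measurable ((W n).weight (k + 1)))
    (hf0 : ∀ n u, 0 ≤ (W n).weight (k + 1) u) (hM : ∀ n, 0 < M n)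
    (hfM : ∀ n u, (W n).weight (k + 1) u ≤ M n) (hr : ∀ n, 0 < r n)
    (hr0 : Tendsto r atTop (𝓝 0)) (hsc : ∀ n, 0 < sc n) (hsv : ∀ n, 0 < sv n)
    (hscale : ∀ n, (W n).cutScale (k + 1) n (r n) = (n : ℝ) ^ 2 * sc n ∧
      (W n).volScale (k + 1) n (r n) = (n : ℝ) ^ 2 * sv n)
    (hFc : ∀ n, (W n).cutFactor (k + 1) = Fc) (hFv : ∀ n, (W n).volFactor (k + 1) = Fv)
    (hwc : Tendsto (fun n => 2 * kernelWidth ((W n).weight (k + 1)) (r n) S / sc n) atTop (𝓝 Fc))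
    (hwv : Tendsto (fun n => kernelMass (k + 1) ((W n).weight (k + 1)) (r n) / sv n) atTop
      (𝓝 Fv))
    (hρ : ∀ n, 0 < ρ n) (hρ1 : ∀ᶠ n in atTop, ρ n ≤ 1)
    (hMc : ∀ᶠ n in atTop, M n * ρ n ≤ sc n) (hMv : ∀ᶠ n in atTop, M n * ρ n ≤ sv n)
    (hlim : Tendsto (fun n : ℕ => n * ρ n / Real.log n) atTop atTop) :
    ∀ᵐ ω ∂P, Tendsto (fun n => deviation q (W n) p S n (r n) fun i => X i ω) atTop (𝓝 0) := by
  have := hX.isProbabilityMeasure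
  obtain ⟨B, G, h⟩ := hpCS.exists_densityBounds
  have h₁ := mul_pos hFv0 (h.setIntegral_sq_pos S.measurableSet_pos hpCS.mass_pos)
  have h₂ := mul_pos hFv0 (h.setIntegral_sq_pos S.measurableSet_neg hpCS.mass_neg)
  set v₁ := Fv * ∫ x in S.pos, p x ^ 2 with hv₁
  set v₂ := Fv * ∫ x in S.neg, p x ^ 2 with hv₂
  set c := Fc * ∫ s in S.carrier, p s ^ 2 ∂(Measure.euclideanHausdorffMeasure (k + 1 - 1)) with hc
  have hlimit : ∀ n, q.limit (W n) p S = q.value c v₁ v₂ := fun n => by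
    rw [Quality.limit, cutLim, volLim, volLim, hFc, hFv]
  have tc := tendsto_edgeMean_cut hpCS hf hf0 (fun n => (hM n).le) hfM hr hr0 hsc hwc
  have t₁ := tendsto_edgeMean_vol hpCS hf hf0 (fun n => (hM n).le) hfM hr0 hsv hwv
    S.measurableSet_pos
  have t₂ := tendsto_edgeMean_vol hpCS hf hf0 (fun n => (hM n).le) hfM hr0 hsv hwv
    S.measurableSet_neg
  rw [← tendsto_sub_nhds_zero_iff] at tc t₁ t₂
  obtain ⟨L, ε₀, hL, hε₀, hLip⟩ := q.exists_lipschitz c h₁ h₂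
  set a₁ := fun n => |2 * edgeMean p ((W n).weight (k + 1)) (r n) S.pos S.neg / sc n - c|
  set a₂ := fun n => |edgeMean p ((W n).weight (k + 1)) (r n) S.pos univ / sv n - v₁|
  set a₃ := fun n => |edgeMean p ((W n).weight (k + 1)) (r n) S.neg univ / sv n - v₂|
  have hδ : Tendsto (fun n => a₁ n + a₂ n + a₃ n) atTop (𝓝 0) := by
    have := (tc.abs.add t₁.abs).add t₂.abs
    simpa only [abs_zero, add_zero] using this
  have ha₁ : ∀ n, 0 ≤ a₁ n := fun n => abs_nonneg _
  have ha₂ : ∀ n, 0 ≤ a₂ n := fun n => abs_nonneg _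
  have ha₃ : ∀ n, 0 ≤ a₃ n := fun n => abs_nonneg _
  set K := max (max (c + 1) (v₁ + 1)) (v₂ + 1) with hK
  have hK1 : 1 ≤ K := le_trans (by linarith only [h₂]) (le_max_right _ _)
  have hmain := ae_eventually_quality_sub_le hX S q (K := K) hε₀ hLip hf hf0
    (Eventually.of_forall hfM) (Eventually.of_forall hM) (Eventually.of_forall hsc)
    (Eventually.of_forall hsv) (Eventually.of_forall hρ) hρ1
    (hMc.mono fun n hn => hn.trans (le_mul_of_one_le_left (hsc n).le hK1))
    (hMv.mono fun n hn => hn.trans (le_mul_of_one_le_left (hsv n).le hK1)) (by linarith only [hK1])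
    ((le_max_left _ _).trans (le_max_left _ _)) ((le_max_right _ _).trans (le_max_left _ _))
    (le_max_right _ _) hlim hδ
    (Eventually.of_forall fun n =>
      (le_add_of_nonneg_right (ha₂ n)).trans (le_add_of_nonneg_right (ha₃ n)))
    (Eventually.of_forall fun n =>
      (le_add_of_nonneg_left (ha₁ n)).trans (le_add_of_nonneg_right (ha₃ n)))
    (Eventually.of_forall fun n =>
      le_add_of_nonneg_left (add_nonneg (ha₁ n) (ha₂ n)))
  filter_upwards [hmain] with ω hω
  have hz : Tendsto (fun n : ℕ => L * (a₁ n + a₂ n + a₃ n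
      + 18 * K * √(Real.log n / (n * ρ n)))) atTop (𝓝 0) := by
    have := (hδ.add ((tendsto_sqrt_fluctuation hlim).const_mul (18 * K))).const_mul L
    simpa using this
  refine squeeze_zero' (Eventually.of_forall fun n => abs_nonneg _) (hω.mono fun n hn => ?_) hz
  simp only [deviation, hlimit, (hscale n).1, (hscale n).2]
  exact hn

end MeanConvergence

/-! ### Unit weights: the rate of convergence -/

section Rate

variable {k : ℕ} {p : E (k + 1) → ℝ} {C : Set (E (k + 1))} {S : Hyperplane (k + 1)}

lemma kernelWidth_one_div {r : ℝ} (hr : 0 < r) (S : Hyperplane (k + 1)) :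
    2 * kernelWidth (fun _ => 1) r S / r ^ (k + 2) = Weighting.unweighted.cutFactor (k + 1) := by
  have : r ^ (k + 2) ≠ 0 := by positivity
  rw [kernelWidth_one hr.le, Weighting.cutFactor, Nat.add_sub_cancel]
  push_cast
  field_simp
  ring

lemma kernelMass_one_div (d : ℕ) {r : ℝ} (hr : 0 < r) :
    kernelMass d (fun _ => 1) r / r ^ d = Weighting.unweighted.volFactor d := by
  rw [kernelMass_one d hr.le, Weighting.volFactor, mul_div_cancel_left₀ _ (by positivity)]

/-- With unit weights the bias is `O(r)`, so that the deviation is eventually at most a bias term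
proportional to `r` plus a fluctuation term, with constants that do not depend on the radii.
The radii need only be positive eventually, as `rate d n` vanishes for `n ≤ 1`. -/
theorem exists_ae_eventually_deviation_le_errorBound {Ω : Type*} [MeasurableSpace Ω]
    {P : Measure Ω} [IsProbabilityMeasure P] (hpCS : GeneralAssumptions p C S)
    (hfin : k + 1 = 1 → (frontier C).Finite) {X : ℕ → Ω → E (k + 1)}
    (hX : IsIIDSample P p X) (q : Quality) :
    ∃ a b : ℝ, 0 < a ∧ 0 < b ∧ ∀ r : ℕ → ℝ, (∀ᶠ n in atTop, 0 < r n) → Tendsto r atTop (𝓝 0) →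
      Tendsto (fun n : ℕ => n * r n ^ (k + 1 + 1) / Real.log n) atTop atTop →
      ∀ᵐ ω ∂P, ∀ᶠ n : ℕ in atTop,
        deviation q .unweighted p S n (r n) (fun i => X i ω) ≤ errorBound (k + 1) a b n (r n) := by
  have := hX.isProbabilityMeasure
  obtain ⟨B, G, h⟩ := hpCS.exists_densityBounds
  obtain ⟨Kc, ρc, hKc, hρc, hbc⟩ := hpCS.exists_abs_corr_cut_sub_le
  obtain ⟨Kl, ρl, hKl, hρl, hlayer⟩ := exists_layer_le hpCS hfin
  obtain ⟨K₁, hK₁, hb₁⟩ := h.exists_abs_corr_sub_le_mul S.measurableSet_pos hKl hlayer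
  obtain ⟨K₂, hK₂, hb₂⟩ := h.exists_abs_corr_sub_le_mul S.measurableSet_neg hKl hlayer
  set Fc := Weighting.unweighted.cutFactor (k + 1) with hFc
  set Fv := Weighting.unweighted.volFactor (k + 1) with hFv
  have hFv0 : 0 < Fv := ballVolume_pos _
  have hFc0 : 0 ≤ Fc := by
    rw [hFc, ← kernelWidth_one_div one_pos S]
    have := kernelWidth_nonneg (r := 1) (f := fun _ => 1) (fun _ => zero_le_one) S
    positivity
  have h₁ := mul_pos hFv0 (h.setIntegral_sq_pos S.measurableSet_pos hpCS.mass_pos)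
  have h₂ := mul_pos hFv0 (h.setIntegral_sq_pos S.measurableSet_neg hpCS.mass_neg)
  set A₁ := ∫ x in S.pos, p x ^ 2
  set A₂ := ∫ x in S.neg, p x ^ 2
  set I := ∫ s in S.carrier, p s ^ 2 ∂(Measure.euclideanHausdorffMeasure (k + 1 - 1)) with hI
  obtain ⟨L, ε₀, hL, hε₀, hLip⟩ := q.exists_lipschitz (Fc * I) h₁ h₂
  set D := Fc * Kc + Fv * K₁ + Fv * K₂ with hD
  have hD1 : 0 ≤ Fc * Kc := by positivity
  have hD2 : 0 ≤ Fv * K₁ := by positivity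
  have hD3 : 0 ≤ Fv * K₂ := by positivity
  set K := max (max (Fc * I + 1) (Fv * A₁ + 1)) (Fv * A₂ + 1) with hK
  have hK1 : 1 ≤ K := le_trans (by linarith) (le_max_right _ _)
  have hK0 : 0 < K := by linarith
  refine ⟨L * (D + 1), L * (18 * K), by positivity, by positivity, fun r hr hr0 hlim => ?_⟩
  have hr1 : ∀ᶠ n in atTop, r n ≤ 1 := hr0.eventually_le_const one_pos
  have hmain := ae_eventually_quality_sub_le hX S q (K := K) (f := fun _ _ => 1) (r := r)
    (sc := fun n => r n ^ (k + 2)) (sv := fun n => r n ^ (k + 1)) (ρ := fun n => r n ^ (k + 2))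
    (M := fun _ => 1) (δ := fun n => D * r n) hε₀ hLip (fun _ => measurable_const)
    (fun _ _ => zero_le_one) (Eventually.of_forall fun _ _ => le_rfl)
    (Eventually.of_forall fun _ => one_pos) (hr.mono fun n hn => by positivity)
    (hr.mono fun n hn => by positivity) (hr.mono fun n hn => by positivity)
    (by filter_upwards [hr, hr1] with n h1 h2 using pow_le_one₀ h1.le h2)
    (by
      filter_upwards [hr] with n h1
      have : 0 ≤ r n ^ (k + 2) := by positivity
      nlinarith)
    (by
      filter_upwards [hr, hr1] with n h1 h2
      have h3 : 0 ≤ r n ^ (k + 1) := by positivity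
      have h4 : r n ^ (k + 2) ≤ r n ^ (k + 1) := pow_le_pow_of_le_one h1.le h2 (by omega)
      nlinarith)
    hK0 ((le_max_left _ _).trans (le_max_left _ _)) ((le_max_right _ _).trans (le_max_left _ _))
    (le_max_right _ _) hlim (by simpa using hr0.const_mul D)
    (by
      filter_upwards [hr, hr0.eventually_le_const hρc] with n h1 h2
      have h3 := h.abs_edgeMean_cut_sub_le (f := fun _ => 1) (M := 1) measurable_const
        (fun _ => zero_le_one) zero_le_one (fun _ => le_rfl) (S := S) (a := I) (e := Kc * r n)
        (hbc (r n) h1 h2)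
      have h4 : 2 * edgeMean p (fun _ => 1) (r n) S.pos S.neg / r n ^ (k + 2) - Fc * I
          = 2 / r n ^ (k + 2) * (edgeMean p (fun _ => 1) (r n) S.pos S.neg
            - kernelWidth (fun _ => 1) (r n) S * I) := by
        rw [hFc, ← kernelWidth_one_div h1 S]
        ring
      have h5 : 0 < 2 / r n ^ (k + 2) := by positivity
      rw [h4, abs_mul, abs_of_pos h5]
      calc _ ≤ 2 / r n ^ (k + 2) * (kernelWidth (fun _ => 1) (r n) S * (Kc * r n)) := by gcongr
        _ = Fc * Kc * r n := by rw [hFc, ← kernelWidth_one_div h1 S]; ring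
        _ ≤ D * r n := by gcongr; linarith)
    (by
      filter_upwards [hr, hr0.eventually_le_const hρl] with n h1 h2
      have h3 := h.abs_edgeMean_univ_sub_le (f := fun _ => 1) (M := 1) measurable_const
        (fun _ => zero_le_one) zero_le_one (fun _ => le_rfl) S.measurableSet_pos
        (hb₁ (r n) h1 h2)
      have h4 : edgeMean p (fun _ => 1) (r n) S.pos univ / r n ^ (k + 1) - Fv * A₁
          = (edgeMean p (fun _ => 1) (r n) S.pos univ
            - kernelMass (k + 1) (fun _ => 1) (r n) * A₁) / r n ^ (k + 1) := by
        rw [hFv, ← kernelMass_one_div (k + 1) h1]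
        ring
      have h5 : 0 < r n ^ (k + 1) := by positivity
      rw [h4, abs_div, abs_of_pos h5]
      calc _ ≤ kernelMass (k + 1) (fun _ => 1) (r n) * (K₁ * r n) / r n ^ (k + 1) := by gcongr
        _ = Fv * K₁ * r n := by rw [hFv, ← kernelMass_one_div (k + 1) h1]; ring
        _ ≤ D * r n := by gcongr; linarith)
    (by
      filter_upwards [hr, hr0.eventually_le_const hρl] with n h1 h2
      have h3 := h.abs_edgeMean_univ_sub_le (f := fun _ => 1) (M := 1) measurable_const
        (fun _ => zero_le_one) zero_le_one (fun _ => le_rfl) S.measurableSet_neg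
        (hb₂ (r n) h1 h2)
      have h4 : edgeMean p (fun _ => 1) (r n) S.neg univ / r n ^ (k + 1) - Fv * A₂
          = (edgeMean p (fun _ => 1) (r n) S.neg univ
            - kernelMass (k + 1) (fun _ => 1) (r n) * A₂) / r n ^ (k + 1) := by
        rw [hFv, ← kernelMass_one_div (k + 1) h1]
        ring
      have h5 : 0 < r n ^ (k + 1) := by positivity
      rw [h4, abs_div, abs_of_pos h5]
      calc _ ≤ kernelMass (k + 1) (fun _ => 1) (r n) * (K₂ * r n) / r n ^ (k + 1) := by gcongr
        _ = Fv * K₂ * r n := by rw [hFv, ← kernelMass_one_div (k + 1) h1]; ring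
        _ ≤ D * r n := by gcongr; linarith)
  filter_upwards [hmain] with ω hω
  filter_upwards [hω, hr] with n hn hrn
  refine le_trans hn ?_
  rw [errorBound]
  have : 0 ≤ L * r n := by positivity
  have e : L * (D * r n + 18 * K * √(Real.log n / (n * r n ^ (k + 2))))
      = L * (D + 1) * r n + L * (18 * K) * √(Real.log n / (n * r n ^ (k + 1 + 1))) - L * r n := by
    ring
  rw [e]
  linarith

end Rate

/-! ### The optimal radius -/

section OptimalRadius

variable {d : ℕ}

lemma rate_pos {n : ℕ} (hn : 2 ≤ n) : 0 < rate d n := by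
  have h1 : (1 : ℝ) < n := by exact_mod_cast hn
  have h2 := Real.log_pos h1
  unfold rate
  positivity

lemma rate_pow {n : ℕ} (hn : 2 ≤ n) : rate d n ^ (d + 3) = Real.log n / n := by
  have h1 : (1 : ℝ) < n := by exact_mod_cast hn
  have h2 := Real.log_pos h1
  have h3 : 0 ≤ Real.log n / n := by positivity
  rw [rate, one_div, show (d : ℝ) + 3 = ((d + 3 : ℕ) : ℝ) by push_cast; ring,
    Real.rpow_inv_natCast_pow h3 (by omega)]

/-- At a multiple of the rate, both terms of the error bound are proportional to the rate. -/
lemma errorBound_mul_rate (a b : ℝ) {n : ℕ} (hn : 2 ≤ n) {u : ℝ} (hu : 0 < u) :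
    errorBound d a b n (u * rate d n) = rate d n * (a * u + b / √(u ^ (d + 1))) := by
  have hR := rate_pos (d := d) hn
  have hn0 : (0 : ℝ) < n := by positivity
  have h1 : Real.log n / (n * (u * rate d n) ^ (d + 1)) = rate d n ^ 2 / u ^ (d + 1) := by
    rw [← div_div, ← rate_pow hn (d := d), mul_pow]
    field_simp
    ring
  rw [errorBound, h1, Real.sqrt_div (by positivity), Real.sqrt_sq hR.le]
  ring

lemma tendsto_rate : Tendsto (rate d) atTop (𝓝 0) := by
  have h1 : Tendsto (fun n : ℕ => Real.log n / n) atTop (𝓝 0) := by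
    have := (Real.isLittleO_log_id_atTop.tendsto_div_nhds_zero).comp tendsto_natCast_atTop_atTop
    simpa [Function.comp_def] using this
  have h2 : (0 : ℝ) < 1 / ((d : ℝ) + 3) := by positivity
  have h3 := h1.rpow_const (p := 1 / ((d : ℝ) + 3)) (Or.inr h2.le)
  rw [Real.zero_rpow h2.ne'] at h3
  exact h3

lemma tendsto_mul_rate_pow_div_log {u : ℝ} (hu : 0 < u) :
    Tendsto (fun n : ℕ => n * (u * rate d n) ^ (d + 1) / Real.log n) atTop atTop := by
  have h1 : Tendsto (fun n => rate d n ^ 2) atTop (𝓝[>] 0) := by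
    refine tendsto_nhdsWithin_iff.2 ⟨by simpa using (tendsto_rate (d := d)).pow 2, ?_⟩
    filter_upwards [eventually_ge_atTop 2] with n hn
    exact pow_pos (rate_pos hn) 2
  refine ((tendsto_inv_nhdsGT_zero.comp h1).const_mul_atTop (pow_pos hu (d + 1))).congr' ?_
  filter_upwards [eventually_ge_atTop 2] with n hn
  have hR := rate_pos (d := d) hn
  have hn0 : (0 : ℝ) < n := by positivity
  have h2 : Real.log n = rate d n ^ (d + 3) * n := by
    rw [rate_pow hn]
    field_simp
  simp only [Function.comp_apply]
  rw [h2, mul_pow]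
  field_simp
  ring

/-- The tangent to `x ↦ x ^ (-m / 2)` at `1` lies below its graph. -/
lemma one_sub_le_inv_sqrt_pow {x : ℝ} (hx : 0 < x) (m : ℕ) :
    1 - m / 2 * (x - 1) ≤ 1 / √(x ^ m) := by
  have h1 : √(x ^ m) = Real.exp (m / 2 * Real.log x) := by
    rw [Real.sqrt_eq_iff_mul_self_eq (by positivity) (Real.exp_pos _).le, ← Real.exp_add,
      ← add_mul, add_halves, ← Real.log_pow, Real.exp_log (by positivity)]
  rw [h1, one_div, ← Real.exp_neg]
  have h2 := Real.add_one_le_exp (-(m / 2 * Real.log x))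
  have h3 : (m : ℝ) / 2 * Real.log x ≤ m / 2 * (x - 1) := by
    gcongr
    exact Real.log_le_sub_one_of_pos hx
  linarith

/-- The multiple of the rate that balances the two terms of the error bound minimizes it. -/
lemma exists_isMinOn_errorBound {a b : ℝ} (ha : 0 < a) (hb : 0 < b) :
    ∃ r₀ : ℝ, 0 < r₀ ∧ ∀ n : ℕ, 2 ≤ n →
      IsMinOn (errorBound d a b n) (Ioi 0) (r₀ * rate d n) := by
  -- the critical point of `u ↦ a u + b u ^ (-(d + 1) / 2)`
  set T : ℝ := b * (d + 1) / (2 * a) with hT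
  have hT0 : 0 < T := by positivity
  set r₀ : ℝ := (T ^ 2) ^ (((d + 3 : ℕ) : ℝ)⁻¹) with hr₀
  have hr0 : 0 < r₀ := by positivity
  have hpow : r₀ ^ (d + 3) = T ^ 2 := Real.rpow_inv_natCast_pow (by positivity) (by omega)
  have hcrit : r₀ * √(r₀ ^ (d + 1)) = T := by
    have e : r₀ ^ (d + 3) = r₀ ^ 2 * r₀ ^ (d + 1) := by ring
    rw [← Real.sqrt_sq hT0.le, ← hpow, e, Real.sqrt_mul (by positivity), Real.sqrt_sq hr0.le]
  have hs0 : 0 < √(r₀ ^ (d + 1)) := Real.sqrt_pos.2 (by positivity)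
  refine ⟨r₀, hr0, fun n hn r hr => ?_⟩
  have hR := rate_pos (d := d) hn
  obtain ⟨u, hu⟩ : ∃ u, r = u * rate d n := ⟨_, (div_mul_cancel₀ r hR.ne').symm⟩
  have hu0 : 0 < u := pos_of_mul_pos_left (hu ▸ hr) hR.le
  change errorBound d a b n (r₀ * rate d n) ≤ errorBound d a b n r
  rw [hu, errorBound_mul_rate a b hn hr0, errorBound_mul_rate a b hn hu0]
  refine mul_le_mul_of_nonneg_left ?_ hR.le
  have h1 := one_sub_le_inv_sqrt_pow (div_pos hu0 hr0) (d + 1)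
  have h2 : b / √(u ^ (d + 1)) = b / √(r₀ ^ (d + 1)) * (1 / √((u / r₀) ^ (d + 1))) := by
    rw [div_pow, Real.sqrt_div (pow_pos hu0 _).le]
    field_simp
  have h3 : b / √(r₀ ^ (d + 1)) * ((d + 1) / 2) = a * r₀ := by
    rw [div_mul_eq_mul_div, div_eq_iff hs0.ne', mul_assoc, hcrit, hT]
    field_simp
  have h4 : 0 < b / √(r₀ ^ (d + 1)) := by positivity
  rw [h2]
  have h5 := mul_le_mul_of_nonneg_left h1 h4.le
  push_cast at h5
  have h6 : b / √(r₀ ^ (d + 1)) * (1 - (d + 1) / 2 * (u / r₀ - 1))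
      = b / √(r₀ ^ (d + 1)) - a * u + a * r₀ := by
    rw [mul_sub, ← mul_assoc, h3]
    field_simp
    ring
  rw [h6] at h5
  linarith

end OptimalRadius

end GraphCut

end

/-! ### The limits for the three kinds of weights -/

theorem theorem2 {d : ℕ} (hd : 1 ≤ d) {Ω : Type*} [MeasurableSpace Ω] (P : Measure Ω)
    [IsProbabilityMeasure P] (p : GraphCut.E d → ℝ) (C : Set (GraphCut.E d))
    (S : GraphCut.Hyperplane d) (hpCS : GraphCut.GeneralAssumptions p C S)
    (X : ℕ → Ω → GraphCut.E d) (hX : GraphCut.IsIIDSample P p X) (q : GraphCut.Quality) :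
    -- unit weights: convergence
    (∀ r : ℕ → ℝ, (∀ n, 0 < r n) → Tendsto r atTop (𝓝 0) →
      Tendsto (fun n : ℕ => n * r n ^ (d + 1) / Real.log n) atTop atTop →
      ∀ᵐ ω ∂P, Tendsto
        (fun n => GraphCut.deviation q .unweighted p S n (r n) (fun i => X i ω)) atTop (𝓝 0)) ∧
    -- unit weights: rate of convergence
    ((d = 1 → (frontier C).Finite) →
      (∀ r₀ : ℝ, 0 < r₀ → ∃ K : ℝ, ∀ᵐ ω ∂P, ∀ᶠ n : ℕ in atTop,
        GraphCut.deviation q .unweighted p S n (r₀ * GraphCut.rate d n) (fun i => X i ω)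
          ≤ K * GraphCut.rate d n) ∧
      -- optimality of this choice of the radius for the bound on the deviation
      ∃ a b : ℝ, 0 < a ∧ 0 < b ∧
        (∀ r : ℕ → ℝ, (∀ n, 0 < r n) → Tendsto r atTop (𝓝 0) →
          Tendsto (fun n : ℕ => n * r n ^ (d + 1) / Real.log n) atTop atTop →
          ∀ᵐ ω ∂P, ∀ᶠ n : ℕ in atTop,
            GraphCut.deviation q .unweighted p S n (r n) (fun i => X i ω)
              ≤ GraphCut.errorBound d a b n (r n)) ∧
        ∃ r₀ : ℝ, 0 < r₀ ∧ ∀ n : ℕ, 2 ≤ n →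
          IsMinOn (GraphCut.errorBound d a b n) (Ioi 0) (r₀ * GraphCut.rate d n)) ∧
    -- Gaussian weights, bandwidth dominated by the radius
    (∀ r σ : ℕ → ℝ, (∀ n, 0 < r n) → (∀ n, 0 < σ n) → Tendsto r atTop (𝓝 0) →
      Tendsto σ atTop (𝓝 0) → Tendsto (fun n => r n / σ n) atTop atTop →
      Tendsto (fun n : ℕ => n * σ n ^ (d + 1) / Real.log n) atTop atTop →
      ∀ᵐ ω ∂P, Tendsto
        (fun n => GraphCut.deviation q (.gaussianLargeRadius (σ n)) p S n (r n) (fun i => X i ω))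
        atTop (𝓝 0)) ∧
    -- Gaussian weights, radius dominated by the bandwidth
    (∀ r σ : ℕ → ℝ, (∀ n, 0 < r n) → (∀ n, 0 < σ n) → Tendsto r atTop (𝓝 0) →
      Tendsto σ atTop (𝓝 0) → Tendsto (fun n => r n / σ n) atTop (𝓝 0) →
      Tendsto (fun n : ℕ => n * r n ^ (d + 1) / Real.log n) atTop atTop →
      ∀ᵐ ω ∂P, Tendsto
        (fun n => GraphCut.deviation q (.gaussianSmallRadius (σ n)) p S n (r n) (fun i => X i ω))
        atTop (𝓝 0)) := by
  open GraphCut in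
  obtain ⟨k, rfl⟩ : ∃ k, d = k + 1 := ⟨d - 1, by omega⟩
  refine ⟨fun r hr hr0 hlim => ?_, fun hfin => ?_, fun r σ hr hσ hr0 hσ0 hrσ hlim => ?_,
    fun r σ hr hσ hr0 hσ0 hrσ hlim => ?_⟩
  · refine ae_tendsto_deviation hpCS hX q (W := fun _ => .unweighted) (M := fun _ => 1)
      (sc := fun n => r n ^ (k + 2)) (sv := fun n => r n ^ (k + 1)) (ρ := fun n => r n ^ (k + 2))
      (ballVolume_pos (k + 1)) (fun _ => measurable_const) (fun _ _ => zero_le_one)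
      (fun _ => one_pos) (fun _ _ => le_rfl) hr hr0 (fun n => pow_pos (hr n) _)
      (fun n => pow_pos (hr n) _) (fun n => ⟨rfl, rfl⟩) (fun _ => rfl) (fun _ => rfl) ?_ ?_
      (fun n => pow_pos (hr n) _) ?_ (Eventually.of_forall fun n => (one_mul _).le) ?_ hlim
    · exact tendsto_const_nhds.congr fun n => (kernelWidth_one_div (hr n) S).symm
    · exact tendsto_const_nhds.congr fun n => (kernelMass_one_div (k + 1) (hr n)).symm
    · filter_upwards [hr0.eventually_le_const one_pos] with n hn using pow_le_one₀ (hr n).le hn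
    · filter_upwards [hr0.eventually_le_const one_pos] with n hn
      rw [one_mul]
      exact pow_le_pow_of_le_one (hr n).le hn (by omega)
  · obtain ⟨a, b, ha, hb, hab⟩ :=
      exists_ae_eventually_deviation_le_errorBound hpCS hfin hX q
    refine ⟨fun r₀ hr₀ => ⟨a * r₀ + b / √(r₀ ^ (k + 1 + 1)), ?_⟩, a, b, ha, hb,
      fun r hr => hab r (Eventually.of_forall hr), exists_isMinOn_errorBound ha hb⟩
    have hpos : ∀ᶠ n in atTop, 0 < r₀ * rate (k + 1) n := by
      filter_upwards [eventually_ge_atTop 2] with n hn using mul_pos hr₀ (rate_pos hn)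
    filter_upwards [hab _ hpos (by simpa using (tendsto_rate (d := k + 1)).const_mul r₀)
      (tendsto_mul_rate_pow_div_log hr₀)] with ω hω
    filter_upwards [hω, eventually_ge_atTop 2] with n hn hn2
    rw [errorBound_mul_rate a b hn2 hr₀] at hn
    exact hn.trans_eq (mul_comm _ _)
  · -- the supremum of the weights is `O(σ ^ (-d))`, whence the fluctuation scale `ρ = σ ^ (d + 1)`
    have hσ1 : ∀ᶠ n in atTop, σ n ≤ 1 := hσ0.eventually_le_const one_pos
    have hMρ : ∀ n, gaussianMax (k + 1) (σ n) * σ n ^ (k + 2) ≤ σ n := fun n => by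
      have h1 := hσ n
      calc gaussianMax (k + 1) (σ n) * σ n ^ (k + 2)
          ≤ (σ n ^ (k + 1))⁻¹ * σ n ^ (k + 2) := by
            gcongr
            exact gaussianMax_le _ h1
        _ = σ n := by
          rw [pow_succ (σ n) (k + 1)]
          field_simp
    refine ae_tendsto_deviation hpCS hX q (W := fun n => .gaussianLargeRadius (σ n))
      (M := fun n => gaussianMax (k + 1) (σ n)) (sc := σ) (sv := fun _ => 1)
      (ρ := fun n => σ n ^ (k + 2)) one_pos (fun _ => measurable_gaussianWeight)
      (fun n => gaussianWeight_nonneg (hσ n)) (fun n => gaussianMax_pos _ (hσ n))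
      (fun n => gaussianWeight_le (hσ n)) hr hr0 hσ (fun _ => one_pos)
      (fun n => ⟨rfl, (mul_one _).symm⟩) (fun _ => rfl) (fun _ => rfl) ?_ ?_
      (fun n => pow_pos (hσ n) _) ?_ (Eventually.of_forall hMρ) ?_ hlim
    · have h1 := (tendsto_integral_gaussian_large S.continuous_width.measurable
        (integrable_gaussianWeight_one_mul_width S)).comp hrσ
      rw [integral_gaussianWeight_one_mul_width] at h1
      have h2 := h1.const_mul 2
      rw [mul_one_div] at h2
      refine h2.congr fun n => ?_
      have h3 := integral_gaussian_scale (r := r n) (hσ n) (τ := S.width) (j := 1) fun z => by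
        have := (hσ n).le
        rw [Hyperplane.width, Hyperplane.width, inner_smul_right, pow_one,
          mul_max_of_nonneg _ _ this, mul_zero, mul_neg]
      have h4 := (hσ n).ne'
      simp only [Function.comp_apply, kernelWidth, Weighting.weight]
      rw [h3]
      field_simp
    · have h1 := (tendsto_integral_gaussian_large (d := k + 1) (τ := fun _ => 1) measurable_const
        (by
          simp only [mul_one, gaussianWeight_one_eq]
          exact (integrable_exp_neg_mul_norm_sq (by norm_num)).const_mul _)).comp hrσ
      simp only [mul_one, integral_gaussianWeight_one] at h1
      refine h1.congr fun n => ?_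
      have h3 := integral_gaussian_scale (d := k + 1) (r := r n) (hσ n) (τ := fun _ => 1) (j := 0)
        fun z => by simp
      simp only [mul_one, pow_zero, one_mul] at h3
      simp only [Function.comp_apply, kernelMass, Weighting.weight, div_one]
      rw [h3]
    · filter_upwards [hσ1] with n hn using pow_le_one₀ (hσ n).le hn
    · filter_upwards [hσ1] with n hn using (hMρ n).trans hn
  · -- after division by `σ ^ (-d)` the weights are nearly constant, and the scales are those of
    -- unit weights
    have hr1 : ∀ᶠ n in atTop, r n ≤ 1 := hr0.eventually_le_const one_pos
    have hMρ : ∀ n, gaussianMax (k + 1) (σ n) * r n ^ (k + 2)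
        ≤ (σ n ^ (k + 1))⁻¹ * r n ^ (k + 2) := fun n => by
      have h1 := hr n
      gcongr
      exact gaussianMax_le _ (hσ n)
    have hpos : ∀ n j, 0 < (σ n ^ (k + 1))⁻¹ * r n ^ j := fun n j =>
      mul_pos (inv_pos.2 (pow_pos (hσ n) _)) (pow_pos (hr n) _)
    refine ae_tendsto_deviation hpCS hX q (W := fun n => .gaussianSmallRadius (σ n))
      (M := fun n => gaussianMax (k + 1) (σ n)) (sc := fun n => (σ n ^ (k + 1))⁻¹ * r n ^ (k + 2))
      (sv := fun n => (σ n ^ (k + 1))⁻¹ * r n ^ (k + 1))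
      (ρ := fun n => r n ^ (k + 2)) (div_pos (ballVolume_pos (k + 1)) (by positivity))
      (fun _ => measurable_gaussianWeight)
      (fun n => gaussianWeight_nonneg (hσ n)) (fun n => gaussianMax_pos _ (hσ n))
      (fun n => gaussianWeight_le (hσ n)) hr hr0 (fun n => hpos n _) (fun n => hpos n _)
      (fun n => ⟨?_, ?_⟩) (fun _ => rfl) (fun _ => rfl) ?_ ?_
      (fun n => pow_pos (hr n) _) ?_ (Eventually.of_forall hMρ) ?_ hlim
    · simp only [Weighting.cutScale]; ring
    · simp only [Weighting.volScale]; ring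
    · have h1 := (tendsto_integral_gaussian_small hσ hrσ S.continuous_width.measurable
        S.width_nonneg (T := r) (fun n z hz => (S.width_le_norm z).trans hz)
        (fun n => pow_pos (hr n) (k + 2)) fun n => kernelWidth_one (hr n).le S).const_mul 2
      have h2 : 2 * (ballVolume k / (k + 2) / (2 * Real.pi) ^ (((k + 1 : ℕ) : ℝ) / 2))
          = (Weighting.gaussianSmallRadius (σ 0)).cutFactor (k + 1) := by
        simp only [Weighting.cutFactor, Nat.add_sub_cancel]
        push_cast
        rw [div_div, ← mul_div_assoc]
        congr 2
        ring
      rw [h2] at h1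
      refine h1.congr fun n => ?_
      rw [mul_div_assoc]
      rfl
    · have h1 := tendsto_integral_gaussian_small (d := k + 1) (τ := fun _ => 1) hσ hrσ
        measurable_const (fun _ => zero_le_one) (T := fun _ => 1) (fun _ _ _ => le_rfl)
        (fun n => pow_pos (hr n) (k + 1)) (c := ballVolume (k + 1)) fun n => by
          simp only [mul_one]
          exact kernelMass_one (k + 1) (hr n).le
      simp only [mul_one] at h1
      exact h1
    · filter_upwards [hr1] with n hn using pow_le_one₀ (hr n).le hn
    · filter_upwards [hr1] with n hn
      refine (hMρ n).trans (mul_le_mul_of_nonneg_left ?_ (inv_pos.2 (pow_pos (hσ n) _)).le)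
      exact pow_le_pow_of_le_one (hr n).le hn (by omega)
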